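/- Let $k$ be a field of characteristic $0$ with algebraic closure $\bar k$. Let $S$ be a non-trivial Severi--Brauer surface over $k$, that is, an integral separated $k$-scheme of finite type such that $S\otimes_k\bar k\cong\mathbb{P}^2_{\bar k}$ over $\bar k$ but $S\not\cong\mathbb{P}^2_k$ over $k$. Let $n\ge 2$, and let $G\subset\mathrm{Aut}_k(S)$ be a finite subgroup that is cyclic of order $n$. Then the fixed locus of $G$ consists of exactly three isolated geometric points: exactly three elements of $S(\bar k)$ are fixed by $G$, and the fixed locus of $G$ on $S\otimes_k\bar k$ (the set of scheme points that are fixed by every $g\in G$ with trivial action on the residue field) consists exactly of the corresponding three points and is discrete in the subspace topology. If moreover $n>3$, then these three geometric points are defined over one common Galois extension $K/k$ of degree $3$, $k\subset K\subset\bar k$, with $\mathrm{Gal}(K/k)$ cyclic. -/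

import Mathlib

open CategoryTheory CategoryTheory.Limits AlgebraicGeometry

universe u

noncomputable section

namespace SeveriBrauer

attribute [local instance] MvPolynomial.gradedAlgebra

/-- The spectrum of a field (or ring). -/
abbrev SpecOf (k : Type u) [CommRing k] : Scheme.{u} := Spec (CommRingCat.of k)

/-- The morphism of spectra given by a `k`-algebra `L`. -/
abbrev specAlgebraMap (k L : Type u) [CommRing k] [CommRing L] [Algebra k L] :
    SpecOf L ⟶ SpecOf k :=
  Spec.map (CommRingCat.ofHom (algebraMap k L))

/-- Projective `d`-space over `k`: the scheme `Proj k[x₀, …, x_d]` for the grading by degree, with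
its structure morphism to `Spec k`. -/
def projectiveSpace (k : Type u) [CommRing k] (d : ℕ) : Over (SpecOf k) :=
  Over.mk
    (Proj.toSpecZero (MvPolynomial.homogeneousSubmodule (Fin (d + 1)) k) ≫
      Spec.map (CommRingCat.ofHom
        (algebraMap k (MvPolynomial.homogeneousSubmodule (Fin (d + 1)) k 0))))

variable {k : Type u} [Field k]

/-- A variety over `k`: an integral separated scheme of finite type over `k`. -/
structure IsVariety (X : Over (SpecOf k)) : Prop where
  isIntegral : IsIntegral X.left
  isSeparated : IsSeparated X.hom
  locallyOfFiniteType : LocallyOfFiniteType X.hom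
  quasiCompact : QuasiCompact X.hom

variable (k) in
/-- Base change `X ↦ X ⊗ k̄` from `k` to its algebraic closure. -/
abbrev geomBaseChange : Over (SpecOf k) ⥤ Over (SpecOf (AlgebraicClosure k)) :=
  Over.pullback (specAlgebraMap k (AlgebraicClosure k))

/-- A `d`-dimensional Severi–Brauer variety over `k`: a variety `X` over `k` such that `X ⊗ k̄` is
isomorphic, over `k̄`, to projective `d`-space. -/
structure IsSeveriBrauer (d : ℕ) (X : Over (SpecOf k)) : Prop where
  isVariety : IsVariety X
  nonempty_iso : Nonempty ((geomBaseChange k).obj X ≅ projectiveSpace (AlgebraicClosure k) d)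

/-- A Severi–Brauer surface. -/
abbrev IsSeveriBrauerSurface (S : Over (SpecOf k)) : Prop := IsSeveriBrauer 2 S

/-- `X` is trivial (of dimension `d`) if it is isomorphic over `k` to projective `d`-space. -/
def IsTrivial (d : ℕ) (X : Over (SpecOf k)) : Prop :=
  Nonempty (X ≅ projectiveSpace k d)

/-- The `L`-points of `X`: the morphisms `Spec L ⟶ X` over `k`. -/
abbrev Points (X : Over (SpecOf k)) (L : Type u) [Field L] [Algebra k L] : Type u :=
  Over.mk (specAlgebraMap k L) ⟶ X

/-- The geometric points of `X`. -/
abbrev GeomPoint (X : Over (SpecOf k)) : Type u := Points X (AlgebraicClosure k)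

/-- The (closed) point of the scheme `X ⊗ k̄` that corresponds to a geometric point of `X`: the
image of the unique point of `Spec k̄` under the morphism `Spec k̄ ⟶ X ⊗ k̄` over `k̄` induced by
the geometric point. -/
def GeomPoint.toBaseChange {X : Over (SpecOf k)} (p : GeomPoint X) :
    ((geomBaseChange k).obj X).left :=
  (pullback.lift p.left (𝟙 (SpecOf (AlgebraicClosure k))) (by simp) :
    SpecOf (AlgebraicClosure k) ⟶ pullback X.hom (specAlgebraMap k (AlgebraicClosure k)))
    (⊥ : PrimeSpectrum (AlgebraicClosure k))

/-- The geometric points of `X` that are fixed by every element of a group `G` of automorphisms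
of `X` over `k`. -/
def fixedGeomPoints {X : Over (SpecOf k)} (G : Subgroup (Aut X)) : Set (GeomPoint X) :=
  {p | ∀ g ∈ G, p ≫ g.hom = p}

/-- The fixed locus of `G` in `X ⊗ k̄`, as a subset of the underlying space of that scheme: the
points `x` such that every `g ∈ G` maps `x` to itself and acts trivially on the residue field
at `x`. -/
def fixedLocus {X : Over (SpecOf k)} (G : Subgroup (Aut X)) :
    Set ((geomBaseChange k).obj X).left :=
  {x | ∀ g ∈ G,
    ((geomBaseChange k).obj X).left.fromSpecResidueField x ≫ ((geomBaseChange k).map g.hom).left =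
      ((geomBaseChange k).obj X).left.fromSpecResidueField x}

/-- A geometric point of `X` is defined over a subextension `K / k` of `k̄ / k` if, as a morphism
`Spec k̄ ⟶ X`, it factors through a `K`-point of `X`. -/
def GeomPoint.IsDefinedOver {X : Over (SpecOf k)} (p : GeomPoint X)
    (K : IntermediateField k (AlgebraicClosure k)) : Prop :=
  ∃ q : Points X K, p.left = specAlgebraMap K (AlgebraicClosure k) ≫ q.left

end SeveriBrauer

end

/-! Over `k̄` the surface is a projective plane. Let `V` be its three-dimensional space of linear
forms. Every automorphism of the plane that is semilinear over an automorphism of `k̄` lifts to a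
semilinear bijection of `V`, unique up to a scalar (`exists_isLift`, `IsLift.exists_eq_smul`). The
plane is studied through its function field and local rings, embedded in the fraction field of
ternary polynomials (`PlaneCoords`), so that the Galois action and the automorphisms of `S` are
treated alike.

Nontriviality of `S` is used in one form: no line of the plane is Galois-stable (`exists_not_smul`).
If the Galois group preserved a linear form `w` up to scalars, the lifts could be normalised to fix
`w`. They would then form a genuine semilinear action, Galois descent would give an invariant basis
of `V`, and `S` would be the plane over `k` (`exists_isRational`,
`PlaneCoords.IsRational.isTrivial`).

Let `g` generate `G`. The `n`-th power of a lift of `g` is scalar, so the lift is diagonalisable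
(`exists_diagonal`). Since the Galois action commutes with `g`, it permutes the eigenspaces. If
exactly two eigenvalues agreed, the third eigenvector would be a Galois-stable line; if all agreed,
`g` would be trivial. So the eigenvalues `e i` are distinct (`IsLift.eigenvalue_injective`), and the
fixed points are the vertices of the triangle of eigenvectors (`IsLift.fixed_iff_isVertex`).

The Galois group permutes the sides of this triangle through a homomorphism `Γ` with `e (Γ σ i) = t
* σ (e i)`. The ratios `e i / e 0` are `n`-th roots of unity, on which commutators act trivially, so
a commutator permutes the eigenvalues by a common factor. A nontrivial permutation of this kind
makes the cubes of the eigenvalues equal, that is, `g ^ 3 = 1`. Hence for `n > 3` the image of `Γ`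
is commutative (`commute_of_eq_mul`). It has no common fixed letter, so its order is three
(`card_eq_three_of_commute`), and `K` is the fixed field of the kernel. -/

noncomputable section

namespace SeveriBrauer

attribute [local instance] MvPolynomial.gradedAlgebra

/-! ### Function fields and local rings of integral schemes -/

section FunctionField

variable {X Y Z B : Scheme.{u}} [IsIntegral X] [IsIntegral Y] [IsIntegral Z]

variable (X) in
/-- The generic point of an integral scheme, as a morphism from the spectrum of its function
field. -/
abbrev fromSpecFunctionField : Spec X.functionField ⟶ X := X.fromSpecStalk (genericPoint X)

/-- The stalk at a point of an integral scheme, as a subring of the function field. -/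
def stalkSubring (x : X) : Subring X.functionField :=
  (algebraMap (X.presheaf.stalk x) X.functionField).range

lemma mem_stalkSubring_iff {x : X} {f : X.functionField} :
    f ∈ stalkSubring x ↔ ∃ s : X.presheaf.stalk x,
      X.presheaf.stalkSpecializes ((genericPoint_spec X).specializes trivial) s = f :=
  Iff.rfl

lemma genericPoint_map (f : X ⟶ Y) [IsDominant f] : f (genericPoint X) = genericPoint Y := by
  have h : IsGenericPoint (f (genericPoint X)) (closure (f '' Set.univ)) :=
    (genericPoint_spec X).image f.continuous
  rw [Set.image_univ, f.denseRange.closure_range] at h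
  exact h.eq (genericPoint_spec Y)

/-- The map of function fields induced by a dominant morphism. -/
def functionFieldMap (f : X ⟶ Y) [IsDominant f] : Y.functionField →+* X.functionField :=
  (Y.presheaf.stalkSpecializes (Inseparable.of_eq (genericPoint_map f)).specializes ≫
    f.stalkMap (genericPoint X)).hom

lemma SpecMap_functionFieldMap (f : X ⟶ Y) [IsDominant f] :
    Spec.map (CommRingCat.ofHom (functionFieldMap f)) ≫ fromSpecFunctionField Y =
      fromSpecFunctionField X ≫ f := by
  rw [functionFieldMap, CommRingCat.ofHom_hom, Spec.map_comp, Category.assoc,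
    Scheme.SpecMap_stalkSpecializes_fromSpecStalk, Scheme.SpecMap_stalkMap_fromSpecStalk]

lemma functionFieldMap_unique (f : X ⟶ Y) [IsDominant f] (θ : Y.functionField →+* X.functionField)
    (h : Spec.map (CommRingCat.ofHom θ) ≫ fromSpecFunctionField Y =
      fromSpecFunctionField X ≫ f) : θ = functionFieldMap f := by
  rw [← SpecMap_functionFieldMap, cancel_mono] at h
  simpa using congr(($(Spec.map_injective h)).hom)

lemma functionFieldMap_comp (f : X ⟶ Y) (g : Y ⟶ Z) [IsDominant f] [IsDominant g]
    [IsDominant (f ≫ g)] :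
    functionFieldMap (f ≫ g) = (functionFieldMap f).comp (functionFieldMap g) := by
  refine (functionFieldMap_unique _ _ ?_).symm
  rw [CommRingCat.ofHom_comp, Spec.map_comp, Category.assoc, SpecMap_functionFieldMap,
    reassoc_of% SpecMap_functionFieldMap]

lemma functionFieldMap_comp_apply (f : X ⟶ Y) (g : Y ⟶ Z) [IsDominant f] [IsDominant g]
    [IsDominant (f ≫ g)] (a : Z.functionField) :
    functionFieldMap (f ≫ g) a = functionFieldMap f (functionFieldMap g a) := by
  rw [functionFieldMap_comp]; rfl

lemma functionFieldMap_congr {f g : X ⟶ Y} [IsDominant f] [IsDominant g] (h : f = g) :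
    functionFieldMap f = functionFieldMap g := by
  subst h; rfl

lemma functionFieldMap_id [IsDominant (𝟙 X)] : functionFieldMap (𝟙 X) = RingHom.id _ := by
  refine (functionFieldMap_unique _ _ ?_).symm
  rw [CommRingCat.ofHom_id, Spec.map_id, Category.id_comp, Category.comp_id]

lemma stalkSpecializes_functionFieldMap (f : X ⟶ Y) [IsDominant f] (x : X)
    (s : Y.presheaf.stalk (f x)) :
    functionFieldMap f (Y.presheaf.stalkSpecializes ((genericPoint_spec Y).specializes trivial) s) =
      X.presheaf.stalkSpecializes ((genericPoint_spec X).specializes trivial) (f.stalkMap x s) := by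
  have h := Scheme.Hom.stalkSpecializes_stalkMap f _ _
    ((genericPoint_spec X).specializes (Set.mem_univ x))
  have h2 := congr(($h).hom s)
  simp only [CommRingCat.hom_comp, RingHom.comp_apply] at h2
  rw [← h2, functionFieldMap]
  simp only [CommRingCat.hom_comp, RingHom.comp_apply]
  congr 1
  rw [← CommRingCat.comp_apply, TopCat.Presheaf.stalkSpecializes_comp]

lemma functionFieldMap_mem_stalkSubring (f : X ⟶ Y) [IsDominant f] (x : X) {a : Y.functionField}
    (h : a ∈ stalkSubring (f x)) : functionFieldMap f a ∈ stalkSubring x := by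
  obtain ⟨s, rfl⟩ := mem_stalkSubring_iff.1 h
  rw [stalkSpecializes_functionFieldMap]
  exact mem_stalkSubring_iff.2 ⟨_, rfl⟩

/-- A flat local homomorphism is faithfully flat, so ideals are contractions of their extensions. If
`b / c` becomes regular upstairs, then `b` lies in the extension of the ideal of `c`, hence already
in that ideal. -/
lemma functionFieldMap_mem_stalkSubring_iff (f : X ⟶ Y) [IsDominant f] [Flat f] (x : X)
    {a : Y.functionField} :
    functionFieldMap f a ∈ stalkSubring x ↔ a ∈ stalkSubring (f x) := by
  refine ⟨fun h ↦ ?_, functionFieldMap_mem_stalkSubring f x⟩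
  obtain ⟨b, c, hc, rfl⟩ := IsFractionRing.div_surjective (A := Y.presheaf.stalk (f x)) a
  have hc0 : c ≠ 0 := nonZeroDivisors.ne_zero hc
  have hc1 : algebraMap (Y.presheaf.stalk (f x)) Y.functionField c ≠ 0 := by
    simpa using hc0
  obtain ⟨d, hd⟩ := h
  let := (f.stalkMap x).hom.toAlgebra
  have hflat : Module.Flat (Y.presheaf.stalk (f x)) (X.presheaf.stalk x) := Flat.stalkMap f x
  have : IsLocalHom (algebraMap (Y.presheaf.stalk (f x)) (X.presheaf.stalk x)) :=
    inferInstanceAs (IsLocalHom (f.stalkMap x).hom)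
  have hff : Module.FaithfullyFlat (Y.presheaf.stalk (f x)) (X.presheaf.stalk x) :=
    Module.FaithfullyFlat.of_flat_of_isLocalHom
  have key (z) : functionFieldMap f (algebraMap (Y.presheaf.stalk (f x)) Y.functionField z) =
      algebraMap (X.presheaf.stalk x) X.functionField (f.stalkMap x z) :=
    stalkSpecializes_functionFieldMap f x z
  have hmul : f.stalkMap x b = d * f.stalkMap x c := by
    apply IsFractionRing.injective (X.presheaf.stalk x) X.functionField
    rw [map_mul, hd, ← key, ← key, ← map_mul, div_mul_cancel₀ _ hc1]
  have hb : b ∈ Ideal.comap (algebraMap _ (X.presheaf.stalk x))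
      (Ideal.map (algebraMap _ (X.presheaf.stalk x)) (Ideal.span {c})) := by
    rw [Ideal.mem_comap, Ideal.map_span, Set.image_singleton, Ideal.mem_span_singleton']
    exact ⟨d, hmul.symm⟩
  rw [Ideal.comap_map_eq_self_of_faithfullyFlat, Ideal.mem_span_singleton'] at hb
  obtain ⟨e, rfl⟩ := hb
  rw [map_mul, mul_div_cancel_right₀ _ hc1]
  exact ⟨e, rfl⟩

-- Agreement at the generic point spreads out to a nonempty open set, which is dense; separatedness
-- does the rest.
omit [IsIntegral Y] in
lemma eq_of_fromSpecFunctionField_comp_eq {f g : X ⟶ Y} (s : Y ⟶ B) [IsSeparated s]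
    (hs : f ≫ s = g ≫ s)
    (h : fromSpecFunctionField X ≫ f = fromSpecFunctionField X ≫ g) : f = g := by
  obtain ⟨U, hU, hUe⟩ := spread_out_unique_of_isGermInjective' f g h
  have : IsDominant U.ι := by
    refine ⟨?_⟩
    rw [DenseRange, Scheme.Opens.range_ι]
    exact U.2.dense ⟨_, hU⟩
  exact ext_of_isDominant_of_isSeparated s hs U.ι hUe

lemma exists_stalk_hom (θ : Y.functionField ⟶ X.functionField) {x : X} {y : Y}
    (h : ∀ a ∈ stalkSubring y, θ a ∈ stalkSubring x) :
    ∃ φ : Y.presheaf.stalk y ⟶ X.presheaf.stalk x,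
      φ ≫ X.presheaf.stalkSpecializes ((genericPoint_spec X).specializes trivial) =
        Y.presheaf.stalkSpecializes ((genericPoint_spec Y).specializes trivial) ≫ θ := by
  let e : X.presheaf.stalk x ≃+* stalkSubring x :=
    RingEquiv.ofBijective (algebraMap _ X.functionField).rangeRestrict
      ⟨fun a b hab ↦ IsFractionRing.injective (X.presheaf.stalk x) X.functionField
        congr(($hab : X.functionField)), RingHom.rangeRestrict_surjective _⟩
  let ψ : Y.presheaf.stalk y →+* stalkSubring x :=
    (θ.hom.comp (Y.presheaf.stalkSpecializes
      ((genericPoint_spec Y).specializes trivial)).hom).codRestrict _ fun s ↦ h _ ⟨s, rfl⟩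
  refine ⟨CommRingCat.ofHom (e.symm.toRingHom.comp ψ), ?_⟩
  ext s
  have : ((e (e.symm (ψ s)) : stalkSubring x) : X.functionField) = (ψ s : X.functionField) := by
    rw [RingEquiv.apply_symm_apply]
  exact this

lemma isDominant_SpecMap_of_injective {R R' : CommRingCat.{u}} (φ : R ⟶ R')
    (h : Function.Injective φ) : IsDominant (Spec.map φ) :=
  ⟨(PrimeSpectrum.denseRange_comap_iff_ker_le_nilRadical φ.hom).2
    (by rw [(RingHom.injective_iff_ker_eq_bot _).1 h]; exact bot_le)⟩

/-- A morphism of function fields that maps a local ring of `Y` into each local ring of `X` comes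
from a morphism `X ⟶ Y`. -/
lemma exists_hom_of_functionField (sX : X ⟶ B) (sY : Y ⟶ B) [LocallyOfFiniteType sY]
    [Y.IsSeparated] [B.IsSeparated] (θ : Y.functionField ⟶ X.functionField)
    (hθ : Spec.map θ ≫ fromSpecFunctionField Y ≫ sY = fromSpecFunctionField X ≫ sX)
    (h : ∀ x : X, ∃ y : Y, ∀ a ∈ stalkSubring y, θ a ∈ stalkSubring x) :
    ∃ f : X ⟶ Y, f ≫ sY = sX ∧
      fromSpecFunctionField X ≫ f = Spec.map θ ≫ fromSpecFunctionField Y := by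
  let F : X ⤏ Y := .ofFunctionField sX sY (Spec.map θ ≫ fromSpecFunctionField Y)
    (by rw [Category.assoc]; exact hθ)
  have hF : F.fromFunctionField = Spec.map θ ≫ fromSpecFunctionField Y :=
    Scheme.RationalMap.fromFunctionField_ofFunctionField ..
  have hdom : F.domain = ⊤ := by
    -- At each `x` the inclusion of local rings gives a morphism from the spectrum of the stalk to
    -- `Y`. It spreads out to a neighbourhood of `x`, because `sY` is locally of finite type, and
    -- agrees with `F` at the generic point.
    refine top_le_iff.1 fun x _ ↦ ?_
    obtain ⟨y, hy⟩ := h x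
    obtain ⟨φ, hφ⟩ := exists_stalk_hom θ hy
    let ιx : Spec X.functionField ⟶ Spec (X.presheaf.stalk x) :=
      Spec.map (X.presheaf.stalkSpecializes ((genericPoint_spec X).specializes trivial))
    let ιy : Spec Y.functionField ⟶ Spec (Y.presheaf.stalk y) :=
      Spec.map (Y.presheaf.stalkSpecializes ((genericPoint_spec Y).specializes trivial))
    have hιx : ιx ≫ X.fromSpecStalk x = fromSpecFunctionField X :=
      Scheme.SpecMap_stalkSpecializes_fromSpecStalk _
    have hιy : ιy ≫ Y.fromSpecStalk y = fromSpecFunctionField Y :=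
      Scheme.SpecMap_stalkSpecializes_fromSpecStalk _
    have hcomm : ιx ≫ Spec.map φ = Spec.map θ ≫ ιy := by
      simp only [ιx, ιy, ← Spec.map_comp, hφ]
    have hdx : IsDominant ιx :=
      isDominant_SpecMap_of_injective _
        (IsFractionRing.injective (X.presheaf.stalk x) X.functionField)
    have hover : (Spec.map φ ≫ Y.fromSpecStalk y) ≫ sY = X.fromSpecStalk x ≫ sX := by
      refine ext_of_isDominant ιx ?_
      rw [Category.assoc, reassoc_of% hcomm, reassoc_of% hιy, reassoc_of% hιx, hθ]
    let P := Scheme.PartialMap.ofFromSpecStalk sX sY _ hover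
    have hxP : x ∈ P.domain := Scheme.PartialMap.mem_domain_ofFromSpecStalk sX sY _ hover
    refine Scheme.RationalMap.mem_domain.2 ⟨P, hxP,
      Scheme.RationalMap.eq_of_fromFunctionField_eq _ _ ?_⟩
    have h1 : P.fromSpecStalkOfMem hxP = _ :=
      Scheme.PartialMap.fromSpecStalkOfMem_ofFromSpecStalk sX sY _ hover
    rw [hF, Scheme.RationalMap.fromFunctionField_toRationalMap, ← hιy, ← reassoc_of% hcomm, ← h1]
    simp only [Scheme.PartialMap.fromFunctionField, Scheme.PartialMap.fromSpecStalkOfMem]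
    rw [← Category.assoc]
    congr 1
    rw [← cancel_mono P.domain.ι]
    simp [hιx]
  let P := F.toPartialMap
  have hP : P.fromFunctionField = Spec.map θ ≫ fromSpecFunctionField Y := by
    rw [← hF, ← Scheme.RationalMap.fromFunctionField_toRationalMap]
    exact congr_arg _ F.toRationalMap_toPartialMap
  have hPd : P.domain = ⊤ := hdom
  have key : fromSpecFunctionField X ≫ (X.topIso.inv ≫ (X.isoOfEq hPd).inv ≫ P.hom) =
      Spec.map θ ≫ fromSpecFunctionField Y := by
    rw [← hP, Scheme.PartialMap.fromFunctionField, Scheme.PartialMap.fromSpecStalkOfMem]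
    simp only [← Category.assoc]
    congr 1
    rw [← cancel_mono P.domain.ι]
    simp
  refine ⟨_, ?_, key⟩
  have hdX : IsDominant (fromSpecFunctionField X) := by
    refine ⟨(?_ : DenseRange _)⟩
    refine (dense_iff_closure_eq.2 (genericPoint_spec X)).mono ?_
    rintro _ rfl
    exact ⟨_, Scheme.fromSpecStalk_closedPoint⟩
  refine ext_of_isDominant (fromSpecFunctionField X) ?_
  rw [← Category.assoc, key, Category.assoc, hθ]

end FunctionField

/-! ### The projective plane and its homogeneous coordinates -/

variable (F : Type u) [Field F]

/-- Ternary polynomials over `F`. -/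
abbrev Ternary := MvPolynomial (Fin 3) F

/-- The fraction field of the ring of ternary polynomials. -/
abbrev TernaryFrac := FractionRing (Ternary F)

/-- The grading of ternary polynomials by degree. -/
abbrev forms (n : ℕ) : Submodule F (Ternary F) := MvPolynomial.homogeneousSubmodule (Fin 3) F n

/-- The projective plane over `F`. -/
abbrev plane : Scheme.{u} := Proj (forms F)

variable {F}

/-- The quotient of two polynomials in the fraction field. -/
def quot (a b : Ternary F) : TernaryFrac F := algebraMap _ _ a / algebraMap _ _ b

lemma algebraMap_ternary_ne_zero {a : Ternary F} (h : a ≠ 0) :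
    algebraMap (Ternary F) (TernaryFrac F) a ≠ 0 := by
  simpa using h

lemma quot_eq_quot_iff {a b c d : Ternary F} (hb : b ≠ 0) (hd : d ≠ 0) :
    quot a b = quot c d ↔ a * d = c * b := by
  rw [quot, quot, div_eq_div_iff (algebraMap_ternary_ne_zero hb) (algebraMap_ternary_ne_zero hd),
    ← map_mul, ← map_mul]
  exact (IsFractionRing.injective (Ternary F) (TernaryFrac F)).eq_iff

lemma ne_zero_of_notMem {x : ProjectiveSpectrum (forms F)} {a : Ternary F}
    (h : a ∉ x.asHomogeneousIdeal) : a ≠ 0 := by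
  rintro rfl
  exact h (zero_mem _)

/-- The inclusion of the homogeneous localization at a point in the fraction field. -/
def homogVal (x : ProjectiveSpectrum (forms F)) :
    HomogeneousLocalization.AtPrime (forms F) x.asHomogeneousIdeal.toIdeal →+* TernaryFrac F :=
  (IsLocalization.lift (M := x.asHomogeneousIdeal.toIdeal.primeCompl)
    (S := Localization x.asHomogeneousIdeal.toIdeal.primeCompl)
    (g := algebraMap (Ternary F) (TernaryFrac F)) fun y ↦
      isUnit_iff_ne_zero.2 (algebraMap_ternary_ne_zero (ne_zero_of_notMem y.2))).comp
  (algebraMap _ (Localization x.asHomogeneousIdeal.toIdeal.primeCompl))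

lemma homogVal_mk (x : ProjectiveSpectrum (forms F)) (c) :
    homogVal x (.mk c) = quot (c.num : Ternary F) (c.den : Ternary F) := by
  have h0 : algebraMap _ (TernaryFrac F) (c.den : Ternary F) ≠ 0 :=
    algebraMap_ternary_ne_zero (ne_zero_of_notMem c.den_mem)
  rw [homogVal, RingHom.comp_apply, HomogeneousLocalization.algebraMap_apply,
    HomogeneousLocalization.val_mk, Localization.mk_eq_mk', quot, eq_div_iff h0, mul_comm]
  exact ((IsLocalization.lift_mk'_spec
    (M := x.asHomogeneousIdeal.toIdeal.primeCompl)
    (S := Localization x.asHomogeneousIdeal.toIdeal.primeCompl)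
    (g := algebraMap (Ternary F) (TernaryFrac F)) _ _ _ _).1 rfl).symm

/-- The value of a germ in the fraction field. -/
def stalkVal (x : plane F) : (plane F).presheaf.stalk x →+* TernaryFrac F :=
  (homogVal x).comp (Proj.stalkIso (forms F) x).hom.hom

lemma stalkVal_germ (U : (plane F).Opens) (x : plane F) (hx : x ∈ U) (s : Γ(plane F, U)) :
    stalkVal x ((plane F).presheaf.germ U x hx s) = homogVal x (s.1 ⟨x, hx⟩) :=
  congr_arg (homogVal x) (Proj.stalkIso'_germ (forms F) U x hx s)

lemma exists_stalkVal_eq (x : plane F) (s : (plane F).presheaf.stalk x) :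
    ∃ n, ∃ a ∈ forms F n, ∃ b ∈ forms F n, b ∉ x.asHomogeneousIdeal ∧ stalkVal x s = quot a b := by
  obtain ⟨c, hc⟩ := HomogeneousLocalization.mk_surjective ((Proj.stalkIso (forms F) x).hom s)
  exact ⟨c.deg, c.num, c.num.2, c.den, c.den.2, c.den_mem,
    (congr_arg (homogVal x) hc).symm.trans (homogVal_mk x c)⟩

/-- A section is locally one fraction `a / b`, and this fraction is its value at both points. Thus
all local rings of the plane become subrings of the same fraction field. -/
lemma stalkVal_specializes {x y : plane F} (h : x ⤳ y) (s : (plane F).presheaf.stalk y) :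
    stalkVal x ((plane F).presheaf.stalkSpecializes h s) = stalkVal y s := by
  obtain ⟨U, hyU, t, rfl⟩ := (plane F).presheaf.exists_germ_eq s
  have hxU : x ∈ U := h.mem_open U.2 hyU
  have : (plane F).presheaf.stalkSpecializes h ((plane F).presheaf.germ U y hyU t) =
      (plane F).presheaf.germ U x hxU t := by
    rw [← CommRingCat.comp_apply, TopCat.Presheaf.germ_stalkSpecializes]
  rw [this, stalkVal_germ, stalkVal_germ]
  obtain ⟨V, hyV, i, n, a, b, hb, e⟩ := t.2 ⟨y, hyU⟩
  have hxV : x ∈ V := h.mem_open V.2 hyV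
  have e1 := e ⟨x, hxV⟩
  have e2 := e ⟨y, hyV⟩
  exact ((congr_arg (homogVal x) e1).trans (homogVal_mk _ _)).trans
    ((congr_arg (homogVal y) e2).trans (homogVal_mk _ _)).symm

lemma exists_stalkVal_eq_quot (x : ProjectiveSpectrum (forms F)) {n : ℕ} {a b : Ternary F}
    (ha : a ∈ forms F n) (hb : b ∈ forms F n) (hbx : b ∉ x.asHomogeneousIdeal) :
    ∃ s, stalkVal (F := F) x s = quot a b := by
  let c : HomogeneousLocalization.NumDenSameDeg (forms F) x.asHomogeneousIdeal.toIdeal.primeCompl :=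
    ⟨n, ⟨a, ha⟩, ⟨b, hb⟩, hbx⟩
  refine ⟨(plane F).presheaf.germ (ProjectiveSpectrum.basicOpen (forms F) b) x hbx
    (sectionInBasicOpen (forms F) x c), ?_⟩
  exact (stalkVal_germ _ _ _ _).trans (homogVal_mk x c)

lemma X_mem_irrelevant (i : Fin 3) :
    (MvPolynomial.X i : Ternary F) ∈ HomogeneousIdeal.irrelevant (forms F) := by
  rw [HomogeneousIdeal.mem_irrelevant_iff, GradedRing.proj_apply,
    DirectSum.decompose_of_mem_ne (i := 1) _ (MvPolynomial.isHomogeneous_X F i) one_ne_zero]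

variable (F) in
/-- The generic point of the projective plane. -/
def planeGeneric : ProjectiveSpectrum (forms F) where
  asHomogeneousIdeal := ⊥
  isPrime := Ideal.isPrime_bot
  not_irrelevant_le h := MvPolynomial.X_ne_zero (R := F) (0 : Fin 3) (h (X_mem_irrelevant 0))

lemma specializes_iff_le {x y : plane F} :
    x ⤳ y ↔ x.asHomogeneousIdeal ≤ y.asHomogeneousIdeal := by
  rw [specializes_iff_mem_closure]
  exact (ProjectiveSpectrum.le_iff_mem_closure (𝒜 := forms F) x y).symm

lemma homogVal_injective (x : ProjectiveSpectrum (forms F)) :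
    Function.Injective (homogVal x) := by
  rw [injective_iff_map_eq_zero]
  intro a ha
  obtain ⟨c, rfl⟩ := HomogeneousLocalization.mk_surjective a
  rw [homogVal_mk, quot, div_eq_zero_iff, or_iff_left (algebraMap_ternary_ne_zero
    (ne_zero_of_notMem c.den_mem)), FaithfulSMul.algebraMap_eq_zero_iff] at ha
  rw [HomogeneousLocalization.ext_iff_val, HomogeneousLocalization.val_mk, ha,
    HomogeneousLocalization.val_zero, Localization.mk_zero]

lemma stalkVal_injective (x : plane F) : Function.Injective (stalkVal x) :=
  (homogVal_injective x).comp
    (ConcreteCategory.bijective_of_isIso (Proj.stalkIso (forms F) x).hom).1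

instance : IsIntegral (plane F) := by
  have (x : plane F) : IsDomain ((plane F).presheaf.stalk x) :=
    (stalkVal_injective x).isDomain
  have (x : plane F) : _root_.IsReduced ((plane F).presheaf.stalk x) := inferInstance
  have : IsReduced (plane F) := isReduced_of_isReduced_stalk _
  have : IrreducibleSpace (plane F) := by
    let η : plane F := planeGeneric F
    have : IsGenericPoint η Set.univ := by
      refine Set.eq_univ_of_forall fun x ↦ specializes_iff_mem_closure.1 ?_
      exact specializes_iff_le.2 (bot_le (α := HomogeneousIdeal (forms F)))
    exact (irreducibleSpace_def _).2 this.isIrreducible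
  exact isIntegral_of_irreducibleSpace_of_isReduced _

/-- The structure map of the function field of an integral scheme over `F`. -/
def constMap {X : Over (SpecOf F)} [IsIntegral X.left] : F →+* X.left.functionField :=
  (Spec.preimage (fromSpecFunctionField X.left ≫ X.hom)).hom

lemma SpecMap_constMap {X : Over (SpecOf F)} [IsIntegral X.left] :
    Spec.map (CommRingCat.ofHom (constMap (X := X))) = fromSpecFunctionField X.left ≫ X.hom :=
  Spec.map_preimage _

lemma functionFieldMap_constMap {F' : Type u} [Field F'] {X : Over (SpecOf F)}
    {Y : Over (SpecOf F')}
    [IsIntegral X.left] [IsIntegral Y.left] (f : X.left ⟶ Y.left) [IsDominant f] (σ : F' →+* F)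
    (h : f ≫ Y.hom = X.hom ≫ Spec.map (CommRingCat.ofHom σ)) (c : F') :
    functionFieldMap f (constMap c) = constMap (X := X) (σ c) := by
  suffices (functionFieldMap f).comp (constMap (X := Y)) = (constMap (X := X)).comp σ from
    RingHom.congr_fun this c
  suffices CommRingCat.ofHom ((functionFieldMap f).comp (constMap (X := Y))) =
    CommRingCat.ofHom ((constMap (X := X)).comp σ) by simpa using congr(($this).hom)
  apply Spec.map_injective
  rw [CommRingCat.ofHom_comp, CommRingCat.ofHom_comp, Spec.map_comp, Spec.map_comp,
    SpecMap_constMap, SpecMap_constMap, ← Category.assoc, SpecMap_functionFieldMap, Category.assoc,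
    h, Category.assoc]

/-- Homogeneous coordinates on a scheme: an embedding of its function field in the fraction field
of ternary polynomials, and an identification of its points with homogeneous prime ideals, with
local rings as on the projective plane. -/
structure PlaneCoords (X : Over (SpecOf F)) [IsIntegral X.left] where
  val : X.left.functionField →+* TernaryFrac F
  pt : X.left ≃ ProjectiveSpectrum (forms F)
  specializes_iff : ∀ x y, x ⤳ y ↔ (pt x).asHomogeneousIdeal ≤ (pt y).asHomogeneousIdeal
  val_mem : ∀ x, ∀ f ∈ stalkSubring x, ∃ n, ∃ a ∈ forms F n, ∃ b ∈ forms F n,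
    b ∉ (pt x).asHomogeneousIdeal ∧ val f = quot a b
  exists_val : ∀ x n, ∀ a ∈ forms F n, ∀ b ∈ forms F n, b ∉ (pt x).asHomogeneousIdeal →
    ∃ f ∈ stalkSubring x, val f = quot a b
  val_const : ∀ c, val (constMap c) = quot (MvPolynomial.C c) 1


lemma fromSpecStalk_toSpecZero (x : plane F) (hx : x ∈ Proj.basicOpen (forms F) 1) :
    (plane F).fromSpecStalk x ≫ Proj.toSpecZero (forms F) =
      Spec.map (CommRingCat.ofHom (HomogeneousLocalization.fromZeroRingHom (forms F) _) ≫
        Proj.awayToSection (forms F) 1 ≫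
          (plane F).presheaf.germ (Proj.basicOpen (forms F) 1) x hx) := by
  have h1 : (plane F).fromSpecStalk x ≫ (plane F).topIso.inv ≫
      ((plane F).isoOfEq (Proj.basicOpen_one (forms F))).inv =
        (Proj.basicOpen (forms F) 1).fromSpecStalkOfMem x hx := by
    rw [← cancel_mono (Proj.basicOpen (forms F) 1).ι]
    simp
  rw [Proj.toSpecZero, reassoc_of% h1, Proj.basicOpenToSpec, Category.assoc,
    Scheme.Opens.fromSpecStalkOfMem_toSpecΓ_assoc, ← Spec.map_comp, ← Spec.map_comp]
  rw [Category.assoc]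

variable (F) in
/-- The projective plane, as a scheme over `F`. -/
abbrev planeOver : Over (SpecOf F) :=
  Over.mk (Proj.toSpecZero (forms F) ≫ Spec.map (CommRingCat.ofHom (algebraMap F (forms F 0))))

instance : IsIntegral (planeOver F).left := inferInstanceAs (IsIntegral (plane F))

lemma stalkVal_constMap (c : F) :
    stalkVal (F := F) (genericPoint (plane F)) (constMap (X := planeOver F) c) =
      quot (MvPolynomial.C c) 1 := by
  have hx : genericPoint (plane F) ∈ Proj.basicOpen (forms F) 1 := by
    rw [Proj.basicOpen_one]; trivial
  have h2 : CommRingCat.ofHom (constMap (X := planeOver F)) =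
      CommRingCat.ofHom (algebraMap F (forms F 0)) ≫
      (CommRingCat.ofHom (HomogeneousLocalization.fromZeroRingHom (forms F) _) ≫
        Proj.awayToSection (forms F) 1 ≫
          (plane F).presheaf.germ (Proj.basicOpen (forms F) 1) _ hx) := by
    apply Spec.map_injective
    refine (SpecMap_constMap (X := planeOver F)).trans ?_
    rw [Spec.map_comp, ← fromSpecStalk_toSpecZero _ hx, Category.assoc]
    rfl
  have h3 := congr(stalkVal (genericPoint (plane F)) (($h2).hom c))
  refine h3.trans ((stalkVal_germ _ _ _ _).trans ?_)
  let x : ProjectiveSpectrum (forms F) := genericPoint (plane F)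
  exact homogVal_mk x ⟨0, algebraMap F (forms F 0) c, 1,
    fun h ↦ x.isPrime.ne_top ((Ideal.eq_top_iff_one _).2 h)⟩

/-- Homogeneous coordinates on a scheme isomorphic to the projective plane. -/
def PlaneCoords.ofIso (X : Over (SpecOf F)) [IsIntegral X.left] (e : X.left ≅ plane F)
    (he : e.inv ≫ X.hom = (planeOver F).hom) : PlaneCoords X where
  val := (stalkVal (F := F) (genericPoint (plane F))).comp (functionFieldMap e.inv)
  pt := e.hom.homeomorph.toEquiv
  specializes_iff x y := by
    refine (Topology.IsInducing.specializes_iff e.hom.homeomorph.isInducing).symm.trans ?_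
    exact specializes_iff_le
  val_mem x f hf := by
    have h1 : functionFieldMap e.inv f ∈ stalkSubring (e.hom x) := by
      apply functionFieldMap_mem_stalkSubring
      have : e.inv (e.hom x) = x := by
        rw [← Scheme.Hom.comp_apply, e.hom_inv_id]; rfl
      rwa [this]
    obtain ⟨s, hs⟩ := mem_stalkSubring_iff.1 h1
    rw [RingHom.comp_apply, ← hs, stalkVal_specializes]
    exact exists_stalkVal_eq _ _
  exists_val x n a ha b hb hbx := by
    obtain ⟨s, hs⟩ := exists_stalkVal_eq_quot _ ha hb hbx
    refine ⟨functionFieldMap e.hom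
      ((plane F).presheaf.stalkSpecializes ((genericPoint_spec (plane F)).specializes trivial) s),
      functionFieldMap_mem_stalkSubring _ _ (mem_stalkSubring_iff.2 ⟨s, rfl⟩), ?_⟩
    rw [RingHom.comp_apply, ← functionFieldMap_comp_apply, functionFieldMap_congr
      e.inv_hom_id,
      functionFieldMap_id, RingHom.id_apply]
    exact (stalkVal_specializes _ _).trans hs
  val_const c := by
    rw [RingHom.comp_apply, functionFieldMap_constMap (X := planeOver F) _ (RingHom.id F)]
    · exact stalkVal_constMap c
    · rw [he]
      simp

/-! ### Ternary forms, prime forms and homogeneous primes -/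

section Homogeneous

open MvPolynomial

variable {F : Type u} [Field F]

/-- The substitution `X i ↦ X i * t`. -/
def homogenization : Ternary F →+* Polynomial (Ternary F) :=
  eval₂Hom (Polynomial.C.comp C) fun i ↦ Polynomial.C (X i) * Polynomial.X

lemma homogenization_monomial (m : Fin 3 →₀ ℕ) (c : F) :
    homogenization (monomial m c) = Polynomial.monomial m.degree (monomial m c) := by
  rw [homogenization, coe_eval₂Hom, eval₂_monomial, Finsupp.prod]
  simp only [mul_pow, Finset.prod_mul_distrib, RingHom.comp_apply, ← map_pow, ← map_prod]
  rw [Finset.prod_pow_eq_pow_sum, ← Finsupp.degree_apply, ← mul_assoc, ← map_mul,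
    Polynomial.C_mul_X_pow_eq_monomial, monomial_eq, Finsupp.prod]

lemma homogenization_coeff (p : Ternary F) (n : ℕ) :
    (homogenization p).coeff n = homogeneousComponent n p := by
  classical
  induction p using MvPolynomial.induction_on' with
  | monomial m c =>
    rw [homogenization_monomial, Polynomial.coeff_monomial]
    split_ifs with h
    · exact (homogeneousComponent_eq_self (isHomogeneous_monomial c h)).symm
    · rw [homogeneousComponent_of_mem (isHomogeneous_monomial c rfl), if_neg (Ne.symm h)]
  | add p q hp hq => rw [map_add, Polynomial.coeff_add, hp, hq, map_add]

/-- The substitution `X i ↦ X i * t` turns a form into a monomial in `t`. Degree and trailing degree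
in `t` are additive on products and agree for `a * b`, so they agree for `a`. -/
lemma mem_forms_of_mul_mem {a b : Ternary F} {n : ℕ} (h : a * b ∈ forms F n) (h0 : a * b ≠ 0) :
    ∃ m, a ∈ forms F m := by
  have hX : homogenization (a * b) = Polynomial.monomial n (a * b) := by
    ext1 i
    rw [homogenization_coeff, homogeneousComponent_of_mem h, Polynomial.coeff_monomial]
    simp [eq_comm]
  have hinj {p : Ternary F} (hp : p ≠ 0) : homogenization p ≠ 0 := by
    intro h
    apply hp
    rw [← sum_homogeneousComponent p]
    simp [← homogenization_coeff, h]
  have ha := hinj (left_ne_zero_of_mul h0)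
  have hb := hinj (right_ne_zero_of_mul h0)
  have h1 := Polynomial.natDegree_mul ha hb
  have h2 := Polynomial.natTrailingDegree_mul ha hb
  rw [← map_mul, hX] at h1 h2
  rw [Polynomial.natDegree_monomial_eq _ h0] at h1
  rw [Polynomial.natTrailingDegree_monomial h0] at h2
  have h3 := Polynomial.natTrailingDegree_le_natDegree (homogenization a)
  have h4 := Polynomial.natTrailingDegree_le_natDegree (homogenization b)
  have h5 : (homogenization a).natTrailingDegree = (homogenization a).natDegree := by omega
  refine ⟨(homogenization a).natDegree, ?_⟩
  nth_rw 2 [← sum_homogeneousComponent a]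
  refine sum_mem fun i _ ↦ ?_
  by_cases hi : i = (homogenization a).natDegree
  · rw [← hi]; exact homogeneousComponent_mem i a
  · rw [← homogenization_coeff]
    rcases lt_or_gt_of_ne hi with hi | hi
    · rw [Polynomial.coeff_eq_zero_of_lt_natTrailingDegree (h5 ▸ hi)]; exact zero_mem _
    · rw [Polynomial.coeff_eq_zero_of_natDegree_lt hi]; exact zero_mem _

lemma forms_mul {a b : Ternary F} {m n : ℕ} (ha : a ∈ forms F m) (hb : b ∈ forms F n) :
    a * b ∈ forms F (m + n) :=
  IsHomogeneous.mul ha hb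

lemma forms_inj {a : Ternary F} {m n : ℕ} (ha : a ∈ forms F m) (hb : a ∈ forms F n) (h : a ≠ 0) :
    m = n :=
  IsHomogeneous.inj_right ha hb h

lemma X_mem_forms (i : Fin 3) : (X i : Ternary F) ∈ forms F 1 := isHomogeneous_X F i

lemma exists_X_not_dvd {f : Ternary F} (hf : Prime f) : ∃ i, ¬ f ∣ X i := by
  by_contra! h
  have h0 : Irreducible (X 0 : Ternary F) := X_prime.irreducible
  have h1 : (X 0 : Ternary F) ∣ f :=
    (hf.irreducible.associated_of_dvd h0 (h 0)).dvd'
  exact absurd (X_dvd_X.1 (h1.trans (h 1))) (by decide)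

/-- The point of the projective plane given by a prime form. -/
def primeFormPoint {f : Ternary F} (hf : Prime f) {d : ℕ} (hd : f ∈ forms F d) :
    ProjectiveSpectrum (forms F) where
  asHomogeneousIdeal := ⟨Ideal.span {f}, Ideal.homogeneous_span _ _ (by
    rintro _ rfl; exact ⟨d, hd⟩)⟩
  isPrime := (Ideal.span_singleton_prime hf.ne_zero).2 hf
  not_irrelevant_le h := by
    obtain ⟨i, hi⟩ := exists_X_not_dvd hf
    exact hi (Ideal.mem_span_singleton.1 (h (X_mem_irrelevant i)))

lemma mem_primeFormPoint {f : Ternary F} (hf : Prime f) {d : ℕ} (hd : f ∈ forms F d)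
    {a : Ternary F} : a ∈ (primeFormPoint hf hd).asHomogeneousIdeal ↔ f ∣ a :=
  Ideal.mem_span_singleton

/-- A nonzero homogeneous prime ideal contains a prime form. -/
lemma exists_prime_form_mem (x : ProjectiveSpectrum (forms F)) (hx : x.asHomogeneousIdeal ≠ ⊥) :
    ∃ d, ∃ f ∈ forms F d, Prime f ∧ f ∈ x.asHomogeneousIdeal := by
  obtain ⟨n, h, hn, h0, hx⟩ : ∃ n, ∃ h ∈ forms F n, h ≠ 0 ∧ h ∈ x.asHomogeneousIdeal := by
    by_contra! hcon
    apply hx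
    rw [eq_bot_iff]
    intro a ha
    have : a = 0 := by
      rw [← sum_homogeneousComponent a]
      refine Finset.sum_eq_zero fun i _ ↦ ?_
      by_contra hne
      refine hcon i _ (homogeneousComponent_mem i a) hne ?_
      exact homogeneousComponent_mem_of_mem x.asHomogeneousIdeal.isHomogeneous ha i
    rw [this]; exact zero_mem _
  have hprod := UniqueFactorizationMonoid.factors_prod h0
  have : (UniqueFactorizationMonoid.factors h).prod ∈ x.asHomogeneousIdeal.toIdeal := by
    obtain ⟨u, hu⟩ := hprod.symm
    rw [← hu]; exact Ideal.mul_mem_right _ _ hx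
  obtain ⟨f, hf, hfx⟩ := (x.isPrime.multiset_prod_mem_iff_exists_mem _).1 this
  obtain ⟨g, rfl⟩ := UniqueFactorizationMonoid.dvd_of_mem_factors hf
  obtain ⟨d, hd⟩ := mem_forms_of_mul_mem hn h0
  exact ⟨d, f, hd, UniqueFactorizationMonoid.prime_of_factor f hf, hfx⟩

/-- A minimal nonzero homogeneous prime ideal is generated by a prime form. -/
lemma exists_prime_form_of_minimal (x : ProjectiveSpectrum (forms F))
    (hx : x.asHomogeneousIdeal ≠ ⊥) (hmin : ∀ y : ProjectiveSpectrum (forms F),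
      y.asHomogeneousIdeal ≤ x.asHomogeneousIdeal → y.asHomogeneousIdeal = ⊥ ∨
        x.asHomogeneousIdeal ≤ y.asHomogeneousIdeal) :
    ∃ d, ∃ f ∈ forms F d, Prime f ∧ ∀ a, a ∈ x.asHomogeneousIdeal ↔ f ∣ a := by
  obtain ⟨d, f, hd, hf, hfx⟩ := exists_prime_form_mem x hx
  have hle : (primeFormPoint hf hd).asHomogeneousIdeal ≤ x.asHomogeneousIdeal := by
    intro a ha
    obtain ⟨g, rfl⟩ := (mem_primeFormPoint hf hd).1 ha
    exact Ideal.mul_mem_right _ _ hfx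
  refine ⟨d, f, hd, hf, fun a ↦ ⟨fun ha ↦ ?_, fun ⟨g, hg⟩ ↦ hg ▸ Ideal.mul_mem_right _ _ hfx⟩⟩
  rcases hmin _ hle with h | h
  · have : f ∈ (⊥ : HomogeneousIdeal (forms F)) :=
      h ▸ (mem_primeFormPoint hf hd).2 dvd_rfl
    exact absurd this hf.ne_zero
  · exact (mem_primeFormPoint hf hd).1 (h ha)

/-- A principal prime has height one: any prime form in the smaller ideal is a multiple of `f`,
hence an associate of it. -/
lemma le_of_prime_form {x y : ProjectiveSpectrum (forms F)} {f : Ternary F} (hf : Prime f)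
    (hx : ∀ a, a ∈ x.asHomogeneousIdeal → f ∣ a) (hy : y.asHomogeneousIdeal ≠ ⊥)
    (hyx : y.asHomogeneousIdeal ≤ x.asHomogeneousIdeal) : f ∈ y.asHomogeneousIdeal := by
  obtain ⟨d, g, hd, hg, hgy⟩ := exists_prime_form_mem y hy
  obtain ⟨u, hu⟩ := (hf.irreducible.associated_of_dvd hg.irreducible (hx g (hyx hgy))).symm
  exact hu ▸ Ideal.mul_mem_right _ _ hgy

variable (F) in
/-- The basis of linear forms given by the variables. -/
def formsBasis : Module.Basis (Fin 3) F (forms F 1) :=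
  (Module.Basis.span (linearIndependent_X (Fin 3) F)).map
    (LinearEquiv.ofEq _ _ homogeneousSubmodule_one_eq_span_X.symm)

lemma coe_formsBasis (i : Fin 3) : (formsBasis F i : Ternary F) = X i := by
  rw [formsBasis, Module.Basis.map_apply, LinearEquiv.coe_ofEq_apply, Module.Basis.span_apply]

/-- Since linear forms have rank three, this excludes degrees above one in `exists_isLift`. -/
lemma four_le_rank_forms {d : ℕ} (hd : 2 ≤ d) : 4 ≤ Module.rank F (forms F d) := by
  obtain ⟨e, rfl⟩ := Nat.exists_eq_add_of_le' hd
  -- The four exponents are told apart by their entries at `1` and `2`.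
  let m : Fin 4 → (Fin 3 →₀ ℕ) := ![.single 0 (e + 2), .single 0 (e + 1) + .single 1 1,
    .single 0 (e + 1) + .single 2 1, .single 0 e + .single 1 2]
  have hm : Function.Injective m := by
    apply Function.Injective.of_comp (f := fun m : Fin 3 →₀ ℕ ↦ (m 1, m 2))
    intro i j
    fin_cases i <;> fin_cases j <;> simp [m]
  have hmd (i) : (m i).degree = e + 2 := by
    fin_cases i <;> simp [m, add_assoc]
  let v (i : Fin 4) : forms F (e + 2) := ⟨monomial (m i) 1, isHomogeneous_monomial _ (hmd i)⟩
  have hv : LinearIndependent F v := by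
    apply LinearIndependent.of_comp (forms F (e + 2)).subtype
    have := (basisMonomials (Fin 3) F).linearIndependent.comp m hm
    have h2 : (⇑(basisMonomials (Fin 3) F) ∘ m) = (forms F (e + 2)).subtype ∘ v := by
      ext i : 1
      simp [v]
    rw [h2] at this
    exact this
  simpa using hv.cardinal_lift_le_rank

end Homogeneous

/-! ### Rational functions with a simple pole along a curve -/

section Coordinates

variable {F : Type u} [Field F] {X : Over (SpecOf F)} [IsIntegral X.left] (c : PlaneCoords X)

namespace PlaneCoords

lemma val_injective : Function.Injective c.val := c.val.injective

lemma mem_iff {x : X.left} {f : X.left.functionField} :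
    f ∈ stalkSubring x ↔ ∃ n, ∃ a ∈ forms F n, ∃ b ∈ forms F n,
      b ∉ (c.pt x).asHomogeneousIdeal ∧ c.val f = quot a b := by
  refine ⟨c.val_mem x f, fun ⟨n, a, ha, b, hb, hbx, h⟩ ↦ ?_⟩
  obtain ⟨g, hg, hgf⟩ := c.exists_val x n a ha b hb hbx
  rwa [c.val_injective (h.trans hgf.symm)]

lemma exists_eq_quot {n : ℕ} {a b : Ternary F} (ha : a ∈ forms F n) (hb : b ∈ forms F n)
    (h0 : b ≠ 0) : ∃ f, c.val f = quot a b := by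
  obtain ⟨f, -, hf⟩ := c.exists_val (c.pt.symm (planeGeneric F)) n a ha b hb (by
    rw [Equiv.apply_symm_apply]; exact h0)
  exact ⟨f, hf⟩

/-- The rational function given by a quotient of forms of the same degree. -/
def frac {n : ℕ} {a b : Ternary F} (ha : a ∈ forms F n) (hb : b ∈ forms F n)
    (h0 : b ≠ 0) : X.left.functionField := (c.exists_eq_quot ha hb h0).choose

@[simp]
lemma val_frac {n : ℕ} {a b : Ternary F} (ha : a ∈ forms F n) (hb : b ∈ forms F n)
    (h0 : b ≠ 0) : c.val (c.frac ha hb h0) = quot a b := (c.exists_eq_quot ha hb h0).choose_spec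

lemma mem_stalkSubring_genericPoint (f : X.left.functionField) :
    f ∈ stalkSubring (genericPoint X.left) :=
  mem_stalkSubring_iff.2 ⟨f, by rw [TopCat.Presheaf.stalkSpecializes_refl]; rfl⟩

/-- The reduced fraction in the polynomial ring divides any homogeneous one, and factors of forms
are forms. -/
lemma exists_isRelPrime (f : X.left.functionField) : ∃ n, ∃ a ∈ forms F n, ∃ b ∈ forms F n,
    b ≠ 0 ∧ IsRelPrime a b ∧ c.val f = quot a b := by
  obtain ⟨n, a, ha, b, hb, hb0, h⟩ := c.val_mem _ f (mem_stalkSubring_genericPoint f)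
  replace hb0 := ne_zero_of_notMem hb0
  obtain ⟨a', b', hab, h'⟩ := IsFractionRing.exists_reduced_fraction (Ternary F) (c.val f)
  have hb' : (b' : Ternary F) ≠ 0 := nonZeroDivisors.ne_zero b'.2
  rw [IsFractionRing.mk'_eq_div] at h'
  rw [← h', ← quot, quot_eq_quot_iff hb' hb0] at h
  obtain ⟨e, rfl⟩ : (b' : Ternary F) ∣ b :=
    hab.symm.dvd_of_dvd_mul_left (Dvd.intro_left _ h.symm)
  obtain rfl : a = a' * e := by
    apply mul_right_cancel₀ hb'
    rw [← h]; ring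
  have he : e ≠ 0 := right_ne_zero_of_mul hb0
  obtain ⟨m, hm⟩ := mem_forms_of_mul_mem hb hb0
  have hem : e ∈ forms F (n - m) ∧ m ≤ n := by
    obtain ⟨l, hl⟩ := mem_forms_of_mul_mem (mul_comm (b' : Ternary F) e ▸ hb)
      (mul_comm (b' : Ternary F) e ▸ hb0)
    have := forms_inj (forms_mul hm hl) hb hb0
    obtain rfl : l = n - m := by omega
    exact ⟨hl, by omega⟩
  refine ⟨m, a', ?_, b', hm, hb', hab, h'.symm⟩
  by_cases ha0 : a' = 0
  · rw [ha0]; exact zero_mem _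
  obtain ⟨l, hl⟩ := mem_forms_of_mul_mem ha (mul_ne_zero ha0 he)
  have := forms_inj (forms_mul hl hem.1) ha (mul_ne_zero ha0 he)
  obtain rfl : l = m := by omega
  exact hl

end PlaneCoords

/-- The rational functions with at most a simple pole along the closure of the point `x`, and no
other pole. -/
def polar {X : Scheme.{u}} [IsIntegral X] (x : X) : Set X.functionField :=
  {g | (∀ y, ¬ x ⤳ y → g ∈ stalkSubring y) ∧
    -- The premise on `t` says that `t` lies in the maximal ideal; as `0⁻¹ = 0`, it allows `t = 0`.
    ∀ t ∈ stalkSubring x, (t⁻¹ ∈ stalkSubring x → t = 0) → t * g ∈ stalkSubring x}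

lemma functionFieldMap_mem_polar_iff {X : Scheme.{u}} [IsIntegral X] (f : X ⟶ X) [IsIso f]
    (x : X) {g : X.functionField} : functionFieldMap f g ∈ polar x ↔ g ∈ polar (f x) := by
  have hs (y) : x ⤳ y ↔ f x ⤳ f y :=
    (Topology.IsInducing.specializes_iff f.homeomorph.isInducing).symm
  have hsurj : Function.Surjective (functionFieldMap f) := by
    intro a
    refine ⟨functionFieldMap (inv f) a, ?_⟩
    rw [← functionFieldMap_comp_apply, functionFieldMap_congr (IsIso.hom_inv_id f),
      functionFieldMap_id, RingHom.id_apply]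
  simp only [polar, Set.mem_ofPred_eq]
  refine and_congr ⟨fun h y hy ↦ ?_, fun h y hy ↦ ?_⟩ ⟨fun h t ↦ ?_, fun h t ↦ ?_⟩
  · obtain ⟨z, rfl⟩ := f.homeomorph.surjective y
    exact (functionFieldMap_mem_stalkSubring_iff f z).1 (h z fun hz ↦ hy ((hs z).1 hz))
  · exact (functionFieldMap_mem_stalkSubring_iff f y).2 (h _ fun hz ↦ hy ((hs y).2 hz))
  · have := h (functionFieldMap f t)
    rwa [functionFieldMap_mem_stalkSubring_iff, ← map_inv₀, functionFieldMap_mem_stalkSubring_iff,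
      map_eq_zero, ← map_mul, functionFieldMap_mem_stalkSubring_iff] at this
  · obtain ⟨s, rfl⟩ := hsurj t
    rw [functionFieldMap_mem_stalkSubring_iff, ← map_inv₀, functionFieldMap_mem_stalkSubring_iff,
      map_eq_zero, ← map_mul, functionFieldMap_mem_stalkSubring_iff]
    exact h s

/-- This recovers the forms of degree `d` from local rings alone. In a reduced fraction, a prime
factor of the denominator other than `f` would give a pole outside the curve, so the denominator is
a constant times `f ^ m`. -/
lemma PlaneCoords.mem_polar_iff {x : X.left} {f : Ternary F} {d : ℕ} (hd : f ∈ forms F d)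
    (hf : Prime f) (hx : ∀ a, a ∈ (c.pt x).asHomogeneousIdeal ↔ f ∣ a)
    {g : X.left.functionField} :
    g ∈ polar x ↔ ∃ a ∈ forms F d, c.val g = quot a f := by
  constructor
  · rintro ⟨h1, h2⟩
    obtain ⟨n, a, ha, b, hb, hb0, hab, hg⟩ := c.exists_isRelPrime g
    have hp (p) (hp : Prime p) (hpb : p ∣ b) : f ∣ p := by
      obtain ⟨m, hm⟩ : ∃ m, p ∈ forms F m := by
        obtain ⟨e, rfl⟩ := hpb
        exact mem_forms_of_mul_mem hb hb0
      by_contra hfp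
      have hspec : ¬ x ⤳ c.pt.symm (primeFormPoint hp hm) := by
        rw [c.specializes_iff, Equiv.apply_symm_apply]
        intro hle
        have := (mem_primeFormPoint hp hm).1 (hle ((hx f).2 dvd_rfl))
        exact hfp (hp.irreducible.associated_of_dvd hf.irreducible this).dvd'
      obtain ⟨l, a', ha', b', hb', hbp, h⟩ := c.mem_iff.1 (h1 _ hspec)
      rw [Equiv.apply_symm_apply, mem_primeFormPoint] at hbp
      rw [hg, quot_eq_quot_iff hb0 (by rintro rfl; simp at hbp)] at h
      have : p ∣ a * b' := h ▸ hpb.mul_left _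
      exact hp.not_isUnit (hab ((hp.dvd_or_dvd this).resolve_right hbp) hpb)
    obtain ⟨m, e, hfe, rfl⟩ := WfDvdMonoid.max_power_factor hb0 hf.irreducible
    have he : IsUnit e := by
      by_contra hu
      obtain ⟨p, hpi, hpe⟩ := WfDvdMonoid.exists_irreducible_factor hu (right_ne_zero_of_mul hb0)
      exact hfe ((hp p hpi.prime (hpe.mul_left _)).trans hpe)
    obtain ⟨r, hr, rfl⟩ := MvPolynomial.isUnit_iff_eq_C_of_isReduced.1 he
    have hr0 : r ≠ 0 := hr.ne_zero
    have hC : (MvPolynomial.C r : Ternary F) * MvPolynomial.C r⁻¹ = 1 := by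
      rw [← map_mul, mul_inv_cancel₀ hr0, map_one]
    have hn : n = d * m := by
      refine forms_inj hb ?_ hb0
      have := forms_mul (MvPolynomial.IsHomogeneous.pow hd m) (MvPolynomial.isHomogeneous_C _ r)
      exact this
    have hm : m ≤ 1 := by
      by_contra! hm
      obtain ⟨i, hi⟩ := exists_X_not_dvd hf
      have hid : ¬ f ∣ (MvPolynomial.X i) ^ d := fun h ↦ hi (hf.dvd_of_dvd_pow h)
      have hXd : (MvPolynomial.X i : Ternary F) ^ d ∈ forms F d :=
        MvPolynomial.isHomogeneous_X_pow i d
      have hXd0 : (MvPolynomial.X i : Ternary F) ^ d ≠ 0 := by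
        intro h; rw [h] at hid; exact hid (dvd_zero _)
      -- Multiplying by the test function `f / X i ^ d`, which vanishes at `x`, cancels only one
      -- factor `f`; for `m ≥ 2` a pole would remain.
      have := h2 (c.frac hd hXd hXd0) (c.mem_iff.2 ⟨d, f, hd, _, hXd, by rwa [hx], by simp⟩) ?_
      · obtain ⟨l, a', ha', b', hb', hbp, h⟩ := c.mem_iff.1 this
        rw [hx] at hbp
        obtain ⟨m, rfl⟩ := Nat.exists_eq_add_of_le' hm
        have hb'0 : b' ≠ 0 := by rintro rfl; simp at hbp
        rw [map_mul, hg, c.val_frac] at h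
        have h' : quot (f * a) (MvPolynomial.X i ^ d * (f ^ (m + 1 + 1) * MvPolynomial.C r)) =
            quot a' b' := by
          rw [← h]; simp only [quot, map_mul]; rw [div_mul_div_comm]
        rw [quot_eq_quot_iff (mul_ne_zero hXd0 hb0) hb'0] at h'
        have h3 : f ∣ a * b' := by
          refine ⟨a' * MvPolynomial.X i ^ d * f ^ m * MvPolynomial.C r, ?_⟩
          apply mul_left_cancel₀ hf.ne_zero
          linear_combination h'
        exact hf.not_isUnit (hab ((hf.dvd_or_dvd h3).resolve_right hbp)
          ((dvd_pow_self f (by omega)).mul_right _))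
      · intro h
        exfalso
        obtain ⟨l, a', ha', b', hb', hbp, h⟩ := c.mem_iff.1 h
        rw [hx] at hbp
        rw [map_inv₀, c.val_frac, quot, inv_div, ← quot,
          quot_eq_quot_iff hf.ne_zero (by rintro rfl; simp at hbp)] at h
        exact (hf.dvd_or_dvd (Dvd.intro_left _ h.symm)).elim hid hbp
    refine ⟨a * MvPolynomial.C r⁻¹ * f ^ (1 - m), ?_, ?_⟩
    · have h := forms_mul (forms_mul ha (MvPolynomial.isHomogeneous_C _ r⁻¹))
        (MvPolynomial.IsHomogeneous.pow hd (1 - m))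
      have h3 : n + 0 + d * (1 - m) = d := by
        obtain rfl | rfl : m = 0 ∨ m = 1 := by omega
        · simp [hn]
        · simp [hn]
      rwa [h3] at h
    · rw [hg, quot_eq_quot_iff hb0 hf.ne_zero]
      obtain rfl | rfl : m = 0 ∨ m = 1 := by omega
      · linear_combination - a * f * hC
      · linear_combination - a * f * hC
  · rintro ⟨a, ha, hg⟩
    constructor
    · intro y hy
      refine c.mem_iff.2 ⟨d, a, ha, f, hd, fun hfy ↦ hy ?_, hg⟩
      rw [c.specializes_iff]
      intro b hb
      obtain ⟨e, rfl⟩ := (hx b).1 hb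
      exact Ideal.mul_mem_right _ _ hfy
    · intro t ht htinv
      obtain ⟨n, a', ha', b', hb', hbx, h⟩ := c.mem_iff.1 ht
      have hb0 : b' ≠ 0 := ne_zero_of_notMem hbx
      have hfa : f ∣ a' := by
        by_contra hfa
        have h0 : t = 0 := by
          refine htinv (c.mem_iff.2 ⟨n, b', hb', a', ha', by rwa [hx], ?_⟩)
          rw [map_inv₀, h, quot, inv_div, quot]
        rw [h0, map_zero, quot, eq_comm, div_eq_zero_iff,
          or_iff_left (algebraMap_ternary_ne_zero hb0), FaithfulSMul.algebraMap_eq_zero_iff] at h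
        rw [h] at hfa
        exact hfa (dvd_zero _)
      obtain ⟨e, rfl⟩ := hfa
      refine c.mem_iff.2 ⟨n, e * a, ?_, b', hb', hbx, ?_⟩
      · by_cases h0 : e = 0
        · rw [h0, zero_mul]; exact zero_mem _
        have h1 : f * e ≠ 0 := mul_ne_zero hf.ne_zero h0
        obtain ⟨l, hl⟩ := mem_forms_of_mul_mem (mul_comm f e ▸ ha') (mul_comm f e ▸ h1)
        rw [forms_inj ha' (forms_mul hd hl) h1, add_comm]
        exact forms_mul hl ha
      · rw [map_mul, h, hg]
        simp only [quot, map_mul]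
        have := algebraMap_ternary_ne_zero hf.ne_zero
        have := algebraMap_ternary_ne_zero hb0
        field_simp

end Coordinates

/-! ### Lifting automorphisms of the plane to linear forms -/

section Lifts

variable {F : Type u} [Field F] {X : Over (SpecOf F)} [IsIntegral X.left] (c : PlaneCoords X)

lemma quot_add {a b d : Ternary F} : quot (a + b) d = quot a d + quot b d := by
  simp only [quot, map_add, add_div]

lemma quot_inj {a b d : Ternary F} (hd : d ≠ 0) : quot a d = quot b d ↔ a = b := by
  rw [quot_eq_quot_iff hd hd, mul_left_inj' hd]

lemma quot_mul_quot (a b c d : Ternary F) : quot a b * quot c d = quot (a * c) (b * d) := by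
  simp only [quot, map_mul, div_mul_div_comm]

lemma quot_mul_cancel_left {a b e : Ternary F} (h : e ≠ 0) : quot (e * a) (e * b) = quot a b := by
  simp only [quot, map_mul]
  exact mul_div_mul_left _ _ (algebraMap_ternary_ne_zero h)

lemma functionFieldMap_bijective {Y Z : Scheme.{u}} [IsIntegral Y] [IsIntegral Z] (f : Y ⟶ Z)
    [IsIso f] : Function.Bijective (functionFieldMap f) := by
  refine ⟨(functionFieldMap f).injective, fun a ↦ ⟨functionFieldMap (inv f) a, ?_⟩⟩
  rw [← functionFieldMap_comp_apply, functionFieldMap_congr (IsIso.hom_inv_id f),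
    functionFieldMap_id, RingHom.id_apply]

/-- The additive bijection `T` of the space of linear forms is semilinear and describes the effect
of the ring endomorphism `θ` of the function field on quotients of linear forms. -/
structure IsLift (θ : X.left.functionField →+* X.left.functionField) (σ : F →+* F)
    (T : forms F 1 ≃+ forms F 1) : Prop where
  map_smul : ∀ (r : F) (a : forms F 1), T (r • a) = σ r • T a
  map_quot : ∀ (f : X.left.functionField) (a b : forms F 1), b ≠ 0 →
    c.val f = quot (a : Ternary F) b → c.val (θ f) = quot (T a : Ternary F) (T b)

/-- The preimage of the line `X 0 = 0` is a curve `f = 0`. Pullback identifies functions with a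
simple pole along the line, `a / X 0` with `a` linear, with the functions `a' / f`, where `a'` has
the degree of `f`. Comparing dimensions shows that `f` is linear, and `a ↦ a'` is the lift. -/
lemma exists_isLift (φ : X.left ⟶ X.left) [IsIso φ] (σ : F ≃+* F)
    (hφ : ∀ r, functionFieldMap φ (constMap (X := X) r) = constMap (X := X) (σ r)) :
    ∃ T, IsLift c (functionFieldMap φ) σ T := by
  set θ := functionFieldMap φ with hθ
  have hs (y z) : y ⤳ z ↔ φ y ⤳ φ z :=
    (Topology.IsInducing.specializes_iff φ.homeomorph.isInducing).symm
  let X₀ : Ternary F := MvPolynomial.X 0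
  have hX₀ : Prime X₀ := MvPolynomial.X_prime
  have hX₀1 : X₀ ∈ forms F 1 := X_mem_forms 0
  let x₀ := c.pt.symm (primeFormPoint hX₀ hX₀1)
  have hx₀ (a) : a ∈ (c.pt x₀).asHomogeneousIdeal ↔ X₀ ∣ a := by
    rw [Equiv.apply_symm_apply, mem_primeFormPoint]
  obtain ⟨x, hx⟩ := φ.homeomorph.surjective x₀
  change φ x = x₀ at hx
  -- The zero ideal and minimality over it are expressed by specialization, which the homeomorphism
  -- `φ` respects.
  have hbot {y : X.left} : (c.pt y).asHomogeneousIdeal = ⊥ ↔ ∀ z, y ⤳ z := by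
    constructor
    · intro h z
      rw [c.specializes_iff, h]
      exact bot_le
    · intro h
      have := (c.specializes_iff _ _).1 (h (c.pt.symm (planeGeneric F)))
      rw [Equiv.apply_symm_apply] at this
      exact le_bot_iff.1 this
  obtain ⟨d, f, hd, hf, hfx⟩ := exists_prime_form_of_minimal (c.pt x) (by
      intro h
      rw [hbot] at h
      have h2 : (c.pt x₀).asHomogeneousIdeal = ⊥ := by
        rw [hbot]
        intro z
        obtain ⟨z, rfl⟩ := φ.homeomorph.surjective z
        rw [← hx]
        exact (hs _ _).1 (h z)
      have h3 := (hx₀ X₀).2 dvd_rfl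
      rw [h2] at h3
      exact hX₀.ne_zero h3) (by
    intro y hy
    obtain ⟨y, rfl⟩ := c.pt.surjective y
    rw [← c.specializes_iff] at hy ⊢
    by_cases h : (c.pt (φ y)).asHomogeneousIdeal = ⊥
    · left
      rw [hbot] at h ⊢
      exact fun z ↦ (hs _ _).2 (h _)
    · right
      have h2 := le_of_prime_form hX₀ (fun a ↦ (hx₀ a).1) h
        ((c.specializes_iff _ _).1 (hx ▸ (hs _ _).1 hy))
      rw [hs, hx, c.specializes_iff]
      intro a ha
      obtain ⟨b, rfl⟩ := (hx₀ a).1 ha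
      exact Ideal.mul_mem_right _ _ h2)
  have hpol (g) : g ∈ polar x₀ ↔ θ g ∈ polar x := by
    rw [hθ, functionFieldMap_mem_polar_iff, hx]
  simp only [c.mem_polar_iff hX₀1 hX₀ hx₀, c.mem_polar_iff hd hf hfx] at hpol
  have key (a : forms F 1) : ∃ a' : forms F d,
      c.val (θ (c.frac a.2 hX₀1 hX₀.ne_zero)) = quot (a' : Ternary F) f := by
    obtain ⟨a', ha', h⟩ := (hpol _).1 ⟨a, a.2, c.val_frac _ _ _⟩
    exact ⟨⟨a', ha'⟩, h⟩
  choose T hT using key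
  have hT' (g) (a : forms F 1) (hg : c.val g = quot (a : Ternary F) X₀) :
      c.val (θ g) = quot (T a : Ternary F) f := by
    rw [← hT]
    congr 2
    apply c.val_injective
    rw [hg, c.val_frac]
  have hTadd (a b) : T (a + b) = T a + T b := by
    apply Subtype.ext
    rw [Submodule.coe_add, ← quot_inj hf.ne_zero, quot_add, ← hT a, ← hT b, ← map_add, ← map_add]
    refine (hT' _ _ ?_).symm
    simp [quot_add]
  have hTsmul (r : F) (a) : T (r • a) = σ r • T a := by
    apply Subtype.ext
    rw [Submodule.coe_smul, ← quot_inj hf.ne_zero, MvPolynomial.smul_eq_C_mul,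
      ← one_mul f, ← quot_mul_quot, one_mul, ← hT a, ← c.val_const, ← hφ, ← map_mul, ← map_mul]
    refine (hT' _ _ ?_).symm
    rw [map_mul, c.val_const, c.val_frac, quot_mul_quot, one_mul, Submodule.coe_smul,
      MvPolynomial.smul_eq_C_mul]
  have hTbij : Function.Bijective T := by
    constructor
    · intro a b hab
      have := (hT a).trans ((congr_arg (fun t : forms F d ↦ quot (t : Ternary F) f) hab).trans
        (hT b).symm)
      have h2 := congr_arg c.val (θ.injective (c.val_injective this))
      rw [c.val_frac, c.val_frac, quot_inj hX₀.ne_zero] at h2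
      exact Subtype.ext h2
    · intro a'
      obtain ⟨g, hg⟩ := (functionFieldMap_bijective φ).2 (c.frac a'.2 hd hf.ne_zero)
      obtain ⟨a, ha, h⟩ := (hpol g).2 ⟨a', a'.2, by rw [hθ, hg, c.val_frac]⟩
      refine ⟨⟨a, ha⟩, Subtype.ext ?_⟩
      rw [← quot_inj hf.ne_zero, ← hT' g ⟨a, ha⟩ h, hθ, hg, c.val_frac]
  let T' : forms F 1 ≃+ forms F d := AddEquiv.ofBijective (AddMonoidHom.mk' T hTadd) hTbij
  have hrank : Module.rank F (forms F 1) = Module.rank F (forms F d) :=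
    rank_eq_of_equiv_equiv σ T' σ.bijective hTsmul
  rw [rank_eq_card_basis (formsBasis F)] at hrank
  -- A form of degree zero is constant and not prime; degree at least two gives rank at least four.
  have hd1 : d = 1 := by
    by_contra hne
    rcases Nat.lt_or_gt_of_ne hne with h | h
    · obtain rfl : d = 0 := by omega
      have h0 : f = MvPolynomial.C (MvPolynomial.coeff 0 f) :=
        (MvPolynomial.totalDegree_eq_zero_iff_eq_C).1
          ((MvPolynomial.totalDegree_zero_iff_isHomogeneous _).2 hd)
      apply hf.not_isUnit
      rw [h0] at hf ⊢
      refine (IsUnit.mk0 _ ?_).map MvPolynomial.C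
      intro h
      rw [h, map_zero] at hf
      exact hf.ne_zero rfl
    · have := four_le_rank_forms (F := F) (d := d) h
      rw [← hrank] at this
      norm_num at this
  subst hd1
  refine ⟨T', hTsmul, fun g a b hb hg ↦ ?_⟩
  have hb0 : (b : Ternary F) ≠ 0 := by simpa using hb
  -- A general quotient is `(a / X₀) / (b / X₀)`, so the denominators `f` cancel.
  have h1 : g * c.frac b.2 hX₀1 hX₀.ne_zero = c.frac a.2 hX₀1 hX₀.ne_zero := by
    apply c.val_injective
    rw [map_mul, hg, c.val_frac, c.val_frac, quot_mul_quot, mul_comm (a : Ternary F),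
      quot_mul_cancel_left hb0]
  have h2 := congr_arg (fun t ↦ c.val (θ t)) h1
  simp only [map_mul, hT] at h2
  have h3 : (T b : Ternary F) ≠ 0 := by
    have : T' b ≠ 0 := T'.map_ne_zero_iff.2 hb
    exact fun h ↦ this (Subtype.ext h)
  change _ = quot (T a : Ternary F) (T b)
  have h4 := algebraMap_ternary_ne_zero h3
  have h5 := algebraMap_ternary_ne_zero hf.ne_zero
  simp only [quot] at h2 ⊢
  field_simp at h2 ⊢
  exact h2

end Lifts

/-! ### Galois action on the base change and its function field -/

section Galois

lemma exists_SpecMap_fromSpecStalk {A : CommRingCat.{u}} [IsLocalRing A] {X : Scheme.{u}}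
    (h : Spec A ⟶ X) {y : X} (hy : h (IsLocalRing.closedPoint A) = y) :
    ∃ r : X.presheaf.stalk y ⟶ A, Spec.map r ≫ X.fromSpecStalk y = h := by
  subst hy
  exact ⟨Scheme.stalkClosedPointTo h, Scheme.Spec_stalkClosedPointTo_fromSpecStalk h⟩

variable {k : Type u} [Field k] (S : Over (SpecOf k))

/-- The base change of `S` to the algebraic closure. -/
abbrev geom : Over (SpecOf (AlgebraicClosure k)) := (geomBaseChange k).obj S

/-- The projection from the base change to the algebraic closure. -/
def toBase : (geom S).left ⟶ S.left := pullback.fst S.hom (specAlgebraMap k (AlgebraicClosure k))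

/-- The morphism of spectra given by an automorphism of the algebraic closure. -/
abbrev specGal (σ : Gal(AlgebraicClosure k/k)) :
    SpecOf (AlgebraicClosure k) ⟶ SpecOf (AlgebraicClosure k) :=
  Spec.map (CommRingCat.ofHom (σ : AlgebraicClosure k →+* AlgebraicClosure k))

lemma specGal_comp (σ : Gal(AlgebraicClosure k/k)) :
    specGal σ ≫ specAlgebraMap k (AlgebraicClosure k) =
      specAlgebraMap k (AlgebraicClosure k) := by
  rw [← Spec.map_comp, ← CommRingCat.ofHom_comp]
  congr 2
  ext x
  exact σ.commutes x

lemma specGal_mul (σ τ : Gal(AlgebraicClosure k/k)) :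
    specGal (σ * τ) = specGal σ ≫ specGal τ := by
  rw [← Spec.map_comp, ← CommRingCat.ofHom_comp]
  rfl

lemma specGal_one : specGal (1 : Gal(AlgebraicClosure k/k)) = 𝟙 _ := by
  rw [← Spec.map_id]
  rfl

variable {S} in
lemma geom_hom_ext {Z : Scheme.{u}} {f g : Z ⟶ (geom S).left} (h₁ : f ≫ toBase S = g ≫ toBase S)
    (h₂ : f ≫ (geom S).hom = g ≫ (geom S).hom) : f = g :=
  pullback.hom_ext h₁ h₂

lemma toBase_comp : toBase S ≫ S.hom = (geom S).hom ≫ specAlgebraMap k (AlgebraicClosure k) :=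
  pullback.condition

/-- The morphism to the base change with given components. -/
def geomLift {Z : Scheme.{u}} (f : Z ⟶ S.left) (g : Z ⟶ SpecOf (AlgebraicClosure k))
    (h : f ≫ S.hom = g ≫ specAlgebraMap k (AlgebraicClosure k)) : Z ⟶ (geom S).left :=
  pullback.lift f g h

@[simp]
lemma geomLift_toBase {Z : Scheme.{u}} (f : Z ⟶ S.left) (g : Z ⟶ SpecOf (AlgebraicClosure k))
    (h) : geomLift S f g h ≫ toBase S = f := pullback.lift_fst _ _ _

@[simp]
lemma geomLift_hom {Z : Scheme.{u}} (f : Z ⟶ S.left) (g : Z ⟶ SpecOf (AlgebraicClosure k))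
    (h) : geomLift S f g h ≫ (geom S).hom = g := pullback.lift_snd _ _ _

/-- The semilinear action of the Galois group on the base change. -/
def galMap (σ : Gal(AlgebraicClosure k/k)) : (geom S).left ⟶ (geom S).left :=
  geomLift S (toBase S) ((geom S).hom ≫ specGal σ)
    (by rw [Category.assoc, specGal_comp, toBase_comp])

lemma galMap_toBase (σ : Gal(AlgebraicClosure k/k)) : galMap S σ ≫ toBase S = toBase S :=
  geomLift_toBase _ _ _ _

lemma galMap_hom (σ : Gal(AlgebraicClosure k/k)) :
    galMap S σ ≫ (geom S).hom = (geom S).hom ≫ specGal σ :=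
  geomLift_hom _ _ _ _

lemma galMap_mul (σ τ : Gal(AlgebraicClosure k/k)) :
    galMap S (σ * τ) = galMap S σ ≫ galMap S τ := by
  apply geom_hom_ext
  · rw [Category.assoc, galMap_toBase, galMap_toBase, galMap_toBase]
  · rw [Category.assoc, galMap_hom, galMap_hom, reassoc_of% galMap_hom, specGal_mul]

lemma galMap_one : galMap S 1 = 𝟙 _ := by
  apply geom_hom_ext
  · rw [galMap_toBase, Category.id_comp]
  · rw [galMap_hom, specGal_one, Category.id_comp, Category.comp_id]

instance (σ : Gal(AlgebraicClosure k/k)) : IsIso (galMap S σ) :=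
  ⟨galMap S σ⁻¹, by rw [← galMap_mul, mul_inv_cancel, galMap_one],
    by rw [← galMap_mul, inv_mul_cancel, galMap_one]⟩

instance : Flat (specAlgebraMap k (AlgebraicClosure k)) := by
  rw [Flat.SpecMap_iff]
  exact (RingHom.flat_algebraMap_iff (R := k) (S := AlgebraicClosure k)).2 inferInstance

instance : Surjective (specAlgebraMap k (AlgebraicClosure k)) :=
  ⟨fun _ ↦ ⟨(⊥ : PrimeSpectrum (AlgebraicClosure k)), Subsingleton.elim (α := PrimeSpectrum k) _ _⟩⟩

instance : Flat (toBase S) := by unfold toBase; infer_instance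
instance : Surjective (toBase S) := by unfold toBase; infer_instance

instance : Epi (toBase S) := Flat.epi_of_flat_of_surjective _

variable [IsIntegral (geom S).left]

/-- The Galois action on the function field of the base change. -/
def galAct (σ : Gal(AlgebraicClosure k/k)) :
    (geom S).left.functionField →+* (geom S).left.functionField :=
  functionFieldMap (galMap S σ)

variable {S}

lemma galAct_constMap (σ : Gal(AlgebraicClosure k/k)) (r : AlgebraicClosure k) :
    galAct S σ (constMap r) = constMap (σ r) :=
  functionFieldMap_constMap (X := geom S) (Y := geom S) _ _ (galMap_hom S σ) r

lemma galAct_mul (σ τ : Gal(AlgebraicClosure k/k)) (f) :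
    galAct S (σ * τ) f = galAct S σ (galAct S τ f) := by
  rw [galAct, galAct, galAct, ← functionFieldMap_comp_apply,
    functionFieldMap_congr (galMap_mul S σ τ)]

variable [IsIntegral S.left]

variable (S) in
/-- Pullback of rational functions to the base change. -/
def pull : S.left.functionField →+* (geom S).left.functionField :=
  functionFieldMap (toBase S)

lemma pull_constMap (r : k) :
    pull S (constMap r) = constMap (algebraMap k (AlgebraicClosure k) r) :=
  functionFieldMap_constMap (X := geom S) (Y := S) _ _ (toBase_comp S) r

lemma galAct_pull (σ : Gal(AlgebraicClosure k/k)) (f) : galAct S σ (pull S f) = pull S f := by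
  rw [galAct, pull, ← functionFieldMap_comp_apply, functionFieldMap_congr (galMap_toBase S σ)]

/-- The function field of the base change is generated by the constants and the rational functions
on `S`. -/
lemma exists_eq_sum (f : (geom S).left.functionField) : ∃ s : Finset (S.left.functionField ×
    AlgebraicClosure k), f = ∑ p ∈ s, pull S p.1 * constMap p.2 := by
  let K := (geom S).left.functionField
  let : Algebra k S.left.functionField := (constMap (X := S)).toAlgebra
  let : Algebra k K := ((constMap (X := geom S)).comp (algebraMap k _)).toAlgebra
  let i₁ : S.left.functionField →ₐ[k] K := { pull S with commutes' := pull_constMap }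
  let i₂ : AlgebraicClosure k →ₐ[k] K :=
    { constMap (X := geom S) with commutes' := fun _ ↦ rfl }
  let μ : TensorProduct k S.left.functionField (AlgebraicClosure k) →ₐ[k] K :=
    Algebra.TensorProduct.productMap i₁ i₂
  let A := μ.range
  let : Algebra S.left.functionField A :=
    (μ.rangeRestrict.toRingHom.comp (algebraMap _ _)).toAlgebra
  -- As `k̄` is algebraic over `k`, the tensor product is integral over the function field of `S`.
  -- Hence its image `A`, a domain, is a field.
  have : Algebra.IsIntegral S.left.functionField A := by
    let ν : TensorProduct k S.left.functionField (AlgebraicClosure k) →ₐ[S.left.functionField] A :=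
      { μ.rangeRestrict with commutes' := fun _ ↦ rfl }
    exact Algebra.IsIntegral.of_surjective ν μ.rangeRestrict_surjective
  have hA : IsField A := isField_of_isIntegral_of_isField' (Field.toIsField S.left.functionField)
  let := hA.toField
  let j₁ : S.left.functionField →+* A :=
    (i₁.codRestrict A fun a ↦ ⟨a ⊗ₜ 1, Algebra.TensorProduct.productMap_left_apply _ _ _⟩).toRingHom
  let j₂ : AlgebraicClosure k →+* A :=
    (i₂.codRestrict A fun a ↦ ⟨1 ⊗ₜ a, Algebra.TensorProduct.productMap_right_apply _ _ _⟩).toRingHom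
  let i : A →+* K := A.val
  have hi₁ : i.comp j₁ = pull S := by
    ext a
    rfl
  have hi₂ : i.comp j₂ = constMap (X := geom S) := by
    ext a
    rfl
  have hj : j₁.comp (constMap (X := S)) = j₂.comp (algebraMap k (AlgebraicClosure k)) := by
    ext r
    change (i.comp j₁) _ = (i.comp j₂) _
    rw [hi₁, hi₂]
    exact pull_constMap r
  -- The generic point of the base change factors through `Spec A`. So its local ring maps to `A`,
  -- and composing with the inclusion `i` gives the identity; thus `i` is surjective.
  let h : Spec (CommRingCat.of A) ⟶ (geom S).left :=
    geomLift S (Spec.map (CommRingCat.ofHom j₁) ≫ fromSpecFunctionField S.left)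
      (Spec.map (CommRingCat.ofHom j₂)) (by
        rw [Category.assoc, ← SpecMap_constMap, ← Spec.map_comp, ← Spec.map_comp,
          ← CommRingCat.ofHom_comp, ← CommRingCat.ofHom_comp, hj])
  have hih : Spec.map (CommRingCat.ofHom i) ≫ h = fromSpecFunctionField (geom S).left := by
    apply geom_hom_ext
    · rw [Category.assoc, geomLift_toBase, ← Category.assoc, ← Spec.map_comp,
        ← CommRingCat.ofHom_comp, hi₁]
      exact SpecMap_functionFieldMap _
    · rw [Category.assoc, geomLift_hom, ← Spec.map_comp, ← CommRingCat.ofHom_comp, hi₂,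
        SpecMap_constMap]
  have hpt : h (IsLocalRing.closedPoint A) = genericPoint (geom S).left := by
    have h1 := Scheme.fromSpecStalk_closedPoint (X := (geom S).left)
      (x := genericPoint (geom S).left)
    refine Eq.trans ?_ h1
    change _ = fromSpecFunctionField (geom S).left _
    rw [← hih]
    refine Eq.trans ?_ (Scheme.Hom.comp_apply _ _ _).symm
    exact congr_arg h (Subsingleton.elim (α := PrimeSpectrum A) _ _)
  obtain ⟨r, hr⟩ := exists_SpecMap_fromSpecStalk h hpt
  have hri : r ≫ CommRingCat.ofHom i = 𝟙 _ := by
    apply Spec.map_injective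
    rw [← cancel_mono ((geom S).left.fromSpecStalk (genericPoint (geom S).left)), Spec.map_comp,
      Category.assoc, hr, hih, Spec.map_id]
    exact (Category.id_comp _).symm
  obtain ⟨t, ht⟩ : ∃ t, μ t = f := by
    have := congr($(hri).hom f)
    obtain ⟨t, ht⟩ := (r.hom f).2
    exact ⟨t, ht.trans this⟩
  obtain ⟨s, rfl⟩ := TensorProduct.exists_finset t
  refine ⟨s, ?_⟩
  rw [← ht, map_sum]
  exact Finset.sum_congr rfl fun p _ ↦ Algebra.TensorProduct.productMap_apply_tmul _ _ _ _

/-- Only finitely many constants occur in `f`. This is the continuity of the Galois action that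
descent needs. -/
lemma exists_finiteDimensional_fixing (f : (geom S).left.functionField) :
    ∃ E : IntermediateField k (AlgebraicClosure k), FiniteDimensional k E ∧
      ∀ σ ∈ E.fixingSubgroup, galAct S σ f = f := by
  obtain ⟨s, rfl⟩ := exists_eq_sum f
  refine ⟨IntermediateField.adjoin k (Prod.snd '' (SetLike.coe s)),
    IntermediateField.finiteDimensional_adjoin fun x _ ↦ Algebra.IsIntegral.isIntegral x,
    fun σ hσ ↦ ?_⟩
  rw [map_sum]
  refine Finset.sum_congr rfl fun p hp ↦ ?_
  rw [map_mul, galAct_pull, galAct_constMap]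
  congr 2
  exact (IntermediateField.mem_fixingSubgroup_iff _ _).1 hσ _
    (IntermediateField.subset_adjoin _ _ (Set.mem_image_of_mem _ (Finset.mem_coe.2 hp)))

/-- Galois-invariant rational functions on the base change are defined over the base field. -/
lemma exists_pull_eq [CharZero k] (f : (geom S).left.functionField)
    (hf : ∀ σ, galAct S σ f = f) : ∃ g, pull S g = f := by
  obtain ⟨s, hs⟩ := exists_eq_sum f
  let E₀ := IntermediateField.adjoin k (Prod.snd '' (SetLike.coe s))
  have hE₀ : FiniteDimensional k E₀ :=
    IntermediateField.finiteDimensional_adjoin fun x _ ↦ Algebra.IsIntegral.isIntegral x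
  let E : IntermediateField k (AlgebraicClosure k) :=
    IntermediateField.normalClosure k E₀ (AlgebraicClosure k)
  have : FiniteDimensional k E := normalClosure.is_finiteDimensional k E₀ (AlgebraicClosure k)
  have : Normal k E := normalClosure.normal k E₀ (AlgebraicClosure k)
  have : IsGalois k E := { }
  have hE : ∀ p ∈ s, p.2 ∈ E := fun p hp ↦ E₀.le_normalClosure
    (IntermediateField.subset_adjoin _ _ (Set.mem_image_of_mem _ (Finset.mem_coe.2 hp)))
  -- Averaging over the finite Galois group replaces the constants by their traces, which lie in
  -- `k`.
  have hsum : (Fintype.card Gal(E/k) : (geom S).left.functionField) * f =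
      ∑ p ∈ s.attach, pull S p.1.1 *
        constMap (algebraMap k (AlgebraicClosure k) (Algebra.trace k E ⟨p.1.2, hE _ p.2⟩)) := by
    calc _ = ∑ τ : Gal(E/k), galAct S (τ.liftNormal (AlgebraicClosure k)) f := by
          simp [hf]
      _ = ∑ τ : Gal(E/k), ∑ p ∈ s.attach, pull S p.1.1 *
            constMap (algebraMap E (AlgebraicClosure k) (τ ⟨p.1.2, hE _ p.2⟩)) := by
          refine Finset.sum_congr rfl fun τ _ ↦ ?_
          rw [hs, ← Finset.sum_attach, map_sum]
          refine Finset.sum_congr rfl fun p _ ↦ ?_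
          rw [map_mul, galAct_pull, galAct_constMap, ← AlgEquiv.liftNormal_commutes]
          rfl
      _ = _ := by
          rw [Finset.sum_comm]
          refine Finset.sum_congr rfl fun p _ ↦ ?_
          rw [← Finset.mul_sum, ← map_sum, ← map_sum, ← trace_eq_sum_automorphisms,
            ← IsScalarTower.algebraMap_apply]
  have : CharZero (geom S).left.functionField :=
    charZero_of_injective_ringHom ((constMap (X := geom S)).comp
      (algebraMap k (AlgebraicClosure k))).injective
  have hcard : (Fintype.card Gal(E/k) : (geom S).left.functionField) ≠ 0 :=
    Nat.cast_ne_zero.2 Fintype.card_ne_zero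
  refine ⟨(Fintype.card Gal(E/k) : S.left.functionField)⁻¹ * ∑ p ∈ s.attach, p.1.1 *
    constMap (Algebra.trace k E ⟨p.1.2, hE _ p.2⟩), ?_⟩
  rw [map_mul, map_inv₀, map_natCast, inv_mul_eq_iff_eq_mul₀ hcard, hsum, map_sum]
  exact Finset.sum_congr rfl fun p _ ↦ by rw [map_mul, pull_constMap]

end Galois

/-! ### Semilinear substitutions and changes of coordinates -/

section Substitution

open MvPolynomial

variable {F F' : Type u} [Field F] [Field F']

lemma exists_X_notMem (x : ProjectiveSpectrum (forms F)) :
    ∃ i, (X i : Ternary F) ∉ x.asHomogeneousIdeal := by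
  by_contra! h
  refine x.not_irrelevant_le fun p hp ↦ ?_
  have hle : Ideal.span (X '' Set.univ : Set (Ternary F)) ≤ x.asHomogeneousIdeal.toIdeal := by
    rw [Ideal.span_le]
    rintro _ ⟨i, -, rfl⟩
    exact h i
  refine hle (mem_ideal_span_X_image.2 fun m hm ↦ ?_)
  by_contra! hm0
  obtain rfl : m = 0 := Finsupp.ext fun i ↦ hm0 i trivial
  rw [mem_support_iff] at hm
  apply hm
  rw [HomogeneousIdeal.mem_irrelevant_iff, GradedRing.proj_apply] at hp
  have h2 : (homogeneousComponent 0 p : Ternary F) = 0 := by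
    rw [← hp]
    exact (decomposition.decompose'_apply p 0).symm
  rw [homogeneousComponent_zero] at h2
  exact C_eq_zero.1 h2

/-- Contraction of homogeneous prime ideals along a ring homomorphism that preserves forms. -/
def comapPt (φ : Ternary F →+* Ternary F') (hφ : ∀ n, ∀ a ∈ forms F n, φ a ∈ forms F' n)
    (hirr : ∀ I : Ideal (Ternary F'), (∀ i, φ (X i) ∈ I) → ∀ i, X i ∈ I)
    (x : ProjectiveSpectrum (forms F')) : ProjectiveSpectrum (forms F) where
  asHomogeneousIdeal := x.asHomogeneousIdeal.comap
    (𝒜 := forms F) { φ with map_mem := fun {n a} ↦ hφ n a }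
  isPrime := x.isPrime.comap φ
  not_irrelevant_le h := by
    obtain ⟨i, hi⟩ := exists_X_notMem x
    exact hi (hirr x.asHomogeneousIdeal.toIdeal (fun i ↦ h (X_mem_irrelevant i)) i)

lemma point_ext {x y : ProjectiveSpectrum (forms F)}
    (h : ∀ a, a ∈ x.asHomogeneousIdeal ↔ a ∈ y.asHomogeneousIdeal) : x = y :=
  ProjectiveSpectrum.ext (HomogeneousIdeal.ext (Ideal.ext h))

/-- The semilinear substitution that applies `σ` to the coefficients and `T` to the variables. -/
def formSubst (σ : F →+* F) (T : forms F 1 → forms F 1) : Ternary F →+* Ternary F :=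
  eval₂Hom (C.comp σ) fun i ↦ T (formsBasis F i)

lemma formSubst_C (σ : F →+* F) (T : forms F 1 → forms F 1) (r : F) :
    formSubst σ T (C r) = C (σ r) := eval₂Hom_C _ _ _

lemma formSubst_X (σ : F →+* F) (T : forms F 1 → forms F 1) (i : Fin 3) :
    formSubst σ T (X i) = T (formsBasis F i) := eval₂Hom_X' _ _ _

lemma formSubst_coe {σ : F →+* F} {T : forms F 1 ≃+ forms F 1}
    (hT : ∀ (r : F) (a : forms F 1), T (r • a) = σ r • T a) (v : forms F 1) :
    formSubst σ T v = T v := by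
  conv_lhs => rw [← (formsBasis F).sum_repr v]
  conv_rhs => rw [← (formsBasis F).sum_repr v]
  simp only [Submodule.coe_sum, map_sum, Submodule.coe_smul, hT, smul_eq_C_mul, map_mul,
    formSubst_C, coe_formsBasis, formSubst_X]

lemma formSubst_mem {σ : F →+* F} {T : forms F 1 → forms F 1} (n : ℕ) (a : Ternary F)
    (ha : a ∈ forms F n) : formSubst σ T a ∈ forms F n := by
  have := IsHomogeneous.eval₂ (m := n) (n := 1) ha (C.comp σ)
    (fun i ↦ (T (formsBasis F i) : Ternary F)) (fun r ↦ isHomogeneous_C _ _)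
    (fun i ↦ (T (formsBasis F i)).2)
  rwa [one_mul] at this

lemma formSubst_formSubst {σ τ : F →+* F} {T U : forms F 1 ≃+ forms F 1}
    (hT : ∀ (r : F) (a : forms F 1), T (r • a) = σ r • T a) (hσ : ∀ r, σ (τ r) = r)
    (hTU : ∀ a, T (U a) = a) (p : Ternary F) : formSubst σ T (formSubst τ U p) = p := by
  suffices (formSubst σ T).comp (formSubst τ U) = RingHom.id _ from RingHom.congr_fun this p
  refine MvPolynomial.ringHom_ext (fun r ↦ ?_) fun i ↦ ?_
  · rw [RingHom.comp_apply, formSubst_C, formSubst_C, hσ, RingHom.id_apply]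
  · rw [RingHom.comp_apply, formSubst_X, formSubst_coe hT, hTU, coe_formsBasis, RingHom.id_apply]

lemma eval₂_mul_of_mem {R : Type*} [CommRing R] (g : F →+* R) (t : R) (v : Fin 3 → R) {n : ℕ}
    {p : Ternary F} (hp : p ∈ forms F n) :
    eval₂ g (fun i ↦ t * v i) p = t ^ n * eval₂ g v p := by
  rw [eval₂_eq, eval₂_eq, Finset.mul_sum]
  refine Finset.sum_congr rfl fun m hm ↦ ?_
  have h := hp (mem_support_iff.1 hm)
  simp only [mul_pow, Finset.prod_mul_distrib, Finset.prod_pow_eq_pow_sum]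
  rw [← h, Finsupp.weight_apply, Finsupp.sum]
  simp
  ring

variable {X : Over (SpecOf F)} [IsIntegral X.left] (c : PlaneCoords X)

/-- Quotients of linear forms and constants generate the function field, so a lift determines the
whole action. A form is written as a power of the first variable times a polynomial in the quotients
`W i`. -/
lemma IsLift.val_eq {c : PlaneCoords X} {θ : X.left.functionField →+* X.left.functionField}
    {σ : F →+* F} {T : forms F 1 ≃+ forms F 1} (h : IsLift c θ σ T)
    (hθ : ∀ r, θ (constMap r) = constMap (X := X) (σ r)) {n : ℕ} {a b : Ternary F}
    (ha : a ∈ forms F n) (hb : b ∈ forms F n) (hb0 : b ≠ 0) {f : X.left.functionField}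
    (hf : c.val f = quot a b) :
    c.val (θ f) = quot (formSubst σ T a) (formSubst σ T b) := by
  let l := formsBasis F
  have hl0 : l 0 ≠ 0 := l.ne_zero 0
  have hl0' : (l 0 : Ternary F) ≠ 0 := by simpa using hl0
  have hTl0 : (T (l 0) : Ternary F) ≠ 0 := by simpa using hl0
  let W (i) : X.left.functionField := c.frac (l i).2 (l 0).2 hl0'
  let Φ : Ternary F →+* X.left.functionField := eval₂Hom constMap W
  have h1 {n : ℕ} {p : Ternary F} (hp : p ∈ forms F n) :
      algebraMap _ (TernaryFrac F) p = algebraMap _ _ (l 0 : Ternary F) ^ n * c.val (Φ p) := by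
    have e : c.val (Φ p) = eval₂ ((algebraMap (Ternary F) (TernaryFrac F)).comp C)
        (fun i ↦ quot (l i : Ternary F) (l 0)) p := by
      simp only [Φ, coe_eval₂Hom, hom_eval₂]
      congr 1
      · ext r
        simp [c.val_const, quot]
      · ext i
        simp [W]
    rw [e, ← eval₂_mul_of_mem _ _ _ hp]
    have : (fun i ↦ algebraMap (Ternary F) (TernaryFrac F) (l 0) * quot (l i : Ternary F) (l 0)) =
        fun i ↦ algebraMap (Ternary F) (TernaryFrac F) (MvPolynomial.X i) := by
      ext i
      rw [quot, mul_div_cancel₀ _ (algebraMap_ternary_ne_zero hl0'), coe_formsBasis]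
    rw [this]
    have h3 := hom_eval₂ p C (algebraMap (Ternary F) (TernaryFrac F)) MvPolynomial.X
    rwa [eval₂_eta] at h3
  have h2 {n : ℕ} {p : Ternary F} (hp : p ∈ forms F n) :
      algebraMap _ (TernaryFrac F) (formSubst σ T p) =
        algebraMap _ _ (T (l 0) : Ternary F) ^ n * c.val (θ (Φ p)) := by
    have e : c.val (θ (Φ p)) = eval₂ ((algebraMap (Ternary F) (TernaryFrac F)).comp (C.comp σ))
        (fun i ↦ quot (T (l i) : Ternary F) (T (l 0))) p := by
      simp only [Φ, coe_eval₂Hom, hom_eval₂]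
      congr 1
      · ext r
        simp [hθ, c.val_const, quot]
      · ext i
        exact h.map_quot _ _ _ hl0 (c.val_frac _ _ _)
    rw [e, ← eval₂_mul_of_mem _ _ _ hp]
    have : (fun i ↦ algebraMap (Ternary F) (TernaryFrac F) (T (l 0)) *
        quot (T (l i) : Ternary F) (T (l 0))) =
        fun i ↦ algebraMap (Ternary F) (TernaryFrac F) (T (l i)) := by
      ext i
      rw [quot, mul_div_cancel₀ _ (algebraMap_ternary_ne_zero hTl0)]
    rw [this]
    exact hom_eval₂ p (C.comp σ) (algebraMap (Ternary F) (TernaryFrac F))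
      fun i ↦ (T (l i) : Ternary F)
  have hA := algebraMap_ternary_ne_zero hb0
  have hΦb : Φ b ≠ 0 := by
    intro h0
    rw [h1 hb, h0, map_zero c.val, mul_zero] at hA
    exact hA rfl
  obtain rfl : f = Φ a / Φ b := by
    apply c.val_injective
    rw [hf, quot, h1 ha, h1 hb, map_div₀]
    exact mul_div_mul_left _ _ (pow_ne_zero _ (algebraMap_ternary_ne_zero hl0'))
  rw [quot, h2 ha, h2 hb, map_div₀, map_div₀]
  exact (mul_div_mul_left _ _ (pow_ne_zero _ (algebraMap_ternary_ne_zero hTl0))).symm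

/-- The automorphism of the polynomial ring given by a linear change of variables. -/
def linearSubst (T : forms F 1 ≃ₗ[F] forms F 1) : Ternary F ≃+* Ternary F where
  __ := formSubst (RingHom.id F) T.toAddEquiv
  invFun := formSubst (RingHom.id F) T.symm.toAddEquiv
  left_inv := formSubst_formSubst (T := T.symm.toAddEquiv) (U := T.toAddEquiv)
    (fun r a ↦ T.symm.map_smul r a) (fun _ ↦ rfl) T.symm_apply_apply
  right_inv := formSubst_formSubst (T := T.toAddEquiv) (U := T.symm.toAddEquiv)
    (fun r a ↦ T.map_smul r a) (fun _ ↦ rfl) T.apply_symm_apply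

lemma linearSubst_coe (T : forms F 1 ≃ₗ[F] forms F 1) (v : forms F 1) :
    linearSubst T v = T v :=
  formSubst_coe (T := T.toAddEquiv) (fun r a ↦ T.map_smul r a) v

lemma linearSubst_C (T : forms F 1 ≃ₗ[F] forms F 1) (r : F) :
    linearSubst T (C r) = C r := formSubst_C _ _ _

lemma linearSubst_mem (T : forms F 1 ≃ₗ[F] forms F 1) (n : ℕ) (a : Ternary F)
    (ha : a ∈ forms F n) : linearSubst T a ∈ forms F n := formSubst_mem n a ha

lemma linearSubst_symm (T : forms F 1 ≃ₗ[F] forms F 1) :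
    linearSubst T.symm = (linearSubst T).symm := rfl

/-- The bijection of points of the projective plane given by a linear change of variables. -/
def linearPt (T : forms F 1 ≃ₗ[F] forms F 1) (x : ProjectiveSpectrum (forms F)) :
    ProjectiveSpectrum (forms F) :=
  comapPt (linearSubst T) (linearSubst_mem T) (fun I h i ↦ by
    have h2 : (linearSubst T : Ternary F →+* Ternary F) (linearSubst T.symm (MvPolynomial.X i)) =
      MvPolynomial.X i := (linearSubst T).apply_symm_apply _
    rw [← h2]
    have h3 : linearSubst T.symm (MvPolynomial.X i) ∈
        Submodule.span F (Set.range (MvPolynomial.X : Fin 3 → Ternary F)) := by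
      rw [← homogeneousSubmodule_one_eq_span_X]
      exact linearSubst_mem _ _ _ (X_mem_forms i)
    generalize linearSubst T.symm (MvPolynomial.X i) = p at h3
    induction h3 using Submodule.span_induction with
    | mem x hx => obtain ⟨j, rfl⟩ := hx; exact h j
    | zero => rw [map_zero]; exact zero_mem _
    | add x y _ _ hx hy => rw [map_add]; exact add_mem hx hy
    | smul r x _ hx => rw [smul_eq_C_mul, map_mul]; exact Ideal.mul_mem_left _ _ hx) x

namespace PlaneCoords

/-- Linear change of homogeneous coordinates. -/
def changeCoords (T : forms F 1 ≃ₗ[F] forms F 1) : PlaneCoords X where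
  val := (IsFractionRing.ringEquivOfRingEquiv (K := TernaryFrac F) (L := TernaryFrac F)
    (linearSubst T) : TernaryFrac F →+* TernaryFrac F).comp c.val
  pt := c.pt.trans
    { toFun := linearPt T.symm
      invFun := linearPt T
      left_inv x := point_ext fun a ↦ by
        change linearSubst T.symm (linearSubst T a) ∈ x.asHomogeneousIdeal ↔ _
        rw [linearSubst_symm, RingEquiv.symm_apply_apply]
      right_inv x := point_ext fun a ↦ by
        change linearSubst T (linearSubst T.symm a) ∈ x.asHomogeneousIdeal ↔ _
        rw [linearSubst_symm, RingEquiv.apply_symm_apply] }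
  specializes_iff x y := by
    rw [c.specializes_iff]
    refine ⟨fun h a ha ↦ h ha, fun h a ha ↦ ?_⟩
    have : linearSubst T.symm (linearSubst T a) ∈ (c.pt y).asHomogeneousIdeal := h (by
      change linearSubst T.symm (linearSubst T a) ∈ (c.pt x).asHomogeneousIdeal
      rwa [linearSubst_symm, RingEquiv.symm_apply_apply])
    rwa [linearSubst_symm, RingEquiv.symm_apply_apply] at this
  val_mem x f hf := by
    obtain ⟨n, a, ha, b, hb, hbx, h⟩ := c.val_mem x f hf
    refine ⟨n, _, linearSubst_mem T n a ha, _, linearSubst_mem T n b hb, ?_, ?_⟩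
    · change linearSubst T.symm (linearSubst T b) ∉ (c.pt x).asHomogeneousIdeal
      rwa [linearSubst_symm, RingEquiv.symm_apply_apply]
    · rw [RingHom.comp_apply, h]
      simp [quot]
  exists_val x n a ha b hb hbx := by
    obtain ⟨f, hf, h⟩ := c.exists_val x n _ (linearSubst_mem T.symm n a ha) _
      (linearSubst_mem T.symm n b hb) hbx
    refine ⟨f, hf, ?_⟩
    rw [RingHom.comp_apply, h]
    simp [quot, linearSubst_symm]
  val_const r := by
    rw [RingHom.comp_apply, c.val_const]
    simp [quot, linearSubst_C]

lemma changeCoords_val (T : forms F 1 ≃ₗ[F] forms F 1) {f : X.left.functionField}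
    {a b : Ternary F} (hf : c.val f = quot a b) :
    (c.changeCoords T).val f = quot (linearSubst T a) (linearSubst T b) := by
  change IsFractionRing.ringEquivOfRingEquiv (K := TernaryFrac F) (L := TernaryFrac F)
    (linearSubst T) (c.val f) = _
  rw [hf]
  simp [quot]

lemma val_of_changeCoords_val (T : forms F 1 ≃ₗ[F] forms F 1) {f : X.left.functionField}
    {a b : Ternary F} (hf : (c.changeCoords T).val f = quot a b) :
    c.val f = quot (linearSubst T.symm a) (linearSubst T.symm b) := by
  change IsFractionRing.ringEquivOfRingEquiv (K := TernaryFrac F) (L := TernaryFrac F)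
    (linearSubst T) (c.val f) = _ at hf
  rw [← RingEquiv.eq_symm_apply] at hf
  rw [hf, IsFractionRing.ringEquivOfRingEquiv_symm]
  simp [quot, linearSubst_symm]

end PlaneCoords

lemma IsLift.changeCoords {c : PlaneCoords X} {θ : X.left.functionField →+* X.left.functionField}
    {σ : F →+* F} {T : forms F 1 ≃+ forms F 1} (h : IsLift c θ σ T)
    (U : forms F 1 ≃ₗ[F] forms F 1) :
    IsLift (c.changeCoords U) θ σ ((U.symm.toAddEquiv.trans T).trans U.toAddEquiv) where
  map_smul r a := by simp [h.map_smul]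
  map_quot f a b hb hf := by
    have h1 := h.map_quot f (U.symm a) (U.symm b) (by simpa using hb) (by
      rw [c.val_of_changeCoords_val U hf, linearSubst_coe, linearSubst_coe])
    rw [c.changeCoords_val U h1, linearSubst_coe, linearSubst_coe]
    rfl

end Substitution

/-! ### Galois descent and rational coordinates -/

section Descent

variable {k : Type u} [Field k]

/-- Galois descent for vector spaces: a continuous semilinear action is generated by invariants. -/
lemma span_invariants_eq_top [CharZero k] {V : Type*} [AddCommGroup V]
    [Module (AlgebraicClosure k) V] (A : Gal(AlgebraicClosure k/k) → V → V)
    (hadd : ∀ σ v w, A σ (v + w) = A σ v + A σ w)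
    (hsmul : ∀ σ (r : AlgebraicClosure k) v, A σ (r • v) = σ r • A σ v)
    (hmul : ∀ σ τ v, A (σ * τ) v = A σ (A τ v))
    (hfix : ∀ v, ∃ E : IntermediateField k (AlgebraicClosure k), FiniteDimensional k E ∧
      ∀ σ ∈ E.fixingSubgroup, A σ v = v) :
    Submodule.span (AlgebraicClosure k) {v | ∀ σ, A σ v = v} = ⊤ := by
  by_contra hne
  obtain ⟨ℓ, hℓ0, hℓ⟩ := Submodule.exists_le_ker_of_lt_top _ (lt_top_iff_ne_top.2 hne)
  obtain ⟨v, hv⟩ : ∃ v, ℓ v ≠ 0 := by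
    by_contra! h
    exact hℓ0 (LinearMap.ext h)
  obtain ⟨E₀, hE₀, hE₀v⟩ := hfix v
  let E : IntermediateField k (AlgebraicClosure k) :=
    IntermediateField.normalClosure k E₀ (AlgebraicClosure k)
  have : FiniteDimensional k E := normalClosure.is_finiteDimensional k E₀ (AlgebraicClosure k)
  have : Normal k E := normalClosure.normal k E₀ (AlgebraicClosure k)
  have hsum (σ) {ι : Type _} (s : Finset ι) (f : ι → V) :
      A σ (∑ i ∈ s, f i) = ∑ i ∈ s, A σ (f i) :=
    map_sum (AddMonoidHom.mk' (A σ) (hadd σ)) f s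
  -- On `E`-multiples of `v` only the restriction to `E` matters. This is needed because the lifts
  -- `L τ` below need not form a group.
  have hcongr (σ τ : Gal(AlgebraicClosure k/k)) (h : ∀ x : E, σ x = τ x) (a : E) :
      A σ ((a : AlgebraicClosure k) • v) = A τ ((a : AlgebraicClosure k) • v) := by
    have h1 : A (τ⁻¹ * σ) v = v := by
      refine hE₀v _ ((IntermediateField.mem_fixingSubgroup_iff _ _).2 fun x hx ↦ ?_)
      have := h ⟨x, E₀.le_normalClosure hx⟩
      change τ.symm (σ x) = x
      rw [AlgEquiv.symm_apply_eq]
      exact this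
    have h2 : σ = τ * (τ⁻¹ * σ) := by group
    rw [hsmul, hsmul, h a]
    nth_rewrite 1 [h2]
    rw [hmul, h1]
  let L (τ : Gal(E/k)) : Gal(AlgebraicClosure k/k) := τ.liftNormal (AlgebraicClosure k)
  have hL (τ : Gal(E/k)) (x : E) : L τ x = τ x := τ.liftNormal_commutes (AlgebraicClosure k) x
  have hinv (a : E) (σ) : A σ (∑ τ, A (L τ) ((a : AlgebraicClosure k) • v)) =
      ∑ τ, A (L τ) ((a : AlgebraicClosure k) • v) := by
    rw [hsum]
    refine Fintype.sum_equiv (Equiv.mulLeft (σ.restrictNormal E)) _ _ fun τ ↦ ?_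
    rw [← hmul]
    refine hcongr _ _ (fun x ↦ ?_) a
    rw [hL, Equiv.coe_mulLeft, AlgEquiv.mul_apply, AlgEquiv.mul_apply, hL]
    exact (σ.restrictNormal_commutes E (τ x)).symm
  -- The functional `ℓ` kills the invariant sums for all `a`, a linear relation between the
  -- characters `τ` of `E`.
  have hzero (a : E) : ∑ τ : Gal(E/k), ℓ (A (L τ) v) * (τ a : AlgebraicClosure k) = 0 := by
    have h := hℓ (Submodule.subset_span (hinv a))
    rw [LinearMap.mem_ker, map_sum] at h
    rw [← h]
    refine Finset.sum_congr rfl fun τ _ ↦ ?_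
    rw [hsmul, hL, map_smul, smul_eq_mul, mul_comm]
  let χ (τ : Gal(E/k)) : E →* AlgebraicClosure k :=
    ((algebraMap E (AlgebraicClosure k)).comp (τ : E →+* E)).toMonoidHom
  have hχ : Function.Injective χ := by
    intro τ τ' h
    ext x
    exact DFunLike.congr_fun h x
  have hli := (linearIndependent_monoidHom E (AlgebraicClosure k)).comp χ hχ
  rw [Fintype.linearIndependent_iff] at hli
  -- Independence of characters makes every coefficient vanish; the one at `τ = 1` is `ℓ v`.
  have h1 := hli (fun τ ↦ ℓ (A (L τ) v)) (by
    ext a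
    rw [Finset.sum_apply]
    exact hzero a) 1
  have h2 : A (L 1) v = v :=
    hE₀v _ ((IntermediateField.mem_fixingSubgroup_iff _ _).2 fun x hx ↦
      hL 1 ⟨x, E₀.le_normalClosure hx⟩)
  rw [h2] at h1
  exact hv h1

section Lifts

variable {F : Type u} [Field F] {X : Over (SpecOf F)} [IsIntegral X.left] {c : PlaneCoords X}
  {θ : X.left.functionField →+* X.left.functionField} {σ : F →+* F} {T : forms F 1 ≃+ forms F 1}

lemma IsLift.smul (h : IsLift c θ σ T) {r : F} (hr : r ≠ 0) :
    IsLift c θ σ (T.trans (LinearEquiv.smulOfNeZero F (forms F 1) r hr).toAddEquiv) where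
  map_smul t a := by
    change r • T (t • a) = σ t • r • T a
    rw [h.map_smul, smul_comm]
  map_quot f a b hb hf := by
    change _ = quot (r • (T a : Ternary F)) (r • (T b : Ternary F))
    rw [MvPolynomial.smul_eq_C_mul, MvPolynomial.smul_eq_C_mul, quot_mul_cancel_left,
      h.map_quot f a b hb hf]
    rwa [Ne, MvPolynomial.C_eq_zero]

lemma IsLift.map_frac (h : IsLift c θ σ T) {w : forms F 1} (hw : w ≠ 0)
    (hw' : (w : Ternary F) ≠ 0) (hTw : T w = w) (v : forms F 1) :
    θ (c.frac v.2 w.2 hw') = c.frac (T v).2 w.2 hw' := by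
  apply c.val_injective
  rw [h.map_quot _ v w hw (c.val_frac _ _ _), hTw, c.val_frac]

lemma PlaneCoords.frac_inj (c : PlaneCoords X) {w v v' : forms F 1} (hw' : (w : Ternary F) ≠ 0)
    (hv : c.frac v.2 w.2 hw' = c.frac v'.2 w.2 hw') : v = v' := by
  have := congr_arg c.val hv
  rw [c.val_frac, c.val_frac, quot_inj hw'] at this
  exact Subtype.ext this

/-- Once the fixed basis becomes the variables, the substitution attached to the lift only changes
coefficients. -/
lemma IsLift.val_eq_of_basis (h : IsLift c θ σ T)
    (hθ : ∀ r, θ (constMap r) = constMap (X := X) (σ r)) (l : Module.Basis (Fin 3) F (forms F 1))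
    (hl : ∀ i, T (l i) = l i) {n : ℕ} {a b : Ternary F} (ha : a ∈ forms F n) (hb : b ∈ forms F n)
    (hb0 : b ≠ 0) {f : X.left.functionField}
    (hf : (c.changeCoords (l.equiv (formsBasis F) (Equiv.refl _))).val f = quot a b) :
    (c.changeCoords (l.equiv (formsBasis F) (Equiv.refl _))).val (θ f) =
      quot (MvPolynomial.map σ a) (MvPolynomial.map σ b) := by
  set U := l.equiv (formsBasis F) (Equiv.refl _) with hU
  have hUl (i) : U (l i) = formsBasis F i := by simp [U]
  rw [(h.changeCoords U).val_eq hθ ha hb hb0 hf]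
  have hmap : formSubst σ ((U.symm.toAddEquiv.trans T).trans U.toAddEquiv) =
      MvPolynomial.map σ := by
    refine MvPolynomial.ringHom_ext (fun r ↦ ?_) fun i ↦ ?_
    · rw [formSubst_C, MvPolynomial.map_C]
    · rw [formSubst_X, MvPolynomial.map_X, ← coe_formsBasis]
      congr 1
      change U (T (U.symm (formsBasis F i))) = _
      rw [← hUl, LinearEquiv.symm_apply_apply, hl]
  rw [hmap]

end Lifts

variable {S : Over (SpecOf k)} [IsIntegral (geom S).left]

lemma exists_isLift_galAct (c : PlaneCoords (geom S)) (σ : Gal(AlgebraicClosure k/k)) :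
    ∃ T, IsLift c (galAct S σ) (σ : AlgebraicClosure k →+* AlgebraicClosure k) T :=
  exists_isLift c (galMap S σ) σ.toRingEquiv (galAct_constMap σ)

/-- Homogeneous coordinates are rational if the Galois group acts through the coefficients. -/
def PlaneCoords.IsRational (c : PlaneCoords (geom S)) : Prop :=
  ∀ (σ : Gal(AlgebraicClosure k/k)) (n : ℕ), ∀ a ∈ forms (AlgebraicClosure k) n,
    ∀ b ∈ forms (AlgebraicClosure k) n, b ≠ 0 → ∀ f, c.val f = quot a b →
      c.val (galAct S σ f) = quot (MvPolynomial.map (σ : AlgebraicClosure k →+* _) a)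
        (MvPolynomial.map (σ : AlgebraicClosure k →+* _) b)

variable [IsIntegral S.left]

/-- If the Galois group preserves a line, then there are rational homogeneous coordinates. -/
lemma exists_isRational [CharZero k] (c : PlaneCoords (geom S)) (w : forms (AlgebraicClosure k) 1)
    (hw : w ≠ 0) (h : ∀ (σ : Gal(AlgebraicClosure k/k)) (T),
      IsLift c (galAct S σ) (σ : AlgebraicClosure k →+* AlgebraicClosure k) T →
        ∃ r : AlgebraicClosure k, T w = r • w) :
    ∃ c' : PlaneCoords (geom S), c'.IsRational := by
  have key (σ : Gal(AlgebraicClosure k/k)) : ∃ A, A w = w ∧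
      IsLift c (galAct S σ) (σ : AlgebraicClosure k →+* AlgebraicClosure k) A := by
    obtain ⟨T, hT⟩ := exists_isLift_galAct c σ
    obtain ⟨r, hr⟩ := h σ T hT
    have hr0 : r ≠ 0 := by
      rintro rfl
      rw [zero_smul] at hr
      exact hw (T.map_eq_zero_iff.1 hr)
    exact ⟨_, (congr_arg (r⁻¹ • ·) hr).trans (inv_smul_smul₀ hr0 w), hT.smul (inv_ne_zero hr0)⟩
  choose A hAw hA using key
  have hw' : (w : Ternary (AlgebraicClosure k)) ≠ 0 := fun h ↦ hw (Subtype.ext h)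
  have hfrac (σ v) : galAct S σ (c.frac v.2 w.2 hw') = c.frac (A σ v).2 w.2 hw' :=
    (hA σ).map_frac hw hw' (hAw σ) v
  -- Normalising `A σ w = w` removes the scalar ambiguity: `A σ v` is read off from the action on `v
  -- / w`, so no cocycle remains.
  have hmul (σ τ v) : A (σ * τ) v = A σ (A τ v) := c.frac_inj hw' (by
    refine (hfrac _ _).symm.trans ((galAct_mul _ _ _).trans ?_)
    rw [hfrac, hfrac])
  have hspan := span_invariants_eq_top (k := k) (fun σ v ↦ A σ v) (fun σ ↦ (A σ).map_add)
    (fun σ ↦ (hA σ).map_smul) hmul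
    (fun v ↦ by
      obtain ⟨E, hE, hv⟩ := exists_finiteDimensional_fixing (c.frac v.2 w.2 hw')
      exact ⟨E, hE, fun σ hσ ↦ c.frac_inj hw' ((hfrac σ v).symm.trans (hv σ hσ))⟩)
  let l₀ := Module.Basis.ofSpan hspan.ge
  have hl₀ (i) (σ) : A σ (l₀ i) = l₀ i :=
    Module.Basis.ofSpan_subset hspan.ge (Set.mem_range_self i) σ
  let l := l₀.reindex (l₀.indexEquiv (formsBasis _))
  refine ⟨c.changeCoords (l.equiv (formsBasis _) (Equiv.refl _)), fun σ n a ha b hb hb0 f hf ↦ ?_⟩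
  refine (hA σ).val_eq_of_basis (galAct_constMap σ) l (fun i ↦ ?_) ha hb hb0 hf
  rw [Module.Basis.reindex_apply, hl₀]

end Descent

/-! ### Rational coordinates force triviality -/

section Trivial

open MvPolynomial

variable {k : Type u} [Field k]

variable (k) in
/-- Extension of scalars of ternary polynomials to the algebraic closure. -/
def extend : Ternary k →+* Ternary (AlgebraicClosure k) :=
  MvPolynomial.map (algebraMap k (AlgebraicClosure k))

lemma extend_injective : Function.Injective (extend k) :=
  MvPolynomial.map_injective _ (algebraMap k (AlgebraicClosure k)).injective

lemma extend_mem_iff {n : ℕ} {p : Ternary k} :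
    extend k p ∈ forms (AlgebraicClosure k) n ↔ p ∈ forms k n :=
  ⟨fun h ↦ IsHomogeneous.of_map (algebraMap k (AlgebraicClosure k)).injective h,
    fun h ↦ IsHomogeneous.map h _⟩

lemma exists_extend_eq [CharZero k] {p : Ternary (AlgebraicClosure k)}
    (hp : ∀ σ : Gal(AlgebraicClosure k/k),
      MvPolynomial.map (σ : AlgebraicClosure k →+* AlgebraicClosure k) p = p) :
    ∃ q, extend k q = p := by
  have : IsGalois k (AlgebraicClosure k) := { }
  refine mem_range_map_iff_coeffs_subset.2 fun r hr ↦ ?_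
  obtain ⟨m, -, rfl⟩ := mem_coeffs_iff.1 hr
  have h : coeff m p ∈ (⊥ : IntermediateField k (AlgebraicClosure k)) := by
    rw [InfiniteGalois.mem_bot_iff_fixed]
    intro σ
    have := congr_arg (coeff m) (hp σ)
    rwa [coeff_map] at this
  exact IntermediateField.mem_bot.1 h

/-- Scale so that one coefficient of `b` is `1`. By coprimality `b` divides its conjugate, which has
the same degree, so the quotient is a constant; the normalised coefficient shows that it is `1`.
Hence `a` and `b` are both invariant. -/
lemma exists_rational_fraction [CharZero k] {n : ℕ} {a b : Ternary (AlgebraicClosure k)}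
    (ha : a ∈ forms (AlgebraicClosure k) n) (hb : b ∈ forms (AlgebraicClosure k) n)
    (hb0 : b ≠ 0) (hab : IsRelPrime a b) (hσ : ∀ σ : Gal(AlgebraicClosure k/k),
      quot (MvPolynomial.map (σ : AlgebraicClosure k →+* AlgebraicClosure k) a)
        (MvPolynomial.map (σ : AlgebraicClosure k →+* AlgebraicClosure k) b) = quot a b) :
    ∃ p ∈ forms k n, ∃ q ∈ forms k n, q ≠ 0 ∧ IsRelPrime (extend k p) (extend k q) ∧
      quot a b = quot (extend k p) (extend k q) := by
  obtain ⟨m, hm⟩ := ne_zero_iff.1 hb0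
  set r := (coeff m b)⁻¹ with hr
  have hr0 : r ≠ 0 := inv_ne_zero hm
  have hu : IsUnit (C r : Ternary (AlgebraicClosure k)) := (IsUnit.mk0 r hr0).map C
  set a' := C r * a with ha'
  set b' := C r * b with hb'
  have ha1 : a' ∈ forms (AlgebraicClosure k) n := IsHomogeneous.C_mul ha r
  have hb1 : b' ∈ forms (AlgebraicClosure k) n := IsHomogeneous.C_mul hb r
  have hb'0 : b' ≠ 0 := mul_ne_zero hu.ne_zero hb0
  have hab' : IsRelPrime a' b' := by
    rw [ha', hb', isRelPrime_mul_unit_left_left hu, isRelPrime_mul_unit_left_right hu]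
    exact hab
  have hq : quot a' b' = quot a b := quot_mul_cancel_left hu.ne_zero
  have hm1 : coeff m b' = 1 := by rw [hb', coeff_C_mul, hr, inv_mul_cancel₀ hm]
  have hinv (σ : Gal(AlgebraicClosure k/k)) :
      MvPolynomial.map (σ : AlgebraicClosure k →+* AlgebraicClosure k) b' = b' ∧
      MvPolynomial.map (σ : AlgebraicClosure k →+* AlgebraicClosure k) a' = a' := by
    have hinj : Function.Injective
        (MvPolynomial.map (σ := Fin 3) (σ : AlgebraicClosure k →+* AlgebraicClosure k)) :=
      MvPolynomial.map_injective _ σ.injective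
    have h1 : quot (MvPolynomial.map (σ : AlgebraicClosure k →+* AlgebraicClosure k) a')
        (MvPolynomial.map (σ : AlgebraicClosure k →+* AlgebraicClosure k) b') = quot a' b' := by
      rw [hq, ha', hb', map_mul, map_mul, quot_mul_cancel_left, hσ]
      rw [map_C, Ne, C_eq_zero]
      exact σ.map_ne_zero_iff.2 hr0
    have hσb0 := (map_ne_zero_iff _ hinj).2 hb'0
    rw [quot_eq_quot_iff hσb0 hb'0] at h1
    obtain ⟨e, he⟩ : b' ∣ MvPolynomial.map (σ : AlgebraicClosure k →+* AlgebraicClosure k) b' :=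
      hab'.symm.dvd_of_dvd_mul_left (Dvd.intro_left _ h1)
    have hmem : MvPolynomial.map (σ : AlgebraicClosure k →+* AlgebraicClosure k) b' ∈
      forms (AlgebraicClosure k) n := IsHomogeneous.map hb1 _
    obtain ⟨l, hl⟩ := mem_forms_of_mul_mem (mul_comm b' e ▸ he ▸ hmem)
      (mul_comm b' e ▸ he ▸ hσb0)
    have hl0 := forms_inj (forms_mul hb1 hl) (he ▸ hmem) (he ▸ hσb0)
    obtain rfl : l = 0 := by omega
    obtain ⟨t, rfl⟩ : ∃ t, e = C t := ⟨_, totalDegree_eq_zero_iff_eq_C.1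
      ((totalDegree_zero_iff_isHomogeneous _).2 hl)⟩
    have h2 := congr_arg (coeff m) he
    rw [coeff_map, mul_comm b', hm1, coeff_C_mul, hm1, mul_one] at h2
    rw [← h2, RingHom.coe_coe, map_one, C_1, mul_one] at he
    refine ⟨he, ?_⟩
    rw [he] at h1
    exact mul_right_cancel₀ hb'0 h1
  obtain ⟨p, hp⟩ := exists_extend_eq fun σ ↦ (hinv σ).2
  obtain ⟨q, hq'⟩ := exists_extend_eq fun σ ↦ (hinv σ).1
  refine ⟨p, extend_mem_iff.1 (hp ▸ ha1), q, extend_mem_iff.1 (hq' ▸ hb1), ?_, ?_, ?_⟩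
  · rintro rfl
    exact hb'0 (by rw [← hq', map_zero])
  · rwa [hp, hq']
  · rw [hp, hq', hq]

variable (k) in
/-- Extension of scalars of fractions to the algebraic closure. -/
def extendFrac : TernaryFrac k →+* TernaryFrac (AlgebraicClosure k) :=
  IsFractionRing.map (extend_injective (k := k))

lemma extendFrac_quot (p q : Ternary k) :
    extendFrac k (quot p q) = quot (extend k p) (extend k q) := by
  rw [quot, map_div₀, extendFrac, IsFractionRing.map, IsLocalization.map_eq,
    IsLocalization.map_eq, quot]

variable {S : Over (SpecOf k)} [IsIntegral S.left] [IsIntegral (geom S).left]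
  {c : PlaneCoords (geom S)}

namespace PlaneCoords.IsRational

lemma exists_pull [CharZero k] (hc : c.IsRational) {n : ℕ} {p q : Ternary k} (hp : p ∈ forms k n)
    (hq : q ∈ forms k n) (hq0 : q ≠ 0) :
    ∃ g, c.val (pull S g) = quot (extend k p) (extend k q) := by
  have h0 : extend k q ≠ 0 := (map_ne_zero_iff _ extend_injective).2 hq0
  obtain ⟨g, hg⟩ := exists_pull_eq (c.frac (extend_mem_iff.2 hp) (extend_mem_iff.2 hq) h0)
    (fun σ ↦ by
      apply c.val_injective
      rw [hc σ n _ (extend_mem_iff.2 hp) _ (extend_mem_iff.2 hq) h0 _ (c.val_frac _ _ _),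
        c.val_frac, extend, map_map, map_map]
      have : (σ : AlgebraicClosure k →+* AlgebraicClosure k).comp
          (algebraMap k (AlgebraicClosure k)) = algebraMap k (AlgebraicClosure k) :=
        RingHom.ext σ.commutes
      rw [this])
  exact ⟨g, by rw [hg, c.val_frac]⟩

lemma exists_eq_quot_extend [CharZero k] (hc : c.IsRational) (g : S.left.functionField) :
    ∃ n, ∃ p ∈ forms k n, ∃ q ∈ forms k n, q ≠ 0 ∧ IsRelPrime (extend k p) (extend k q) ∧
      c.val (pull S g) = quot (extend k p) (extend k q) := by
  obtain ⟨n, a, ha, b, hb, hb0, hab, h⟩ := c.exists_isRelPrime (pull S g)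
  obtain ⟨p, hp, q, hq, hq0, hpq, h'⟩ := exists_rational_fraction ha hb hb0 hab fun σ ↦ by
    rw [← h, ← hc σ n a ha b hb hb0 _ h, galAct_pull]
  exact ⟨n, p, hp, q, hq, hq0, hpq, h.trans h'⟩

/-- By flatness, regularity may be tested upstairs. The denominator of the coprime rational fraction
divides the denominator of any other, so it does not vanish where the function is regular. -/
lemma mem_stalkSubring_iff [CharZero k] (hc : c.IsRational) (x : (geom S).left)
    (g : S.left.functionField) : g ∈ stalkSubring (toBase S x) ↔
      ∃ n, ∃ p ∈ forms k n, ∃ q ∈ forms k n, extend k q ∉ (c.pt x).asHomogeneousIdeal ∧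
        c.val (pull S g) = quot (extend k p) (extend k q) := by
  rw [← functionFieldMap_mem_stalkSubring_iff, ← pull, c.mem_iff]
  constructor
  · rintro ⟨m, a, ha, b, hb, hbx, h⟩
    obtain ⟨n, p, hp, q, hq, hq0, hpq, h'⟩ := hc.exists_eq_quot_extend g
    refine ⟨n, p, hp, q, hq, fun hqx ↦ hbx ?_, h'⟩
    have h0 : extend k q ≠ 0 := (map_ne_zero_iff _ extend_injective).2 hq0
    rw [h', quot_eq_quot_iff h0 (ne_zero_of_notMem hbx)] at h
    obtain ⟨e, rfl⟩ : extend k q ∣ b := hpq.symm.dvd_of_dvd_mul_left (Dvd.intro_left _ h.symm)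
    exact Ideal.mul_mem_right _ _ hqx
  · rintro ⟨n, p, hp, q, hq, hqx, h⟩
    exact ⟨n, _, extend_mem_iff.2 hp, _, extend_mem_iff.2 hq, hqx, h⟩

end PlaneCoords.IsRational

variable (k) in
/-- Homogeneous coordinates on the projective plane. -/
def planeCoords : PlaneCoords (planeOver k) :=
  PlaneCoords.ofIso (planeOver k) (Iso.refl _) (Category.id_comp _)

/-- Contraction of points of the projective plane. -/
def contract (x : ProjectiveSpectrum (forms (AlgebraicClosure k))) :
    ProjectiveSpectrum (forms k) :=
  comapPt (extend k) (fun _ _ h ↦ extend_mem_iff.2 h)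
    (fun _ h i ↦ by have := h i; rwa [extend, map_X] at this) x

lemma mem_contract {x : ProjectiveSpectrum (forms (AlgebraicClosure k))} {p : Ternary k} :
    p ∈ (contract x).asHomogeneousIdeal ↔ extend k p ∈ x.asHomogeneousIdeal := Iff.rfl

-- Lying over for the integral extension of polynomial rings gives a prime `Q`; its homogeneous core
-- is still prime and, the given ideal being homogeneous, has the same contraction.
attribute [local instance] MvPolynomial.algebraMvPolynomial in
lemma contract_surjective : Function.Surjective (contract (k := k)) := by
  intro y
  have := y.isPrime
  obtain ⟨Q, hQ, hQy⟩ := Ideal.exists_ideal_over_prime_of_isIntegral_of_isDomain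
    (R := Ternary k) (S := Ternary (AlgebraicClosure k)) y.asHomogeneousIdeal.toIdeal (by
      intro p hp
      have h0 : extend k p = 0 := hp
      rw [(map_eq_zero_iff _ extend_injective).1 h0]
      exact zero_mem _)
  have hQy' (p : Ternary k) : extend k p ∈ Q ↔ p ∈ y.asHomogeneousIdeal := by
    change p ∈ Q.comap (algebraMap (Ternary k) (Ternary (AlgebraicClosure k))) ↔ _
    rw [hQy]
    rfl
  have hle := Ideal.toIdeal_homogeneousCore_le (forms (AlgebraicClosure k)) Q
  refine ⟨⟨Q.homogeneousCore (forms (AlgebraicClosure k)), hQ.homogeneousCore, fun h ↦ ?_⟩,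
    point_ext fun p ↦ ⟨fun h ↦ (hQy' p).1 (hle h), fun h ↦ ?_⟩⟩
  · obtain ⟨i, hi⟩ := exists_X_notMem y
    apply hi
    rw [← hQy', extend, map_X]
    exact hle (h (X_mem_irrelevant i))
  · let φ : forms k →+*ᵍ forms (AlgebraicClosure k) :=
      { extend k with map_mem := fun {n a} h ↦ extend_mem_iff.2 h }
    have h1 : HomogeneousIdeal.map φ y.asHomogeneousIdeal ≤
        Q.homogeneousCore (forms (AlgebraicClosure k)) := by
      refine (Ideal.homogeneousCore.gc _ _ _).1 (Ideal.map_le_iff_le_comap.2 fun p hp ↦ ?_)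
      exact (hQy' p).2 hp
    exact h1 (Ideal.mem_map_of_mem φ h)

lemma exists_ringHom_comp_eq {K L E : Type*} [Field K] [Field L] [Field E] (α : K →+* E)
    (β : L →+* E) (h : ∀ l, ∃ a, α a = β l) : ∃ θ : L →+* K, ∀ l, α (θ l) = β l := by
  let e : K ≃+* α.range := RingEquiv.ofBijective α.rangeRestrict
    ⟨fun _ _ h ↦ α.injective congr(($h : E)), α.rangeRestrict_surjective⟩
  refine ⟨e.symm.toRingHom.comp (β.codRestrict α.range h), fun l ↦ ?_⟩
  have := e.apply_symm_apply (β.codRestrict α.range h l)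
  exact congr(($this : E))

variable (k) in
lemma algebraMap_forms_zero_bijective : Function.Bijective (algebraMap k (forms k 0)) := by
  refine ⟨fun a b h ↦ C_injective (Fin 3) k congr(($h : Ternary k)), fun ⟨p, hp⟩ ↦ ?_⟩
  have h := totalDegree_eq_zero_iff_eq_C.1 ((totalDegree_zero_iff_isHomogeneous _).2 hp)
  exact ⟨coeff 0 p, Subtype.ext h.symm⟩

instance : IsIso (Spec.map (CommRingCat.ofHom (algebraMap k (forms k 0)))) := by
  have : IsIso (CommRingCat.ofHom (algebraMap k (forms k 0))) :=
    (ConcreteCategory.isIso_iff_bijective _).2 (algebraMap_forms_zero_bijective k)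
  infer_instance

instance : LocallyOfFiniteType (planeOver k).hom := by
  have : Algebra.FiniteType (forms k 0) (Ternary k) := by
    have : IsScalarTower k (forms k 0) (Ternary k) :=
      IsScalarTower.of_algebraMap_eq (R := k) (S := forms k 0) (A := Ternary k) fun _ ↦ rfl
    exact Algebra.FiniteType.of_restrictScalars_finiteType k _ _
  change LocallyOfFiniteType (Proj.toSpecZero (forms k) ≫ Spec.map _)
  infer_instance

instance : (planeOver k).left.IsSeparated := inferInstanceAs (Proj (forms k)).IsSeparated

/-- A form of the projective plane with rational homogeneous coordinates is trivial. -/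
theorem PlaneCoords.IsRational.isTrivial [CharZero k] (hc : c.IsRational)
    [LocallyOfFiniteType S.hom] [S.left.IsSeparated] : IsTrivial 2 S := by
  let P := planeOver k
  let α : S.left.functionField →+* TernaryFrac (AlgebraicClosure k) := c.val.comp (pull S)
  let β : P.left.functionField →+* TernaryFrac (AlgebraicClosure k) :=
    (extendFrac k).comp (planeCoords k).val
  have hβ (h : P.left.functionField) (p q : Ternary k) :
      (planeCoords k).val h = quot p q ↔ β h = quot (extend k p) (extend k q) := by
    rw [← extendFrac_quot]
    exact (extendFrac k).injective.eq_iff.symm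
  -- Inside the fraction field over `k̄`, the local rings of `S` and of the plane over `k` agree at
  -- corresponding points.
  have hαβ (g h) (hgh : α g = β h) (x : (geom S).left) : g ∈ stalkSubring (toBase S x) ↔
      h ∈ stalkSubring ((planeCoords k).pt.symm (contract (c.pt x))) := by
    rw [hc.mem_stalkSubring_iff, (planeCoords k).mem_iff, Equiv.apply_symm_apply]
    simp only [hβ, ← hgh, mem_contract]
    rfl
  have hconst (r : k) : α (constMap r) = β (constMap r) := by
    refine Eq.trans ?_ ((hβ _ _ 1).1 ((planeCoords k).val_const r)).symm
    change c.val (pull S (constMap r)) = _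
    rw [pull_constMap, c.val_const, extend, map_C, map_one]
  -- The two function fields have the same image, the quotients of forms over `k`; this gives
  -- inverse isomorphisms, which extend to morphisms of schemes by the comparison of local rings.
  obtain ⟨θ, hθ⟩ := exists_ringHom_comp_eq α β fun h ↦ by
    obtain ⟨n, p, hp, q, hq, hq0, -, h'⟩ := (planeCoords k).exists_isRelPrime h
    obtain ⟨g, hg⟩ := hc.exists_pull hp hq hq0
    exact ⟨g, hg.trans ((hβ _ _ _).1 h').symm⟩
  obtain ⟨θ', hθ'⟩ := exists_ringHom_comp_eq β α fun g ↦ by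
    obtain ⟨n, p, hp, q, hq, hq0, -, h⟩ := hc.exists_eq_quot_extend g
    obtain ⟨h', hh⟩ := (planeCoords k).exists_eq_quot hp hq hq0
    exact ⟨h', ((hβ _ _ _).1 hh).trans h.symm⟩
  have h1 (l) : θ' (θ l) = l := β.injective (by rw [hθ', hθ])
  have h2 (l) : θ (θ' l) = l := α.injective (by rw [hθ, hθ'])
  let Θ : P.left.functionField ⟶ S.left.functionField := CommRingCat.ofHom θ
  let Θ' : S.left.functionField ⟶ P.left.functionField := CommRingCat.ofHom θ'
  have hΘΘ' : Θ ≫ Θ' = 𝟙 _ := by ext l; exact h1 l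
  have hΘ'Θ : Θ' ≫ Θ = 𝟙 _ := by ext l; exact h2 l
  have hΘ : Spec.map Θ ≫ fromSpecFunctionField P.left ≫ P.hom =
      fromSpecFunctionField S.left ≫ S.hom := by
    rw [← SpecMap_constMap, ← SpecMap_constMap]
    refine (Spec.map_comp _ _).symm.trans (congr_arg Spec.map ?_)
    ext r
    exact α.injective ((hθ _).trans (hconst r).symm)
  have hΘ' : Spec.map Θ' ≫ fromSpecFunctionField S.left ≫ S.hom =
      fromSpecFunctionField P.left ≫ P.hom := by
    rw [← SpecMap_constMap, ← SpecMap_constMap]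
    refine (Spec.map_comp _ _).symm.trans (congr_arg Spec.map ?_)
    ext r
    exact β.injective ((hθ' _).trans (hconst r))
  obtain ⟨f, hf, hf'⟩ := exists_hom_of_functionField S.hom P.hom Θ hΘ fun s ↦ by
    obtain ⟨x, rfl⟩ := (toBase S).surjective s
    exact ⟨_, fun h hh ↦ (hαβ (θ h) h (hθ h) x).2 hh⟩
  obtain ⟨g, hg, hg'⟩ := exists_hom_of_functionField P.hom S.hom Θ' hΘ' fun y ↦ by
    obtain ⟨z, hz⟩ := contract_surjective ((planeCoords k).pt y)
    obtain ⟨x, rfl⟩ := c.pt.surjective z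
    refine ⟨toBase S x, fun h hh ↦ ?_⟩
    have := (hαβ h (θ' h) (hθ' h).symm x).1 hh
    rwa [hz, Equiv.symm_apply_apply] at this
  have : IsSeparated S.hom := .of_comp S.hom (terminal.from _)
  have : IsSeparated P.hom := .of_comp P.hom (terminal.from _)
  have hfg : f ≫ g = 𝟙 _ := by
    refine eq_of_fromSpecFunctionField_comp_eq S.hom
      (by rw [Category.assoc, hg, hf, Category.id_comp]) ?_
    rw [reassoc_of% hf', hg', ← Category.assoc, ← Spec.map_comp, hΘ'Θ, Spec.map_id,
      Category.id_comp, Category.comp_id]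
  have hgf : g ≫ f = 𝟙 _ := by
    refine eq_of_fromSpecFunctionField_comp_eq P.hom
      (by rw [Category.assoc, hf, hg, Category.id_comp]) ?_
    rw [reassoc_of% hg', hf', ← Category.assoc, ← Spec.map_comp, hΘΘ', Spec.map_id,
      Category.id_comp, Category.comp_id]
  exact ⟨Over.isoMk ⟨f, g, hfg, hgf⟩ hf⟩

end Trivial

/-! ### Uniqueness of lifts and vertices of the coordinate triangle -/

section Vertices

open MvPolynomial

variable {F : Type u} [Field F]

lemma exists_eq_C_mul_of_dvd {a b : Ternary F} {n : ℕ} (ha : a ∈ forms F n) (hb : b ∈ forms F n)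
    (hb0 : b ≠ 0) (hab : a ∣ b) : ∃ r, b = C r * a := by
  obtain ⟨e, rfl⟩ := hab
  obtain ⟨l, hl⟩ := mem_forms_of_mul_mem (mul_comm a e ▸ hb) (mul_comm a e ▸ hb0)
  have hl0 := forms_inj (forms_mul ha hl) hb hb0
  obtain rfl : l = 0 := by omega
  refine ⟨coeff 0 e, ?_⟩
  rw [mul_comm]
  congr 1
  exact totalDegree_eq_zero_iff_eq_C.1 ((totalDegree_zero_iff_isHomogeneous _).2 hl)

variable {X : Over (SpecOf F)} [IsIntegral X.left] {c : PlaneCoords X}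
  {θ θ' : X.left.functionField →+* X.left.functionField} {σ σ' : F →+* F}
  {T T' : forms F 1 ≃+ forms F 1}

/-- With `T a₀ = X 0`, equality of quotients gives `T a * T' a₀ = T' a * X 0`. Taking `T a₁ = X 1`
shows that `X 0` divides `T' a₀`, so `T' a₀` is a constant multiple of `X 0`. -/
lemma IsLift.exists_eq_smul (h : IsLift c θ σ T) (h' : IsLift c θ σ' T') :
    ∃ r : F, r ≠ 0 ∧ ∀ a, T' a = r • T a := by
  let l := formsBasis F
  obtain ⟨a₀, ha₀⟩ := T.surjective (l 0)
  obtain ⟨a₁, ha₁⟩ := T.surjective (l 1)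
  have h0 : a₀ ≠ 0 := fun h ↦ l.ne_zero 0 (by rw [← ha₀, h, map_zero])
  have h0' : (a₀ : Ternary F) ≠ 0 := fun h ↦ h0 (Subtype.ext h)
  have hT0 : (T' a₀ : Ternary F) ≠ 0 := fun h ↦ h0 (T'.map_eq_zero_iff.1 (Subtype.ext h))
  have key (a) : (T a : Ternary F) * (T' a₀ : Ternary F) = (T' a : Ternary F) * MvPolynomial.X 0 := by
    have h1 := (h.map_quot _ a a₀ h0 (c.val_frac a.2 a₀.2 h0')).symm.trans
      (h'.map_quot _ a a₀ h0 (c.val_frac a.2 a₀.2 h0'))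
    rw [ha₀, coe_formsBasis, quot_eq_quot_iff (X_ne_zero _) hT0] at h1
    exact h1
  have hdvd : (MvPolynomial.X 0 : Ternary F) ∣ T' a₀ := by
    have h1 := key a₁
    rw [ha₁, coe_formsBasis] at h1
    refine ((X_prime (R := F) (i := (0 : Fin 3))).dvd_or_dvd
      (Dvd.intro_left _ h1.symm)).resolve_left fun h ↦ ?_
    exact absurd (X_dvd_X.1 h) (by decide)
  obtain ⟨r, hr⟩ := exists_eq_C_mul_of_dvd (X_mem_forms 0) (T' a₀).2 hT0 hdvd
  refine ⟨r, ?_, fun a ↦ Subtype.ext ?_⟩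
  · rintro rfl
    rw [map_zero, zero_mul] at hr
    exact hT0 hr
  · apply mul_right_cancel₀ (X_ne_zero (R := F) (0 : Fin 3))
    rw [← key, hr, Submodule.coe_smul, smul_eq_C_mul]
    ring

lemma IsLift.comp (h : IsLift c θ σ T) (h' : IsLift c θ' σ' T') :
    IsLift c (θ.comp θ') (σ.comp σ') (T'.trans T) where
  map_smul r a := by simp [h.map_smul, h'.map_smul]
  map_quot f a b hb hf :=
    h.map_quot _ _ _ (T'.map_ne_zero_iff.2 hb) (h'.map_quot f a b hb hf)

lemma IsLift.id : IsLift c (RingHom.id _) (RingHom.id F) (AddEquiv.refl _) where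
  map_smul _ _ := rfl
  map_quot _ _ _ _ hf := hf

/-- A point of the scheme is the `j`-th vertex of the coordinate triangle if all coordinates except
the `j`-th one vanish there. -/
def PlaneCoords.IsVertex (c : PlaneCoords X) (j : Fin 3) (x : X.left) : Prop :=
  ∀ i, i ≠ j → (MvPolynomial.X i : Ternary F) ∈ (c.pt x).asHomogeneousIdeal

variable (F) in
/-- Substitution of zero for all variables but the `j`-th one. -/
def keepVar (j : Fin 3) : Ternary F →+* Ternary F :=
  eval₂Hom C fun i ↦ MvPolynomial.X j * if i = j then 1 else 0

lemma keepVar_X_of_ne {i j : Fin 3} (h : i ≠ j) : keepVar F j (MvPolynomial.X i) = 0 := by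
  simp [keepVar, h]

lemma keepVar_X_self (j : Fin 3) : keepVar F j (MvPolynomial.X j) = MvPolynomial.X j := by
  simp [keepVar]

lemma keepVar_of_mem (j : Fin 3) {n : ℕ} {a : Ternary F} (ha : a ∈ forms F n) :
    ∃ r, keepVar F j a = C r * MvPolynomial.X j ^ n := by
  refine ⟨eval₂ (RingHom.id F) (fun i ↦ if i = j then 1 else 0) a, ?_⟩
  rw [keepVar, coe_eval₂Hom, eval₂_mul_of_mem _ _ _ ha, mul_comm, hom_eval₂]
  congr 2
  ext1 i
  change _ = C (if i = j then 1 else 0)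
  split_ifs <;> simp

lemma keepVar_mem (j : Fin 3) {n : ℕ} {a : Ternary F} (ha : a ∈ forms F n) :
    keepVar F j a ∈ forms F n := by
  obtain ⟨r, hr⟩ := keepVar_of_mem j ha
  rw [hr]
  exact IsHomogeneous.C_mul (isHomogeneous_X_pow _ _) _

lemma keepVar_sub_mem (j : Fin 3) (I : Ideal (Ternary F))
    (hI : ∀ i, i ≠ j → MvPolynomial.X i ∈ I) (a : Ternary F) : a - keepVar F j a ∈ I := by
  rw [← Ideal.Quotient.eq]
  suffices (Ideal.Quotient.mk I) = (Ideal.Quotient.mk I).comp (keepVar F j) from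
    RingHom.congr_fun this a
  refine MvPolynomial.ringHom_ext (fun r ↦ ?_) fun i ↦ ?_
  · simp [keepVar]
  · rw [RingHom.comp_apply]
    by_cases h : i = j
    · rw [h, keepVar_X_self]
    · rw [keepVar_X_of_ne h, map_zero]
      exact Ideal.Quotient.eq_zero_iff_mem.2 (hI i h)

variable (F) in
/-- The `j`-th vertex of the coordinate triangle. -/
def vertex (j : Fin 3) : ProjectiveSpectrum (forms F) where
  asHomogeneousIdeal := (⊥ : HomogeneousIdeal (forms F)).comap
    (𝒜 := forms F) { keepVar F j with map_mem := fun {n a} ha ↦ keepVar_mem j ha }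
  isPrime := Ideal.isPrime_bot.comap (keepVar F j)
  not_irrelevant_le h := by
    have h1 : keepVar F j (MvPolynomial.X j) = 0 := h (X_mem_irrelevant j)
    rw [keepVar_X_self] at h1
    exact X_ne_zero _ h1

lemma mem_vertex {j : Fin 3} {a : Ternary F} :
    a ∈ (vertex F j).asHomogeneousIdeal ↔ keepVar F j a = 0 := Iff.rfl

/-- Modulo the other variables a form of degree `n` is `r * X j ^ n`, which lies in the ideal only
if `r = 0`. -/
lemma eq_vertex {j : Fin 3} {x : ProjectiveSpectrum (forms F)}
    (hx : ∀ i, i ≠ j → (MvPolynomial.X i : Ternary F) ∈ x.asHomogeneousIdeal) :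
    x = vertex F j := by
  have hj : (MvPolynomial.X j : Ternary F) ∉ x.asHomogeneousIdeal := by
    obtain ⟨i, hi⟩ := exists_X_notMem x
    by_cases h : i = j
    · exact h ▸ hi
    · exact absurd (hx i h) hi
  have hsub (a) := keepVar_sub_mem j x.asHomogeneousIdeal.toIdeal hx a
  refine point_ext fun a ↦ ⟨fun ha ↦ ?_, fun ha ↦ ?_⟩
  · rw [← sum_homogeneousComponent a]
    refine sum_mem fun n _ ↦ ?_
    have hn : homogeneousComponent n a ∈ x.asHomogeneousIdeal := by
      have := x.asHomogeneousIdeal.is_homogeneous' n ha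
      have h2 : (DirectSum.decompose (forms F) a n : Ternary F) = homogeneousComponent n a :=
        decomposition.decompose'_apply a n
      rw [← h2]
      exact this
    rw [mem_vertex]
    obtain ⟨r, hr⟩ := keepVar_of_mem j (homogeneousComponent_mem n a)
    have h1 : keepVar F j (homogeneousComponent n a) ∈ x.asHomogeneousIdeal.toIdeal :=
      (Submodule.sub_mem_iff_right _ hn).1 (hsub _)
    rw [hr] at h1 ⊢
    by_cases hr0 : r = 0
    · rw [hr0, map_zero, zero_mul]
    · have := x.isPrime
      rw [Ideal.unit_mul_mem_iff_mem _ ((IsUnit.mk0 r hr0).map C)] at h1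
      exact absurd (this.mem_of_pow_mem _ h1) hj
  · have := hsub a
    rwa [mem_vertex.1 ha, sub_zero] at this

namespace PlaneCoords

lemma isVertex_iff {j : Fin 3} {x : X.left} : c.IsVertex j x ↔ x = c.pt.symm (vertex F j) := by
  rw [Equiv.eq_symm_apply]
  refine ⟨eq_vertex, fun h i hi ↦ ?_⟩
  rw [h, mem_vertex, keepVar_X_of_ne hi]

lemma IsVertex.inj {i j : Fin 3} {x : X.left} (hi : c.IsVertex i x) (hj : c.IsVertex j x) :
    i = j := by
  by_contra h
  obtain ⟨l, hl⟩ := exists_X_notMem (c.pt x)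
  by_cases hli : l = i
  · exact hl (hj l (hli ▸ h))
  · exact hl (hi l hli)

lemma IsVertex.isClosed {j : Fin 3} {x : X.left} (hx : c.IsVertex j x) : IsClosed {x} := by
  rw [← closure_subset_iff_isClosed]
  intro y hy
  rw [← specializes_iff_mem_closure, c.specializes_iff] at hy
  have hy' : c.IsVertex j y := fun i hi ↦ hy (hx i hi)
  rw [isVertex_iff] at hx hy'
  exact hy'.trans hx.symm

variable (c) in
/-- The quotient of two coordinates as a rational function. -/
def coordFrac (i l : Fin 3) : X.left.functionField :=
  c.frac (X_mem_forms i) (X_mem_forms l) (X_ne_zero l)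

lemma val_coordFrac (i l : Fin 3) :
    c.val (c.coordFrac i l) = quot (MvPolynomial.X i) (MvPolynomial.X l) := c.val_frac _ _ _

/-- Vanishing of a coordinate is thus expressed by local rings, and so can be transported along
automorphisms. -/
lemma X_notMem_iff {x : X.left} {l : Fin 3} :
    (MvPolynomial.X l : Ternary F) ∉ (c.pt x).asHomogeneousIdeal ↔
      ∀ i, c.coordFrac i l ∈ stalkSubring x := by
  refine ⟨fun h i ↦ c.mem_iff.2 ⟨1, _, X_mem_forms i, _, X_mem_forms l, h, c.val_frac _ _ _⟩,
    fun h hl ↦ ?_⟩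
  obtain ⟨i, hi⟩ := exists_X_notMem (c.pt x)
  obtain ⟨n, a, -, b, -, hb, hab⟩ := c.mem_iff.1 (h i)
  rw [val_coordFrac, quot_eq_quot_iff (X_ne_zero _) (ne_zero_of_notMem hb)] at hab
  have hp := (c.pt x).isPrime
  have : MvPolynomial.X i * b ∈ (c.pt x).asHomogeneousIdeal.toIdeal :=
    hab ▸ Ideal.mul_mem_left _ _ hl
  exact (hp.mem_or_mem this).elim hi hb

end PlaneCoords

lemma PlaneCoords.constMap_mem (c : PlaneCoords X) (r : F) (x : X.left) :
    constMap r ∈ stalkSubring x :=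
  c.mem_iff.2 ⟨0, C r, isHomogeneous_C _ _, 1, isHomogeneous_one _ _,
    fun h ↦ (c.pt x).isPrime.ne_top ((Ideal.eq_top_iff_one _).2 h), c.val_const r⟩

lemma PlaneCoords.constMap_mul_mem_iff (c : PlaneCoords X) {x : X.left} {r : F} (hr : r ≠ 0)
    {f : X.left.functionField} : constMap r * f ∈ stalkSubring x ↔ f ∈ stalkSubring x := by
  refine ⟨fun h ↦ ?_, mul_mem (c.constMap_mem r x)⟩
  have := mul_mem (c.constMap_mem r⁻¹ x) h
  rwa [← mul_assoc, ← map_mul, inv_mul_cancel₀ hr, map_one, one_mul] at this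

lemma IsLift.map_coordFrac (h : IsLift c θ σ T) {π : Equiv.Perm (Fin 3)} {r : Fin 3 → F}
    (hT : ∀ i, T (formsBasis F i) = r i • formsBasis F (π i)) (i l : Fin 3) :
    r i ≠ 0 ∧ θ (c.coordFrac i l) = constMap (r i / r l) * c.coordFrac (π i) (π l) := by
  have hr (i) : r i ≠ 0 := by
    intro h0
    have := hT i
    rw [h0, zero_smul] at this
    exact (formsBasis F).ne_zero i (T.map_eq_zero_iff.1 this)
  refine ⟨hr i, ?_⟩
  apply c.val_injective
  rw [h.map_quot _ (formsBasis F i) (formsBasis F l) ((formsBasis F).ne_zero l) (by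
    rw [c.val_coordFrac, coe_formsBasis, coe_formsBasis]), map_mul, c.val_coordFrac, c.val_const,
    quot_mul_quot, hT, hT, Submodule.coe_smul, Submodule.coe_smul, coe_formsBasis,
    coe_formsBasis, smul_eq_C_mul, smul_eq_C_mul, quot_eq_quot_iff, one_mul, div_eq_mul_inv,
    map_mul]
  · have : (C (r l) : Ternary F) * C (r l)⁻¹ = 1 := by
      rw [← map_mul, mul_inv_cancel₀ (hr l), map_one]
    linear_combination - C (r i) * MvPolynomial.X (π i) * MvPolynomial.X (π l) * this
  · exact mul_ne_zero (by rw [Ne, C_eq_zero]; exact hr l) (X_ne_zero _)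
  · exact mul_ne_zero one_ne_zero (X_ne_zero _)

/-- An automorphism that permutes the coordinates up to scalars permutes the vertices. -/
lemma IsLift.X_notMem_iff {φ : X.left ⟶ X.left} [IsIso φ]
    (h : IsLift c (functionFieldMap φ) σ T) {π : Equiv.Perm (Fin 3)} {r : Fin 3 → F}
    (hT : ∀ i, T (formsBasis F i) = r i • formsBasis F (π i)) {x : X.left} {l : Fin 3} :
    (MvPolynomial.X l : Ternary F) ∉ (c.pt (φ x)).asHomogeneousIdeal ↔
      (MvPolynomial.X (π l) : Ternary F) ∉ (c.pt x).asHomogeneousIdeal := by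
  rw [c.X_notMem_iff, c.X_notMem_iff]
  have hr (i) := (h.map_coordFrac hT i l).1
  simp only [← functionFieldMap_mem_stalkSubring_iff, (h.map_coordFrac hT _ l).2,
    c.constMap_mul_mem_iff (div_ne_zero (hr _) (hr _))]
  exact π.forall_congr_right (q := fun i ↦ c.coordFrac i (π l) ∈ stalkSubring x)

lemma IsLift.isVertex {φ : X.left ⟶ X.left} [IsIso φ]
    (h : IsLift c (functionFieldMap φ) σ T) {π : Equiv.Perm (Fin 3)} {r : Fin 3 → F}
    (hT : ∀ i, T (formsBasis F i) = r i • formsBasis F (π i)) {x : X.left} {j : Fin 3}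
    (hx : c.IsVertex (π j) x) : c.IsVertex j (φ x) := by
  intro i hi
  by_contra hcon
  exact (h.X_notMem_iff hT).1 hcon (hx (π i) (π.injective.ne hi))

end Vertices

/-! ### Fixed points and residue fields -/

section FixedPoints

variable {F : Type u} [Field F]

/-- If `x` is fixed by `φ` with trivial action on the residue field, then `φ` moves regular
functions at `x` by functions vanishing at `x`. -/
lemma sub_eq_zero_of_fixed {X : Scheme.{u}} [IsIntegral X] {φ : X ⟶ X} [IsIso φ] {x : X}
    (h : X.fromSpecResidueField x ≫ φ = X.fromSpecResidueField x) {f : X.functionField}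
    (hf : f ∈ stalkSubring x) :
    (functionFieldMap φ f - f)⁻¹ ∈ stalkSubring x → functionFieldMap φ f - f = 0 := by
  have hx : φ x = x := by
    let s : Spec (X.residueField x) := IsLocalRing.closedPoint (X.residueField x)
    have : φ (X.fromSpecResidueField x s) = X.fromSpecResidueField x s := by
      rw [← Scheme.Hom.comp_apply, h]
    rwa [Scheme.fromSpecResidueField_apply] at this
  obtain ⟨r, hr⟩ := exists_SpecMap_fromSpecStalk (X.fromSpecStalk x ≫ φ) (y := x)
    ((Scheme.Hom.comp_apply _ _ _).trans (by rw [Scheme.fromSpecStalk_closedPoint, hx]))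
  -- The endomorphism `r` of the local ring induced by `φ` is the identity modulo the maximal ideal.
  have hres : r ≫ X.residue x = X.residue x := by
    apply Spec.map_injective
    rw [← cancel_mono (X.fromSpecStalk x), Spec.map_comp, Category.assoc, hr]
    exact h
  let γ : X.presheaf.stalk x ⟶ X.functionField :=
    X.presheaf.stalkSpecializes ((genericPoint_spec X).specializes trivial)
  have hγ : Spec.map γ ≫ X.fromSpecStalk x = fromSpecFunctionField X :=
    Scheme.SpecMap_stalkSpecializes_fromSpecStalk _
  let Θ : X.functionField ⟶ X.functionField := CommRingCat.ofHom (functionFieldMap φ)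
  have hΘ : Spec.map Θ ≫ fromSpecFunctionField X = fromSpecFunctionField X ≫ φ :=
    SpecMap_functionFieldMap φ
  have hrγ : γ ≫ Θ = r ≫ γ := by
    apply Spec.map_injective
    rw [← cancel_mono (X.fromSpecStalk x), Spec.map_comp, Spec.map_comp, Category.assoc,
      Category.assoc, hr, hγ, hΘ, ← hγ, Category.assoc]
  obtain ⟨s, rfl⟩ := mem_stalkSubring_iff.1 hf
  have h1 : functionFieldMap φ (γ s) = γ (r s) := congr($(hrγ).hom s)
  have h2 : r s - s ∈ IsLocalRing.maximalIdeal (X.presheaf.stalk x) := by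
    rw [← IsLocalRing.residue_eq_zero_iff, map_sub, sub_eq_zero]
    exact congr($(hres).hom s)
  change (functionFieldMap φ (γ s) - γ s)⁻¹ ∈ _ → functionFieldMap φ (γ s) - γ s = 0
  rw [h1, ← map_sub]
  intro hinv
  obtain ⟨t, ht⟩ := mem_stalkSubring_iff.1 hinv
  by_contra hne
  apply (IsLocalRing.mem_maximalIdeal _).1 h2
  refine IsUnit.of_mul_eq_one t ?_
  have hinj : Function.Injective γ := IsFractionRing.injective (X.presheaf.stalk x) X.functionField
  apply hinj
  rw [map_mul, map_one]
  refine Eq.trans ?_ (mul_inv_cancel₀ hne)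
  exact congr_arg _ ht

end FixedPoints

/-! ### Geometric points, closed points and fields of definition -/

section Points

lemma exists_SpecMap_fromSpecResidueField {K : Type u} [Field K] {X : Scheme.{u}}
    (h : SpecOf K ⟶ X) {y : X} (hy : h (⊥ : PrimeSpectrum K) = y) :
    ∃ r : X.residueField y ⟶ CommRingCat.of K, Spec.map r ≫ X.fromSpecResidueField y = h := by
  have hbot : h (IsLocalRing.closedPoint K) = y :=
    (congr_arg h (Subsingleton.elim (α := PrimeSpectrum K) _ _)).trans hy
  subst hbot
  exact ⟨_, Scheme.descResidueField_stalkClosedPointTo_fromSpecResidueField K X h⟩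

lemma epi_SpecMap_of_field {K : Type u} [Field K] {R : CommRingCat.{u}} (hR : IsField R)
    (r : R ⟶ CommRingCat.of K) : Epi (Spec.map r) := by
  let := hR.toField
  algebraize [r.hom]
  have : Flat (Spec.map r) := by
    rw [Flat.SpecMap_iff]
    exact (inferInstance : Module.Flat R K)
  have : Surjective (Spec.map r) :=
    ⟨fun _ ↦ ⟨(⊥ : PrimeSpectrum K), Subsingleton.elim (α := PrimeSpectrum R) _ _⟩⟩
  exact Flat.epi_of_flat_of_surjective _

/-- The point `q` factors through the residue field at `x`, and a map of spectra of fields is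
faithfully flat, hence an epimorphism. -/
lemma comp_eq_iff_fromSpecResidueField {K : Type u} [Field K] {X : Scheme.{u}}
    {q : SpecOf K ⟶ X} {x : X} (hx : q (⊥ : PrimeSpectrum K) = x) (φ : X ⟶ X) :
    q ≫ φ = q ↔ X.fromSpecResidueField x ≫ φ = X.fromSpecResidueField x := by
  obtain ⟨r, rfl⟩ := exists_SpecMap_fromSpecResidueField q hx
  have := epi_SpecMap_of_field (Field.toIsField _) r
  rw [Category.assoc, cancel_epi]

variable {F : Type u} [Field F] {X : Over (SpecOf F)} [IsIntegral X.left] {c : PlaneCoords X}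
  {T : forms F 1 ≃+ forms F 1}

/-- The points fixed by an automorphism with three distinct eigenvalues are the vertices of the
coordinate triangle. -/
lemma IsLift.fixed_iff_isVertex [IsAlgClosed F] [LocallyOfFiniteType X.hom]
    {φ : X.left ⟶ X.left} [IsIso φ] (hφ : φ ≫ X.hom = X.hom) {σ : F →+* F}
    (h : IsLift c (functionFieldMap φ) σ T) {r : Fin 3 → F}
    (hT : ∀ i, T (formsBasis F i) = r i • formsBasis F i) (hr : Function.Injective r)
    (x : X.left) : X.left.fromSpecResidueField x ≫ φ = X.left.fromSpecResidueField x ↔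
      ∃ j, c.IsVertex j x := by
  have hT' : ∀ i, T (formsBasis F i) = r i • formsBasis F ((1 : Equiv.Perm (Fin 3)) i) := hT
  constructor
  · intro hx
    obtain ⟨l, hl⟩ := exists_X_notMem (c.pt x)
    refine ⟨l, fun i hi ↦ ?_⟩
    -- Otherwise `X i / X l` is a unit at `x` multiplied by `r i / r l ≠ 1`. Its difference from its
    -- image is again a unit, although it should vanish at `x`.
    by_contra hxi
    obtain ⟨-, h1⟩ := h.map_coordFrac hT' i l
    have hl0 := (h.map_coordFrac hT' l l).1
    have h2 : functionFieldMap φ (c.coordFrac i l) - c.coordFrac i l =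
        constMap (r i / r l - 1) * c.coordFrac i l := by
      rw [h1, map_sub, map_one, sub_mul, one_mul]
      rfl
    have h3 : r i / r l - 1 ≠ 0 := by
      rw [sub_ne_zero, Ne, div_eq_one_iff_eq hl0]
      exact fun h ↦ hi (hr h)
    have h4 : (c.coordFrac i l)⁻¹ = c.coordFrac l i := by
      apply c.val_injective
      rw [map_inv₀, c.val_coordFrac, c.val_coordFrac, quot, quot, inv_div]
    have h5 := sub_eq_zero_of_fixed hx (c.X_notMem_iff.1 hl i) (by
      rw [h2, mul_inv, h4, ← map_inv₀]
      exact mul_mem (c.constMap_mem _ x) (c.X_notMem_iff.1 hxi l))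
    rw [h2, mul_eq_zero, map_eq_zero, or_iff_right h3] at h5
    have h6 := c.val_coordFrac i l
    rw [h5, map_zero, quot, eq_comm, div_eq_zero_iff] at h6
    exact h6.elim (algebraMap_ternary_ne_zero (MvPolynomial.X_ne_zero i))
      (algebraMap_ternary_ne_zero (MvPolynomial.X_ne_zero l))
  · rintro ⟨j, hj⟩
    have hj' : c.IsVertex j (φ x) := h.isVertex hT' hj
    have hφx : φ x = x := (c.isVertex_iff.1 hj').trans (c.isVertex_iff.1 hj).symm
    -- A closed point carries exactly one `F`-point, as `F` is algebraically closed. So fixing `x`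
    -- topologically suffices.
    let q := pointOfClosedPoint X.hom x hj.isClosed
    have hq : q ≫ X.hom = 𝟙 _ := pointOfClosedPoint_comp _ _ _
    have hqx (a) : q a = x := pointOfClosedPoint_apply _ _ _ a
    have hqφ : q ≫ φ = q := by
      refine ext_of_apply_closedPoint_eq X.hom (by rw [Category.assoc, hφ, hq]) hq ?_
      exact (Scheme.Hom.comp_apply _ _ _).trans
        ((congr_arg φ (hqx _)).trans (hφx.trans (hqx _).symm))
    exact (comp_eq_iff_fromSpecResidueField (hqx _) φ).1 hqφ

variable {k : Type u} [Field k] (S : Over (SpecOf k))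

section

variable {S}

/-- The automorphism of the base change induced by an automorphism of `S`. -/
def autMap (g : Aut S) : (geom S).left ⟶ (geom S).left := ((geomBaseChange k).map g.hom).left

lemma autMap_toBase (g : Aut S) : autMap g ≫ toBase S = toBase S ≫ g.hom.left :=
  pullback.lift_fst _ _ _

lemma autMap_hom (g : Aut S) : autMap g ≫ (geom S).hom = (geom S).hom :=
  pullback.lift_snd _ _ _

lemma autMap_mul (g h : Aut S) : autMap (g * h) = autMap h ≫ autMap g := by
  simp only [autMap, ← Over.comp_left, ← Functor.map_comp]
  rfl

lemma autMap_one : autMap (1 : Aut S) = 𝟙 _ := by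
  apply geom_hom_ext
  · rw [autMap_toBase, Category.id_comp]
    exact Category.comp_id _
  · rw [autMap_hom, Category.id_comp]

instance (g : Aut S) : IsIso (autMap g) :=
  ⟨autMap g⁻¹, by rw [← autMap_mul, inv_mul_cancel, autMap_one],
    by rw [← autMap_mul, mul_inv_cancel, autMap_one]⟩

lemma galMap_autMap (σ : Gal(AlgebraicClosure k/k)) (g : Aut S) :
    galMap S σ ≫ autMap g = autMap g ≫ galMap S σ := by
  apply geom_hom_ext
  · rw [Category.assoc, Category.assoc, autMap_toBase, galMap_toBase, reassoc_of% galMap_toBase,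
      autMap_toBase]
  · rw [Category.assoc, Category.assoc, autMap_hom, galMap_hom, reassoc_of% autMap_hom]

lemma eq_one_of_autMap_eq (g : Aut S) (h : autMap g = 𝟙 _) : g = 1 := by
  have h1 := autMap_toBase g
  rw [h, Category.id_comp] at h1
  have h2 := (cancel_epi (toBase S)).1 ((Category.comp_id _).trans h1)
  exact Iso.ext (Over.OverMorphism.ext h2.symm)

/-- The section of the base change given by a geometric point. -/
def geomSection (p : GeomPoint S) : SpecOf (AlgebraicClosure k) ⟶ (geom S).left :=
  geomLift S p.left (𝟙 _) (by simp)

lemma geomSection_toBase (p : GeomPoint S) : geomSection p ≫ toBase S = p.left :=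
  geomLift_toBase _ _ _ _

lemma geomSection_hom (p : GeomPoint S) : geomSection p ≫ (geom S).hom = 𝟙 _ :=
  geomLift_hom _ _ _ _

lemma toBaseChange_eq (p : GeomPoint S) :
    p.toBaseChange = geomSection p (⊥ : PrimeSpectrum (AlgebraicClosure k)) := rfl

lemma comp_hom_eq_iff (p : GeomPoint S) (g : Aut S) :
    p ≫ g.hom = p ↔ geomSection p ≫ autMap g = geomSection p := by
  constructor
  · intro h
    apply geom_hom_ext
    · rw [Category.assoc, autMap_toBase, reassoc_of% geomSection_toBase, geomSection_toBase,
        ← Over.comp_left, h]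
    · rw [Category.assoc, autMap_hom]
  · intro h
    ext1
    rw [Over.comp_left, ← geomSection_toBase, Category.assoc, ← autMap_toBase, reassoc_of% h]

lemma mem_fixedGeomPoints_iff (G : Subgroup (Aut S)) (p : GeomPoint S) :
    p ∈ fixedGeomPoints G ↔ p.toBaseChange ∈ fixedLocus G := by
  refine forall₂_congr fun g hg ↦ ?_
  rw [comp_hom_eq_iff]
  exact comp_eq_iff_fromSpecResidueField rfl _

instance [LocallyOfFiniteType S.hom] : LocallyOfFiniteType (geom S).hom :=
  inferInstanceAs (LocallyOfFiniteType (pullback.snd _ _))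

lemma geomSection_injective : Function.Injective (geomSection (S := S)) := by
  intro p q h
  ext1
  rw [← geomSection_toBase, h, geomSection_toBase]

lemma toBaseChange_injective [LocallyOfFiniteType S.hom] :
    Function.Injective (GeomPoint.toBaseChange (X := S)) := fun p q h ↦
  geomSection_injective (ext_of_apply_closedPoint_eq (geom S).hom (geomSection_hom p)
    (geomSection_hom q) (by
      rw [Subsingleton.elim (α := PrimeSpectrum (AlgebraicClosure k)) (IsLocalRing.closedPoint _) ⊥]
      exact h))

lemma exists_toBaseChange_eq [LocallyOfFiniteType S.hom] {x : (geom S).left}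
    (hx : IsClosed {x}) : ∃ p : GeomPoint S, p.toBaseChange = x := by
  let q := pointOfClosedPoint (geom S).hom x hx
  have hq : q ≫ (geom S).hom = 𝟙 _ := pointOfClosedPoint_comp _ _ _
  let p : GeomPoint S := Over.homMk (q ≫ toBase S) (by
    rw [Category.assoc, toBase_comp, reassoc_of% hq]; rfl)
  have hp : geomSection p = q := by
    apply geom_hom_ext
    · rw [geomSection_toBase]; rfl
    · rw [geomSection_hom, hq]
  refine ⟨p, ?_⟩
  rw [toBaseChange_eq, hp]
  exact pointOfClosedPoint_apply _ _ _ _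

/-- A geometric point whose image in the base change is fixed by a Galois automorphism is itself
invariant. -/
lemma specGal_comp_of_fixed [LocallyOfFiniteType S.hom] (p : GeomPoint S)
    (σ : Gal(AlgebraicClosure k/k)) (h : galMap S σ p.toBaseChange = p.toBaseChange) :
    specGal σ ≫ p.left = p.left := by
  have hσ : specGal σ⁻¹ ≫ specGal σ = 𝟙 _ := by
    rw [← specGal_mul, inv_mul_cancel, specGal_one]
  have hσ' : specGal σ ≫ specGal σ⁻¹ = 𝟙 _ := by
    rw [← specGal_mul, mul_inv_cancel, specGal_one]
  have h1 : specGal σ⁻¹ ≫ geomSection p ≫ galMap S σ = geomSection p := by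
    refine ext_of_apply_closedPoint_eq (geom S).hom ?_ (geomSection_hom p) ?_
    · rw [Category.assoc, Category.assoc, galMap_hom, reassoc_of% geomSection_hom, hσ]
    · have hpt (a b : SpecOf (AlgebraicClosure k)) : a = b :=
        Subsingleton.elim (α := PrimeSpectrum (AlgebraicClosure k)) _ _
      refine (Scheme.Hom.comp_apply _ _ _).trans ((Scheme.Hom.comp_apply _ _ _).trans ?_)
      refine (congr_arg (fun z ↦ galMap S σ (geomSection p z)) (hpt _ _)).trans (h.trans ?_)
      exact congr_arg (geomSection p) (hpt _ _)
  have h2 : geomSection p ≫ galMap S σ = specGal σ ≫ geomSection p := by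
    rw [← h1, reassoc_of% hσ', h1]
  have h3 := congr_arg (· ≫ toBase S) h2
  simp only [Category.assoc, galMap_toBase, geomSection_toBase] at h3
  exact h3.symm

/-- Invariance of the point means that `N` fixes the image of its residue field in `k̄`, so this
image lies in the fixed field. -/
lemma isDefinedOver_fixedField (p : GeomPoint S) (N : Subgroup Gal(AlgebraicClosure k/k))
    (h : ∀ σ ∈ N, specGal σ ≫ p.left = p.left) :
    p.IsDefinedOver (IntermediateField.fixedField N) := by
  obtain ⟨s, hs⟩ : ∃ s, p.left (⊥ : PrimeSpectrum (AlgebraicClosure k)) = s := ⟨_, rfl⟩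
  obtain ⟨r, hr⟩ := exists_SpecMap_fromSpecResidueField p.left hs
  have hr' (σ) (hσ : σ ∈ N) (a) : σ (r a) = r a := by
    have h1 := h σ hσ
    rw [← hr, ← Category.assoc, cancel_mono, ← Spec.map_comp] at h1
    exact congr($(Spec.map_injective h1).hom a)
  let ψ : S.left.residueField s →+* IntermediateField.fixedField N :=
    r.hom.codRestrict (IntermediateField.fixedField N).toSubfield.toSubring
      fun a ↦ (IntermediateField.mem_fixedField_iff _ _).2 fun σ hσ ↦ hr' σ hσ a
  have hψ : CommRingCat.ofHom ψ ≫ CommRingCat.ofHom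
      (algebraMap (IntermediateField.fixedField N) (AlgebraicClosure k)) = r := by
    ext a; rfl
  have hp : p.left = specAlgebraMap (IntermediateField.fixedField N) (AlgebraicClosure k) ≫
      Spec.map (CommRingCat.ofHom ψ) ≫ S.left.fromSpecResidueField s := by
    rw [← Category.assoc, ← Spec.map_comp, hψ, hr]
  have := epi_SpecMap_of_field (Field.toIsField (IntermediateField.fixedField N))
    (CommRingCat.ofHom (algebraMap (IntermediateField.fixedField N) (AlgebraicClosure k)))
  refine ⟨Over.homMk (Spec.map (CommRingCat.ofHom ψ) ≫ S.left.fromSpecResidueField s) ?_, hp⟩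
  rw [← cancel_epi (specAlgebraMap (IntermediateField.fixedField N) (AlgebraicClosure k))]
  rw [← Category.assoc, ← hp]
  refine (Over.w p).trans ?_
  change specAlgebraMap k (AlgebraicClosure k) = specAlgebraMap _ _ ≫ specAlgebraMap _ _
  rw [← Spec.map_comp, ← CommRingCat.ofHom_comp, ← IsScalarTower.algebraMap_eq]

end

end Points

/-! ### Diagonalisation of lifts -/

section Eigenbasis

variable {F : Type u} [Field F]

/-- The polynomial `X ^ n - r` is separable in characteristic zero, so `f` is semisimple and its
eigenvectors span. -/
lemma exists_eigenbasis [IsAlgClosed F] [CharZero F] (f : Module.End F (forms F 1)) {n : ℕ}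
    (hn : 0 < n) {r : F} (hr : r ≠ 0) (hf : ∀ a, (f ^ n) a = r • a) :
    ∃ (l : Module.Basis (Fin 3) F (forms F 1)) (e : Fin 3 → F), ∀ i, f (l i) = e i • l i := by
  have : FiniteDimensional F (forms F 1) := (formsBasis F).finiteDimensional_of_finite
  have hs : f.IsSemisimple := by
    refine Module.End.isSemisimple_of_squarefree_aeval_eq_zero
      (Polynomial.separable_X_pow_sub_C r (Nat.cast_ne_zero.2 hn.ne') hr).squarefree ?_
    ext1 a
    simp [hf, Algebra.algebraMap_eq_smul_one]
  have hspan : ⊤ ≤ Submodule.span F {v : forms F 1 | ∃ μ : F, f v = μ • v} := by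
    rw [← hs.iSup_eigenspace_eq_top]
    exact iSup_le fun μ v hv ↦ Submodule.subset_span ⟨μ, Module.End.mem_eigenspace_iff.1 hv⟩
  let l₀ := Module.Basis.ofSpan hspan
  have hl₀ (i) : ∃ μ : F, f (l₀ i) = μ • l₀ i :=
    Module.Basis.ofSpan_subset hspan (Set.mem_range_self i)
  let l := l₀.reindex (l₀.indexEquiv (formsBasis _))
  have hl (i) : ∃ μ : F, f (l i) = μ • l i := by
    simp only [l, Module.Basis.reindex_apply]
    exact hl₀ _
  choose e he using hl
  exact ⟨l, e, he⟩

lemma repr_mul_sub_eq_zero {T : forms F 1 ≃+ forms F 1} {e : Fin 3 → F}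
    (hsmul : ∀ (r : F) a, T (r • a) = r • T a)
    (hT : ∀ i, T (formsBasis F i) = e i • formsBasis F i) {v : forms F 1} {μ : F}
    (hv : T v = μ • v) (j : Fin 3) : (formsBasis F).repr v j * (e j - μ) = 0 := by
  have h1 : T v = ∑ i, ((formsBasis F).repr v i * e i) • formsBasis F i := by
    conv_lhs => rw [← (formsBasis F).sum_repr v]
    rw [map_sum]
    exact Finset.sum_congr rfl fun i _ ↦ by rw [hsmul, hT, smul_smul]
  have h2 := congr_arg (fun w ↦ (formsBasis F).repr w j) (h1.symm.trans hv)
  simp only [Module.Basis.repr_sum_self, map_smul, Finsupp.smul_apply, smul_eq_mul] at h2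
  linear_combination h2

variable {X : Over (SpecOf F)} [IsIntegral X.left] {c : PlaneCoords X}
  {θ : X.left.functionField →+* X.left.functionField} {T : forms F 1 ≃+ forms F 1}

lemma IsLift.eq_id_of_scalar (h : IsLift c θ (RingHom.id F) T)
    (hθ : ∀ r, θ (constMap r) = constMap (X := X) r) {r : F} (hT : ∀ a, T a = r • a) :
    θ = RingHom.id _ := by
  have hr : r ≠ 0 := by
    rintro rfl
    refine (formsBasis F).ne_zero 0 (T.map_eq_zero_iff.1 ?_)
    rw [hT, zero_smul]
  have h' := h.smul (inv_ne_zero hr)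
  ext f
  obtain ⟨n, a, ha, b, hb, hb0, -, hf⟩ := c.exists_isRelPrime f
  apply c.val_injective
  rw [h'.val_eq hθ ha hb hb0 hf, RingHom.id_apply, hf]
  have : formSubst (RingHom.id F)
      (T.trans (LinearEquiv.smulOfNeZero F (forms F 1) r⁻¹ (inv_ne_zero hr)).toAddEquiv) =
      RingHom.id _ := by
    refine MvPolynomial.ringHom_ext (fun s ↦ ?_) fun i ↦ ?_
    · rw [formSubst_C]; rfl
    · rw [formSubst_X, RingHom.id_apply, ← coe_formsBasis]
      congr 1
      change r⁻¹ • T (formsBasis F i) = _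
      rw [hT, inv_smul_smul₀ hr]
  rw [this]
  rfl

end Eigenbasis

/-! ### Eigenvalues of automorphisms of finite order -/

section Automorphisms

variable {k : Type u} [Field k] {S : Over (SpecOf k)} [IsIntegral (geom S).left]

/-- The action of an automorphism on the function field of the base change. -/
def autAct (g : Aut S) : (geom S).left.functionField →+* (geom S).left.functionField :=
  functionFieldMap (autMap g)

lemma autAct_constMap (g : Aut S) (r : AlgebraicClosure k) :
    autAct g (constMap r) = constMap (X := geom S) r :=
  functionFieldMap_constMap (X := geom S) (Y := geom S) _ (RingHom.id _)
    ((autMap_hom g).trans (by simp)) r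

lemma autAct_mul (g h : Aut S) : autAct (g * h) = (autAct h).comp (autAct g) := by
  rw [autAct, autAct, autAct, ← functionFieldMap_comp, functionFieldMap_congr (autMap_mul g h)]

lemma autAct_one : autAct (1 : Aut S) = RingHom.id _ := by
  rw [autAct, functionFieldMap_congr autMap_one, functionFieldMap_id]

lemma eq_one_of_autAct_eq [IsSeparated S.hom] {g : Aut S} (h : autAct g = RingHom.id _) :
    g = 1 := by
  have : IsSeparated (geom S).hom := inferInstanceAs (IsSeparated (pullback.snd _ _))
  apply eq_one_of_autMap_eq
  refine eq_of_fromSpecFunctionField_comp_eq (geom S).hom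
    ((autMap_hom g).trans (Category.id_comp _).symm) ?_
  rw [← SpecMap_functionFieldMap, Category.comp_id]
  change Spec.map (CommRingCat.ofHom (autAct g)) ≫ _ = _
  rw [h]
  exact (congr_arg (· ≫ fromSpecFunctionField _) (Spec.map_id _)).trans (Category.id_comp _)

lemma galAct_comp_autAct (σ : Gal(AlgebraicClosure k/k)) (g : Aut S) :
    (galAct S σ).comp (autAct g) = (autAct g).comp (galAct S σ) := by
  rw [galAct, autAct, ← functionFieldMap_comp, ← functionFieldMap_comp,
    functionFieldMap_congr (galMap_autMap σ g)]

lemma IsLift.pow {c : PlaneCoords (geom S)} {g : Aut S}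
    {T : forms (AlgebraicClosure k) 1 ≃+ forms (AlgebraicClosure k) 1}
    (h : IsLift c (autAct g) (RingHom.id _) T) (m : ℕ) :
    ∃ U, IsLift c (autAct (g ^ m)) (RingHom.id _) U ∧ ∀ a, U a = T^[m] a := by
  induction m with
  | zero =>
    refine ⟨AddEquiv.refl _, ?_, fun _ ↦ rfl⟩
    rw [pow_zero, autAct_one]
    exact IsLift.id
  | succ m ih =>
    obtain ⟨U, hU, hUT⟩ := ih
    refine ⟨U.trans T, ?_, fun a ↦ ?_⟩
    · rw [pow_succ, autAct_mul]
      exact h.comp hU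
    · rw [Function.iterate_succ_apply', ← hUT]
      rfl

/-- An automorphism of finite order is diagonal in suitable homogeneous coordinates. -/
lemma exists_diagonal [CharZero k] (c : PlaneCoords (geom S)) (g : Aut S) {n : ℕ} (hn : 0 < n)
    (hg : g ^ n = 1) : ∃ (c' : PlaneCoords (geom S))
      (T : forms (AlgebraicClosure k) 1 ≃+ forms (AlgebraicClosure k) 1)
      (e : Fin 3 → AlgebraicClosure k), IsLift c' (autAct g) (RingHom.id _) T ∧
        ∀ i, T (formsBasis _ i) = e i • formsBasis _ i := by
  obtain ⟨T, hT⟩ := exists_isLift c (autMap g) (RingEquiv.refl _) (autAct_constMap g)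
  obtain ⟨U, hU, hUT⟩ := IsLift.pow hT n
  rw [hg, autAct_one] at hU
  obtain ⟨r, hr, hUr⟩ := IsLift.id.exists_eq_smul hU
  let f : Module.End (AlgebraicClosure k) (forms (AlgebraicClosure k) 1) :=
    { T.toAddMonoidHom with map_smul' := hT.map_smul }
  obtain ⟨l, e, hl⟩ := exists_eigenbasis f hn hr fun a ↦ by
    rw [Module.End.pow_apply]
    exact (hUT a).symm.trans (hUr a)
  refine ⟨_, _, e, hT.changeCoords (l.equiv (formsBasis _) (Equiv.refl _)), fun i ↦ ?_⟩
  set W := l.equiv (formsBasis (AlgebraicClosure k)) (Equiv.refl _) with hW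
  have hWl (i) : W (l i) = formsBasis _ i := by simp [W]
  change W (T (W.symm (formsBasis _ i))) = _
  rw [← hWl, LinearEquiv.symm_apply_apply]
  exact (congr_arg W (hl i)).trans (map_smul _ _ _)

variable {c : PlaneCoords (geom S)} {g : Aut S}
  {T : forms (AlgebraicClosure k) 1 ≃+ forms (AlgebraicClosure k) 1}
  {e : Fin 3 → AlgebraicClosure k}

/-- The lift of `g ^ m` is diagonal with entries `e i ^ m`; it induces the identity exactly when it
is scalar. -/
lemma IsLift.pow_eq_one_iff [IsSeparated S.hom] (h : IsLift c (autAct g) (RingHom.id _) T)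
    (hT : ∀ i, T (formsBasis _ i) = e i • formsBasis _ i) (m : ℕ) :
    g ^ m = 1 ↔ ∀ i j, e i ^ m = e j ^ m := by
  obtain ⟨U, hU, hUT⟩ := h.pow m
  have hU' (i) : U (formsBasis _ i) = e i ^ m • formsBasis _ i := by
    rw [hUT]
    clear hUT hU
    induction m with
    | zero => simp
    | succ m ih =>
      rw [Function.iterate_succ_apply', ih, h.map_smul, hT, smul_smul, pow_succ]
      rfl
  constructor
  · intro hg
    rw [hg, autAct_one] at hU
    obtain ⟨r, -, hr⟩ := IsLift.id.exists_eq_smul hU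
    have h1 (i) : e i ^ m = r := by
      have h2 := (hU' i).symm.trans (hr _)
      exact smul_left_injective _ ((formsBasis _).ne_zero i) h2
    intro i j
    rw [h1, h1]
  · intro he
    refine eq_one_of_autAct_eq (hU.eq_id_of_scalar (autAct_constMap _) (r := e 0 ^ m) fun a ↦ ?_)
    conv_lhs => rw [← (formsBasis _).sum_repr a]
    conv_rhs => rw [← (formsBasis _).sum_repr a]
    rw [map_sum, Finset.smul_sum]
    refine Finset.sum_congr rfl fun i _ ↦ ?_
    rw [hU.map_smul, hU', he i 0, smul_comm]
    rfl

/-- A Galois conjugate of an eigenvector is an eigenvector. -/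
lemma IsLift.exists_galois_smul (h : IsLift c (autAct g) (RingHom.id _) T)
    (hT : ∀ i, T (formsBasis _ i) = e i • formsBasis _ i) {σ : Gal(AlgebraicClosure k/k)}
    {U : forms (AlgebraicClosure k) 1 ≃+ forms (AlgebraicClosure k) 1}
    (hU : IsLift c (galAct S σ) (σ : AlgebraicClosure k →+* AlgebraicClosure k) U) :
    ∃ t : AlgebraicClosure k, t ≠ 0 ∧
      ∀ i j, (formsBasis _).repr (U (formsBasis _ i)) j * (e j - t * σ (e i)) = 0 := by
  have h1 := hU.comp h
  have h2 := h.comp hU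
  rw [galAct_comp_autAct] at h1
  obtain ⟨t, ht, h3⟩ := h1.exists_eq_smul h2
  refine ⟨t, ht, fun i j ↦ repr_mul_sub_eq_zero h.map_smul hT ?_ j⟩
  refine (h3 _).trans ?_
  change t • U (T _) = _
  rw [hT, hU.map_smul, smul_smul]
  rfl

variable [IsIntegral S.left]

/-- A linear form preserved up to scalars would give rational coordinates, hence trivialise `S`.
Nontriviality is used only in this form: no line is Galois-stable. -/
lemma exists_not_smul [CharZero k] [LocallyOfFiniteType S.hom] [S.left.IsSeparated]
    (hS : ¬ IsTrivial 2 S) {w : forms (AlgebraicClosure k) 1} (hw : w ≠ 0) :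
    ∃ (σ : Gal(AlgebraicClosure k/k)) (U : forms (AlgebraicClosure k) 1 ≃+ _),
      IsLift c (galAct S σ) (σ : AlgebraicClosure k →+* AlgebraicClosure k) U ∧
        ∀ r : AlgebraicClosure k, U w ≠ r • w := by
  by_contra! hcon
  obtain ⟨c', hc'⟩ := exists_isRational c w hw hcon
  exact hS hc'.isTrivial

lemma eq_smul_of_repr {v : forms (AlgebraicClosure k) 1} {j : Fin 3}
    (h : ∀ i, i ≠ j → (formsBasis _).repr v i = 0) :
    v = (formsBasis _).repr v j • formsBasis _ j := by
  conv_lhs => rw [← (formsBasis _).sum_repr v]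
  exact Finset.sum_eq_single j (fun i _ hi ↦ by rw [h i hi, zero_smul]) (by simp)

/-- The eigenvalues of a nontrivial automorphism of finite order are distinct. -/
lemma IsLift.eigenvalue_injective [CharZero k] [LocallyOfFiniteType S.hom] [S.left.IsSeparated]
    [IsSeparated S.hom] (hS : ¬ IsTrivial 2 S) (h : IsLift c (autAct g) (RingHom.id _) T)
    (hT : ∀ i, T (formsBasis _ i) = e i • formsBasis _ i) (hg : g ≠ 1) :
    Function.Injective e := by
  intro i j hij
  by_contra hne
  obtain ⟨m, hmi, hmj, hm⟩ := (by decide : ∀ i j : Fin 3, i ≠ j →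
    ∃ m, m ≠ i ∧ m ≠ j ∧ ∀ l, l ≠ m → l = i ∨ l = j) i j hne
  have hem : e m ≠ e i := by
    intro hem
    apply hg
    rw [← pow_one g, h.pow_eq_one_iff hT]
    have h1 (l) : e l = e i := by
      by_cases hl : l = m
      · rw [hl, hem]
      · obtain rfl | rfl := hm l hl
        · rfl
        · exact hij.symm
    intro l l'
    rw [h1 l, h1 l']
  obtain ⟨σ, U, hU, hUm⟩ := exists_not_smul (c := c) hS ((formsBasis _).ne_zero m)
  obtain ⟨t, ht, hrepr⟩ := h.exists_galois_smul hT hU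
  -- `U` sends the `m`-th eigenvector to an eigenvector with eigenvalue `t * σ (e m)`. Not being a
  -- multiple of the `m`-th one, it must belong to the repeated eigenvalue.
  have hμ : e i = t * σ (e m) := by
    by_contra hμ
    refine hUm _ (eq_smul_of_repr fun l hl ↦ ?_)
    refine (mul_eq_zero.1 (hrepr m l)).resolve_right (sub_ne_zero.2 ?_)
    obtain rfl | rfl := hm l hl
    · exact hμ
    · exact hij ▸ hμ
  have hσ : e i ≠ t * σ (e i) := by
    rw [hμ, Ne, mul_right_inj' ht, ← hμ]
    exact fun h ↦ hem (σ.injective h)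
  -- Now both eigenvectors with the repeated eigenvalue go to multiples of the `m`-th one, against
  -- injectivity of `U`.
  have key (l) (hl : e l = e i) :
      U (formsBasis _ l) = (formsBasis _).repr (U (formsBasis _ l)) m • formsBasis _ m := by
    refine eq_smul_of_repr fun l' hl' ↦ ?_
    refine (mul_eq_zero.1 (hrepr l l')).resolve_right (sub_ne_zero.2 ?_)
    rw [hl]
    obtain rfl | rfl := hm l' hl'
    · exact hσ
    · exact hij ▸ hσ
  have hi := key i rfl
  have hj := key j hij.symm
  set a := (formsBasis _).repr (U (formsBasis _ i)) m
  set b := (formsBasis _).repr (U (formsBasis _ j)) m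
  have ha : a ≠ 0 := by
    intro ha
    rw [ha, zero_smul, U.map_eq_zero_iff] at hi
    exact (formsBasis _).ne_zero i hi
  have hji : formsBasis (AlgebraicClosure k) j = σ.symm (b / a) • formsBasis _ i := by
    apply U.injective
    rw [hU.map_smul, hi, hj, smul_smul]
    change _ = (σ (σ.symm (b / a)) * a) • _
    rw [AlgEquiv.apply_symm_apply, div_mul_cancel₀ b ha]
  have h1 := congr_arg (fun v ↦ (formsBasis _).repr v j) hji
  simp [Finsupp.single_eq_of_ne (Ne.symm hne)] at h1

end Automorphisms

/-! ### Commuting permutations of three letters -/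

section Perm

lemma perm_fin_three_eq_one {π : Equiv.Perm (Fin 3)} (h0 : π 0 = 0) (h1 : π 1 = 1) : π = 1 := by
  revert π
  decide

/-- If none were fixed-point free, all three would be transpositions. Commuting transpositions of
three letters are equal, and a single one fixes a letter. -/
lemma exists_derangement : ∀ a b c : Equiv.Perm (Fin 3), a * b = b * a → a * c = c * a →
    b * c = c * b → a 0 ≠ 0 → b 1 ≠ 1 → c 2 ≠ 2 →
    ∃ d, (d = a ∨ d = b ∨ d = c) ∧ ∀ i, d i ≠ i := by
  decide

/-- A fixed-point-free permutation of three letters is a 3-cycle: it is transitive and its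
centraliser consists of its powers. -/
lemma eq_pow_of_commute_derangement : ∀ d : Equiv.Perm (Fin 3), (∀ i, d i ≠ i) →
    d ^ 3 = 1 ∧ (∀ i j, j = i ∨ j = d i ∨ j = d (d i)) ∧
      ∀ x, d * x = x * d → x = 1 ∨ x = d ∨ x = d * d := by
  decide

/-- A commutative group of permutations of three letters without common fixed letter has order
three. -/
lemma card_eq_three_of_commute (H : Subgroup (Equiv.Perm (Fin 3)))
    (hcomm : ∀ a ∈ H, ∀ b ∈ H, a * b = b * a) (hfix : ∀ i, ∃ a ∈ H, a i ≠ i) :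
    Nat.card H = 3 := by
  obtain ⟨a, ha, ha0⟩ := hfix 0
  obtain ⟨b, hb, hb1⟩ := hfix 1
  obtain ⟨c, hc, hc2⟩ := hfix 2
  obtain ⟨d, hd, hdi⟩ := exists_derangement a b c (hcomm a ha b hb) (hcomm a ha c hc)
    (hcomm b hb c hc) ha0 hb1 hc2
  have hdH : d ∈ H := by rcases hd with rfl | rfl | rfl <;> assumption
  obtain ⟨hd3, -, hx⟩ := eq_pow_of_commute_derangement d hdi
  have hH : H = Subgroup.zpowers d := by
    refine le_antisymm (fun x hxH ↦ ?_) (by simpa using hdH)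
    obtain rfl | rfl | rfl := hx x (hcomm d hdH x hxH)
    · exact one_mem _
    · exact Subgroup.mem_zpowers x
    · exact mul_mem (Subgroup.mem_zpowers d) (Subgroup.mem_zpowers d)
  have hd1 : d ≠ 1 := fun h ↦ hdi 0 (by rw [h]; rfl)
  have : Fact (Nat.Prime 3) := ⟨Nat.prime_three⟩
  rw [hH, Nat.card_zpowers, orderOf_eq_prime hd3 hd1]

end Perm

/-! ### Roots of unity and cubic extensions -/

section Galois

variable {k : Type u} [Field k]

/-- The commutator of two field automorphisms fixes all roots of unity. -/
lemma commutator_apply_of_pow_eq_one {L : Type u} [Field L] [Algebra k L] (σ τ : Gal(L/k)) {n : ℕ}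
    (hn : 0 < n) {ζ : L} (hζ : ζ ^ n = 1) : (σ * τ * (τ * σ)⁻¹) ζ = ζ := by
  have : NeZero n := ⟨hn.ne'⟩
  have key (ξ : L) (hξ : ξ ^ n = 1) : σ (τ ξ) = τ (σ ξ) := by
    obtain ⟨a, ha⟩ := map_rootsOfUnity_eq_pow_self σ.toAlgHom (rootsOfUnity.mkOfPowEq ξ hξ)
    obtain ⟨b, hb⟩ := map_rootsOfUnity_eq_pow_self τ.toAlgHom (rootsOfUnity.mkOfPowEq ξ hξ)
    have ha' : σ ξ = ξ ^ a := ha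
    have hb' : τ ξ = ξ ^ b := hb
    rw [ha', hb', map_pow, map_pow, ha', hb', ← pow_mul, ← pow_mul, mul_comm]
  have h1 : ((τ * σ)⁻¹ ζ) ^ n = 1 := by rw [← map_pow, hζ, map_one]
  change σ (τ ((τ * σ)⁻¹ ζ)) = ζ
  rw [key _ h1]
  exact AlgEquiv.apply_symm_apply (τ * σ) ζ

lemma exists_cyclic_cubic {k : Type u} [Field k] [CharZero k]
    (N : Subgroup Gal(AlgebraicClosure k/k)) [N.Normal]
    (hN : IsOpen (N : Set Gal(AlgebraicClosure k/k))) (hN3 : N.index = 3) :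
    Module.finrank k (IntermediateField.fixedField N) = 3 ∧
      IsGalois k (IntermediateField.fixedField N) ∧
      IsCyclic (IntermediateField.fixedField N ≃ₐ[k] IntermediateField.fixedField N) := by
  have : IsGalois k (AlgebraicClosure k) := {}
  have hfix : (IntermediateField.fixedField N).fixingSubgroup = N :=
    InfiniteGalois.fixingSubgroup_fixedField ⟨N, N.isClosed_of_isOpen hN⟩
  have h3 : Module.finrank k (IntermediateField.fixedField N) = 3 := by
    rw [IntermediateField.finrank_eq_fixingSubgroup_index, hfix, hN3]
  have hgal : IsGalois k (IntermediateField.fixedField N) :=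
    (InfiniteGalois.normal_iff_isGalois _).1 (by rwa [hfix])
  have : FiniteDimensional k (IntermediateField.fixedField N) :=
    .of_finrank_pos (h3 ▸ Nat.succ_pos 2)
  have : Fact (Nat.Prime 3) := ⟨Nat.prime_three⟩
  exact ⟨h3, hgal, isCyclic_of_prime_card ((IsGalois.card_aut_eq_finrank k _).trans h3)⟩

end Galois

/-! ### Galois permutations of the triangle of eigenvectors -/

section GaloisPerm

variable {k : Type u} [Field k] {S : Over (SpecOf k)} [IsIntegral (geom S).left]
  {c : PlaneCoords (geom S)} {g : Aut S}
  {T : forms (AlgebraicClosure k) 1 ≃+ forms (AlgebraicClosure k) 1}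
  {e : Fin 3 → AlgebraicClosure k}

/-- The coordinate triangle of `c` is mapped to itself by `σ`, through the permutation `π`. -/
def PlaneCoords.PermutedBy (c : PlaneCoords (geom S)) (σ : Gal(AlgebraicClosure k/k))
    (π : Equiv.Perm (Fin 3)) : Prop :=
  ∃ (U : forms (AlgebraicClosure k) 1 ≃+ forms (AlgebraicClosure k) 1)
    (r : Fin 3 → AlgebraicClosure k),
    IsLift c (galAct S σ) (σ : AlgebraicClosure k →+* AlgebraicClosure k) U ∧
      ∀ i, U (formsBasis _ i) = r i • formsBasis _ (π i)

lemma PlaneCoords.PermutedBy.unique {σ : Gal(AlgebraicClosure k/k)} {π π' : Equiv.Perm (Fin 3)}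
    (h : c.PermutedBy σ π) (h' : c.PermutedBy σ π') : π = π' := by
  obtain ⟨U, r, hU, hr⟩ := h
  obtain ⟨U', r', hU', hr'⟩ := h'
  obtain ⟨s, -, hs⟩ := hU.exists_eq_smul hU'
  ext1 i
  by_contra hne
  have h1 := hs (formsBasis _ i)
  rw [hr, hr', smul_smul] at h1
  have h2 := congr_arg (fun v ↦ (formsBasis _).repr v (π' i)) h1
  simp [Finsupp.single_eq_of_ne (Ne.symm hne)] at h2
  exact (hU'.map_coordFrac hr' i i).1 h2

lemma PlaneCoords.PermutedBy.mul {σ τ : Gal(AlgebraicClosure k/k)} {π ϖ : Equiv.Perm (Fin 3)}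
    (h : c.PermutedBy σ π) (h' : c.PermutedBy τ ϖ) : c.PermutedBy (σ * τ) (π * ϖ) := by
  obtain ⟨U, r, hU, hr⟩ := h
  obtain ⟨U', r', hU', hr'⟩ := h'
  refine ⟨U'.trans U, fun i ↦ σ (r' i) * r (ϖ i), ?_, fun i ↦ ?_⟩
  · have : galAct S (σ * τ) = (galAct S σ).comp (galAct S τ) := RingHom.ext (galAct_mul σ τ)
    rw [this]
    exact hU.comp hU'
  · change U (U' _) = _
    rw [hr', hU.map_smul, hr, smul_smul]
    rfl

/-- The kernel contains the fixing group of a finite extension: an element that fixes `X 0 / X 1`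
fixes the letters `0` and `1`, hence all three. -/
lemma PlaneCoords.PermutedBy.isOpen {Γ : Gal(AlgebraicClosure k/k) →* Equiv.Perm (Fin 3)}
    [IsIntegral S.left] (hΓ : ∀ σ, c.PermutedBy σ (Γ σ)) :
    IsOpen (Γ.ker : Set Gal(AlgebraicClosure k/k)) := by
  obtain ⟨E, hE, hfix⟩ := exists_finiteDimensional_fixing (c.coordFrac 0 1)
  refine Subgroup.isOpen_mono (H₁ := E.fixingSubgroup) (fun σ hσ ↦ ?_)
    (IntermediateField.fixingSubgroup_isOpen E)
  rw [MonoidHom.mem_ker]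
  obtain ⟨U, r, hU, hr⟩ := hΓ σ
  have hr0 (i) := (hU.map_coordFrac hr i 0).1
  have h1 := (hU.map_coordFrac hr 0 1).2
  rw [hfix σ hσ] at h1
  have h2 := congr_arg c.val h1
  rw [map_mul, c.val_coordFrac, c.val_const, c.val_coordFrac, quot_mul_quot, quot_eq_quot_iff
    (MvPolynomial.X_ne_zero _) (mul_ne_zero one_ne_zero (MvPolynomial.X_ne_zero _)), one_mul] at h2
  -- Setting the `j`-th variable to zero and the others to one detects which variables occur on each
  -- side.
  have h3 (j) := congr_arg (MvPolynomial.eval fun i ↦ if i = j then 0 else 1) h2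
  have hc := div_ne_zero (hr0 0) (hr0 1)
  simp only [map_mul, MvPolynomial.eval_X, MvPolynomial.eval_C] at h3
  have h0 : Γ σ 0 = 0 := by
    by_contra hne
    exact hc (by simpa [hne, -div_eq_zero_iff] using (h3 0).symm)
  refine perm_fin_three_eq_one h0 ?_
  by_contra hne
  simpa [hne, hr0] using h3 1

lemma IsLift.eigenvalue_ne_zero (h : IsLift c (autAct g) (RingHom.id _) T)
    (hT : ∀ i, T (formsBasis _ i) = e i • formsBasis _ i) (i) : e i ≠ 0 :=
  (h.map_coordFrac (π := 1) hT i i).1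

/-- The image of the `i`-th eigenvector has eigenvalue `t * σ (e i)`; the eigenvalues being
distinct, it spans exactly one coordinate axis. -/
lemma IsLift.exists_permutedBy (h : IsLift c (autAct g) (RingHom.id _) T)
    (hT : ∀ i, T (formsBasis _ i) = e i • formsBasis _ i) (he : Function.Injective e)
    (σ : Gal(AlgebraicClosure k/k)) : ∃ π : Equiv.Perm (Fin 3), c.PermutedBy σ π ∧
      ∃ t, t ≠ 0 ∧ ∀ i, e (π i) = t * σ (e i) := by
  obtain ⟨U, hU⟩ := exists_isLift_galAct c σ
  obtain ⟨t, ht, hrepr⟩ := h.exists_galois_smul hT hU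
  have hex (i) : ∃ j, e j = t * σ (e i) := by
    by_contra! hne
    refine (formsBasis _).ne_zero i (U.map_eq_zero_iff.1 ((formsBasis _).repr.map_eq_zero_iff.1 ?_))
    ext j
    exact (mul_eq_zero.1 (hrepr i j)).resolve_right (sub_ne_zero.2 (hne j))
  choose f hf using hex
  have hfi : Function.Injective f := fun i j hij ↦ by
    have := hf i
    rw [hij, hf, mul_right_inj' ht] at this
    exact he (σ.injective this.symm)
  refine ⟨Equiv.ofBijective f (Finite.injective_iff_bijective.1 hfi),
    ⟨U, fun i ↦ (formsBasis _).repr (U (formsBasis _ i)) (f i), hU, fun i ↦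
      eq_smul_of_repr fun j hj ↦ ?_⟩, t, ht, hf⟩
  refine (mul_eq_zero.1 (hrepr i j)).resolve_right (sub_ne_zero.2 fun h ↦ hj (he ?_))
  rw [h, ← hf]

/-- The Galois group permutes the coordinate triangle of eigenvectors of an automorphism with
distinct eigenvalues. -/
lemma IsLift.exists_galoisPerm (h : IsLift c (autAct g) (RingHom.id _) T)
    (hT : ∀ i, T (formsBasis _ i) = e i • formsBasis _ i) (he : Function.Injective e) :
    ∃ Γ : Gal(AlgebraicClosure k/k) →* Equiv.Perm (Fin 3), ∀ σ, c.PermutedBy σ (Γ σ) ∧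
      ∃ t, t ≠ 0 ∧ ∀ i, e (Γ σ i) = t * σ (e i) := by
  choose f hf hf' using h.exists_permutedBy hT he
  exact ⟨MonoidHom.mk' f fun σ τ ↦ (hf _).unique ((hf σ).mul (hf τ)), fun σ ↦ ⟨hf σ, hf' σ⟩⟩

/-- A permutation multiplying three distinct nonzero numbers with distinct cubes by a common
factor is trivial. -/
lemma eq_one_of_eq_mul {F : Type u} [Field F] {e : Fin 3 → F} (he : Function.Injective e)
    (he0 : ∀ i, e i ≠ 0) (h3 : ¬ ∀ i j, e i ^ 3 = e j ^ 3) {π : Equiv.Perm (Fin 3)} {ζ : F}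
    (hζ : ∀ i, e (π i) = ζ * e i) : π = 1 := by
  by_cases hfix : ∃ i, π i = i
  · obtain ⟨i, hi⟩ := hfix
    have h1 := hζ i
    rw [hi, eq_comm, mul_eq_right₀ (he0 i)] at h1
    ext1 j
    exact he (by rw [hζ, h1, one_mul]; rfl)
  · push Not at hfix
    obtain ⟨hπ3, hπ, -⟩ := eq_pow_of_commute_derangement π hfix
    -- The permutation is a 3-cycle, so going round once gives `ζ ^ 3 = 1`; by transitivity all
    -- cubes `e i ^ 3` are then equal.
    have h1 : ζ ^ 3 = 1 := by
      have h2 : π (π (π 0)) = 0 := congr_arg (fun x : Equiv.Perm (Fin 3) ↦ x 0) hπ3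
      have h4 : e (π (π (π 0))) = ζ ^ 3 * e 0 := by rw [hζ, hζ, hζ]; ring
      rwa [h2, eq_comm, mul_eq_right₀ (he0 0)] at h4
    refine absurd (fun i j ↦ ?_) h3
    obtain rfl | rfl | rfl := hπ i j
    · rfl
    · rw [hζ, mul_pow, h1, one_mul]
    · rw [hζ, hζ, mul_pow, mul_pow, h1, one_mul, one_mul]

/-- A commutator fixes the ratios `e i / e 0`, which are roots of unity, so its permutation
multiplies all eigenvalues by one factor and `eq_one_of_eq_mul` applies. -/
lemma commute_of_eq_mul (he : Function.Injective e) (he0 : ∀ i, e i ≠ 0)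
    (h3 : ¬ ∀ i j, e i ^ 3 = e j ^ 3) {n : ℕ} (hn : 0 < n) (hen : ∀ i j, e i ^ n = e j ^ n)
    {Γ : Gal(AlgebraicClosure k/k) →* Equiv.Perm (Fin 3)}
    (hΓ : ∀ σ, ∃ t, t ≠ 0 ∧ ∀ i, e (Γ σ i) = t * σ (e i)) (σ τ : Gal(AlgebraicClosure k/k)) :
    Γ σ * Γ τ = Γ τ * Γ σ := by
  rw [← mul_inv_eq_one, ← map_mul, ← map_mul, ← map_inv, ← map_mul]
  set γ := σ * τ * (τ * σ)⁻¹ with hγ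
  obtain ⟨t, -, ht⟩ := hΓ γ
  refine eq_one_of_eq_mul he he0 h3 (ζ := t * γ (e 0) / e 0) fun i ↦ ?_
  have h1 : γ (e i / e 0) = e i / e 0 := commutator_apply_of_pow_eq_one σ τ hn
    (by rw [div_pow, hen i 0, div_self (pow_ne_zero _ (he0 0))])
  have h2 : γ (e i) = e i / e 0 * γ (e 0) := by
    rw [← h1, ← map_mul, div_mul_cancel₀ _ (he0 0)]
  rw [ht, h2]
  ring

end GaloisPerm

/-! ### The fixed locus of a cyclic group -/

section FixedLocus

variable {k : Type u} [Field k] {S : Over (SpecOf k)}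

lemma fixed_pow {g : Aut S} {x : (geom S).left}
    (hx : (geom S).left.fromSpecResidueField x ≫ autMap g = (geom S).left.fromSpecResidueField x)
    (m : ℕ) : (geom S).left.fromSpecResidueField x ≫ autMap (g ^ m) =
      (geom S).left.fromSpecResidueField x := by
  induction m with
  | zero => rw [pow_zero, autMap_one, Category.comp_id]
  | succ m ih => rw [pow_succ', autMap_mul, reassoc_of% ih, hx]

lemma mem_fixedLocus_zpowers {g : Aut S} (hg : IsOfFinOrder g) {x : (geom S).left} :
    x ∈ fixedLocus (Subgroup.zpowers g) ↔
      (geom S).left.fromSpecResidueField x ≫ autMap g =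
        (geom S).left.fromSpecResidueField x := by
  refine ⟨fun h ↦ h g (Subgroup.mem_zpowers g), fun h g' hg' ↦ ?_⟩
  rw [← SetLike.mem_coe, ← hg.powers_eq_zpowers] at hg'
  obtain ⟨m, rfl⟩ := hg'
  exact fixed_pow h m

variable [LocallyOfFiniteType S.hom]

/-- Closed points of the base change come from geometric points, as `k̄` is algebraically closed. -/
lemma fixedLocus_eq_image {G : Subgroup (Aut S)} (h : ∀ x ∈ fixedLocus G, IsClosed {x}) :
    fixedLocus G = GeomPoint.toBaseChange '' fixedGeomPoints G := by
  ext x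
  constructor
  · intro hx
    obtain ⟨p, rfl⟩ := exists_toBaseChange_eq (h x hx)
    exact ⟨p, (mem_fixedGeomPoints_iff G p).2 hx, rfl⟩
  · rintro ⟨p, hp, rfl⟩
    exact (mem_fixedGeomPoints_iff G p).1 hp

lemma ncard_fixedGeomPoints {G : Subgroup (Aut S)} (h : ∀ x ∈ fixedLocus G, IsClosed {x}) :
    (fixedGeomPoints G).ncard = (fixedLocus G).ncard := by
  rw [fixedLocus_eq_image h, Set.ncard_image_of_injective _ toBaseChange_injective]

end FixedLocus

/-! ### The set of three vertices -/

section Vertices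

variable {F : Type u} [Field F] {X : Over (SpecOf F)} [IsIntegral X.left] (c : PlaneCoords X)

lemma PlaneCoords.setOf_isVertex :
    {x | ∃ j, c.IsVertex j x} = Set.range fun j ↦ c.pt.symm (vertex F j) := by
  ext x
  exact exists_congr fun j ↦ c.isVertex_iff.trans eq_comm

lemma PlaneCoords.ncard_setOf_isVertex : {x | ∃ j, c.IsVertex j x}.ncard = 3 := by
  have hinj : Function.Injective fun j ↦ c.pt.symm (vertex F j) := fun i j hij ↦
    PlaneCoords.IsVertex.inj (c.isVertex_iff.2 rfl) (c.isVertex_iff.2 hij)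
  rw [c.setOf_isVertex, ← Set.image_univ, Set.ncard_image_of_injective _ hinj, Set.ncard_univ,
    Nat.card_eq_fintype_card, Fintype.card_fin]

lemma discreteTopology_of_isClosed_singleton {Y : Type*} [TopologicalSpace Y] {s : Set Y}
    (hs : s.Finite) (h : ∀ x ∈ s, IsClosed {x}) : DiscreteTopology s := by
  have := hs.to_subtype
  have : T1Space s := ⟨fun x ↦ by
    convert (h x x.2).preimage continuous_subtype_val
    ext y
    exact Subtype.ext_iff⟩
  infer_instance

end Vertices

/-! ### The cyclic cubic field of definition -/

section Main

variable {k : Type u} [Field k] {S : Over (SpecOf k)} [IsIntegral (geom S).left]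
  [LocallyOfFiniteType S.hom] {c : PlaneCoords (geom S)}

lemma PlaneCoords.PermutedBy.isDefinedOver
    {Γ : Gal(AlgebraicClosure k/k) →* Equiv.Perm (Fin 3)} (hΓ : ∀ σ, c.PermutedBy σ (Γ σ))
    {p : GeomPoint S} {j : Fin 3} (hp : c.IsVertex j p.toBaseChange) :
    p.IsDefinedOver (IntermediateField.fixedField Γ.ker) := by
  refine isDefinedOver_fixedField p _ fun σ hσ ↦ specGal_comp_of_fixed p σ ?_
  obtain ⟨U, r, hU, hr⟩ := hΓ σ
  rw [MonoidHom.mem_ker.1 hσ] at hr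
  have := IsLift.isVertex (φ := galMap S σ) hU hr hp
  rw [c.isVertex_iff] at this hp
  exact this.trans hp.symm

variable [CharZero k] [IsIntegral S.left] [S.left.IsSeparated] {g : Aut S}
  {T : forms (AlgebraicClosure k) 1 ≃+ forms (AlgebraicClosure k) 1}
  {e : Fin 3 → AlgebraicClosure k}

/-- The vertices of the triangle of eigenvectors of an automorphism of finite order `n > 3` are
defined over a cyclic cubic extension. -/
lemma IsLift.exists_cubic [IsSeparated S.hom] (hS : ¬ IsTrivial 2 S)
    (h : IsLift c (autAct g) (RingHom.id _) T)
    (hT : ∀ i, T (formsBasis _ i) = e i • formsBasis _ i) (hg : g ≠ 1) (hg3 : g ^ 3 ≠ 1) {n : ℕ}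
    (hn : 0 < n) (hgn : g ^ n = 1) :
    ∃ K : IntermediateField k (AlgebraicClosure k),
        Module.finrank k K = 3 ∧ IsGalois k K ∧ IsCyclic (K ≃ₐ[k] K) ∧
        ∀ p : GeomPoint S, (∃ j, c.IsVertex j p.toBaseChange) → p.IsDefinedOver K := by
  have he := h.eigenvalue_injective hS hT hg
  obtain ⟨Γ, hΓ⟩ := h.exists_galoisPerm hT he
  have hcomm := commute_of_eq_mul he (h.eigenvalue_ne_zero hT)
    (mt (h.pow_eq_one_iff hT 3).2 hg3) hn ((h.pow_eq_one_iff hT n).1 hgn) fun σ ↦ (hΓ σ).2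
  have hindex : Γ.ker.index = 3 := by
    rw [Subgroup.index_ker]
    refine card_eq_three_of_commute _ ?_ fun i ↦ ?_
    · rintro _ ⟨σ, rfl⟩ _ ⟨τ, rfl⟩
      exact hcomm σ τ
    -- A letter fixed by the whole image of `Γ` would be a Galois-stable line.
    · obtain ⟨σ, U, hU, hUi⟩ := exists_not_smul (c := c) hS ((formsBasis _).ne_zero i)
      refine ⟨Γ σ, ⟨σ, rfl⟩, fun hi ↦ ?_⟩
      obtain ⟨U', r, hU', hr⟩ := (hΓ σ).1
      obtain ⟨s, -, hs⟩ := hU'.exists_eq_smul hU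
      refine hUi (s * r i) ?_
      rw [hs, hr, hi, smul_smul]
  obtain ⟨h3, hgal, hcyc⟩ := exists_cyclic_cubic Γ.ker
    (PlaneCoords.PermutedBy.isOpen fun σ ↦ (hΓ σ).1) hindex
  exact ⟨_, h3, hgal, hcyc, fun p ⟨j, hj⟩ ↦
    PlaneCoords.PermutedBy.isDefinedOver (fun σ ↦ (hΓ σ).1) hj⟩

end Main

/-! ### Choice of a generator and the theorem -/

lemma exists_generator {H : Type*} [Group H] (G : Subgroup H) {n : ℕ} (hn : 2 ≤ n)
    (hG : Nonempty (G ≃* Multiplicative (ZMod n))) :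
    ∃ g : H, G = Subgroup.zpowers g ∧ orderOf g = n := by
  obtain ⟨φ⟩ := hG
  have : NeZero n := ⟨by lia⟩
  have : IsCyclic G := isCyclic_of_surjective φ.symm φ.symm.surjective
  obtain ⟨g, hg⟩ := IsCyclic.exists_generator (α := G)
  have hG' : G = Subgroup.zpowers (g : H) := by
    refine le_antisymm (fun x hx ↦ ?_) (by simp)
    obtain ⟨m, hm⟩ := hg ⟨x, hx⟩
    exact ⟨m, congr_arg Subtype.val hm⟩
  refine ⟨g, hG', ?_⟩
  rw [← Nat.card_zpowers, ← hG', Nat.card_congr φ.toEquiv]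
  exact (Nat.card_zmod n)

end SeveriBrauer

end

theorem mainTheorem7 {k : Type u} [Field k] [CharZero k]
    (S : Over (SeveriBrauer.SpecOf k))
    (hS : SeveriBrauer.IsSeveriBrauerSurface S) (hnontriv : ¬ SeveriBrauer.IsTrivial 2 S)
    (n : ℕ) (hn : 2 ≤ n)
    (G : Subgroup (Aut S)) (hG : Nonempty (G ≃* Multiplicative (ZMod n))) :
    ((SeveriBrauer.fixedGeomPoints G).ncard = 3 ∧
      SeveriBrauer.fixedLocus G =
        SeveriBrauer.GeomPoint.toBaseChange '' SeveriBrauer.fixedGeomPoints G ∧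
      DiscreteTopology (SeveriBrauer.fixedLocus G)) ∧
    (3 < n →
      ∃ K : IntermediateField k (AlgebraicClosure k),
        Module.finrank k K = 3 ∧ IsGalois k K ∧ IsCyclic (K ≃ₐ[k] K) ∧
        ∀ p ∈ SeveriBrauer.fixedGeomPoints G, SeveriBrauer.GeomPoint.IsDefinedOver p K) := by
  open SeveriBrauer in
  obtain ⟨⟨hint, hsep, hft, -⟩, ⟨ι⟩⟩ := hS
  have hsep' : S.left.IsSeparated := by
    rw [Scheme.isSeparated_iff, ← terminal.comp_from S.hom]
    infer_instance
  let ε : (geom S).left ≅ plane (AlgebraicClosure k) := (Over.forget _).mapIso ι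
  have hε : ε.inv ≫ (geom S).hom = (planeOver (AlgebraicClosure k)).hom := Over.w ι.inv
  have hgeom : IsIntegral (geom S).left := by
    have : Nonempty (geom S).left := ⟨ε.inv (genericPoint _)⟩
    exact isIntegral_of_isOpenImmersion ε.hom
  obtain ⟨g, rfl, hgn⟩ := exists_generator G hn hG
  have hg1 (m : ℕ) (hm : 0 < m) (hmn : m < n) : g ^ m ≠ 1 :=
    pow_ne_one_of_lt_orderOf hm.ne' (hgn ▸ hmn)
  have hg : g ≠ 1 := pow_one g ▸ hg1 1 one_pos hn
  have hgn' : g ^ n = 1 := hgn ▸ pow_orderOf_eq_one g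
  have hn0 : 0 < n := by lia
  obtain ⟨c, T, e, hlift, hT⟩ := exists_diagonal (PlaneCoords.ofIso (geom S) ε hε) g hn0 hgn'
  have he := hlift.eigenvalue_injective hnontriv hT hg
  have hloc : fixedLocus (Subgroup.zpowers g) = {x | ∃ j, c.IsVertex j x} := by
    ext x
    rw [mem_fixedLocus_zpowers (isOfFinOrder_iff_pow_eq_one.2 ⟨n, hn0, hgn'⟩)]
    exact IsLift.fixed_iff_isVertex (autMap_hom g) hlift hT he x
  have hclosed (x) (hx : x ∈ fixedLocus (Subgroup.zpowers g)) : IsClosed {x} := by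
    rw [hloc] at hx
    exact hx.choose_spec.isClosed
  have hcard : (fixedLocus (Subgroup.zpowers g)).ncard = 3 := by
    rw [hloc, c.ncard_setOf_isVertex]
  refine ⟨⟨(ncard_fixedGeomPoints hclosed).trans hcard, fixedLocus_eq_image hclosed,
    discreteTopology_of_isClosed_singleton (Set.finite_of_ncard_ne_zero (by lia)) hclosed⟩,
    fun hn3 ↦ ?_⟩
  -- The bound `n > 3` enters only through `g ^ 3 ≠ 1`.
  obtain ⟨K, h3, hgal, hcyc, hK⟩ :=
    hlift.exists_cubic hnontriv hT hg (hg1 3 (by lia) hn3) hn0 hgn'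
  refine ⟨K, h3, hgal, hcyc, fun p hp ↦ hK p ?_⟩
  rw [mem_fixedGeomPoints_iff, hloc] at hp
  exact hp
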